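/- **Setting.** Let $\mathbb K$ be a field of characteristic zero and $(X,\mathcal O)$ a ringed space over $\mathbb K$, i.e. $\mathcal O$ is a sheaf of commutative $\mathbb K$-algebras on the topological space $X$. Let $\mathcal L$ be a Lie algebroid over $(X,\mathcal O)$: a sheaf of $\mathcal O$-modules such that each $(\mathcal O(U),\mathcal L(U))$ is a Lie–Rinehart algebra over $\mathbb K$ and the restriction maps are morphisms of Lie–Rinehart algebras. Assume that $\mathcal L$ is locally free of constant finite rank $r$ as an $\mathcal O$-module. *Enveloping algebra.* For a Lie–Rinehart algebra $(R,L)$ let $U(L,R)$ be the unital associative $\mathbb K$-algebra generated by the algebra $R$ and the Lie algebra $L$ with relations $a\cdot x=ax$ and $x\cdot a-a\cdot x=x(a)$ ($a\in R$, $x\in L$). It acts on $R$, $D\mapsto D(a)$, with counit $\epsilon(D)=D(1)$, and has the cocommutative coproduct $\Delta$ over $R$ (for left multiplication) determined by $\Delta(a)=a\otimes 1$, $\Delta(x)=x\otimes1+1\otimes x$ and multiplicativity; write $\Delta(D)=D_{(1)}\otimes D_{(2)}$. Let $\mathcal U(\mathcal L)$ be the sheaf associated with the presheaf $U\mapsto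 U(\mathcal L(U),\mathcal O(U))$. *Jets.* Let $\mathcal J(\mathcal L)=\mathcal Hom_{\mathcal O}(\mathcal U(\mathcal L),\mathcal O)$ (left multiplication on $\mathcal U(\mathcal L)$). It is a sheaf of commutative algebras with $(\phi\psi)(D)=\phi(D_{(1)})\psi(D_{(2)})$ and unit $\epsilon$. Its first $\mathcal O$-module structure is $(a\phi)(D)=a\,\phi(D)$; together with the flat connection $(\nabla^{(1)}_x\phi)(D)=x(\phi(D))-\phi(xD)$, $x\in\mathcal L$, it gives the first $\mathcal U(\mathcal L)$-module structure on $\mathcal J(\mathcal L)$. The second, commuting one is $(D\cdot_2\phi)(E)=\phi(ED)$. *Differential operators.* Let $\mathrm{Diff}_{\mathcal O_{X_1}}(\mathcal J(\mathcal L))$ be the sheaf of differential operators on the sheaf of commutative algebras $\mathcal J(\mathcal L)$ which are linear for the first $\mathcal O$-module structure: over $U$, its sections are the $\mathcal O$-linear endomorphisms $P$ of $\mathcal J(\mathcal L)|_U$ which locally on $U$ have finite order, i.e. every point of $U$ has a neighbourhood $V\subseteq U$ and an $n$ such that, over every open subset of $V$, all $(n+1)$-fold iterated commutators of $P$ with multiplication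 operators vanish. It is a sheaf of algebras under composition, and carries the flat $\mathcal L$-connection $\nabla_xP=[\nabla^{(1)}_x,P]$ induced by the first module structure. *Chevalley–Eilenberg complex.* Let $\Omega^p_{\mathcal L_1}(\mathrm{Diff}_{\mathcal O_{X_1}}(\mathcal J(\mathcal L)))$ be the sheaf of alternating $\mathcal O$-multilinear maps $\mathcal L\times\cdots\times\mathcal L\to \mathrm{Diff}_{\mathcal O_{X_1}}(\mathcal J(\mathcal L))$ in $p$ arguments (for the first $\mathcal O$-module structure), with the differential $$(d\omega)(x_0,\dots,x_p)=\sum_i(-1)^i\nabla_{x_i}\bigl(\omega(x_0,\dots,\widehat{x_i},\dots,x_p)\bigr)+\sum_{i<j}(-1)^{i+j}\omega([x_i,x_j],x_0,\dots,\widehat{x_i},\dots,\widehat{x_j},\dots,x_p)$$ and the product $$(\omega\eta)(x_1,\dots,x_{p+q})=\sum_{\sigma}\mathrm{sgn}(\sigma)\,\omega(x_{\sigma(1)},\dots,x_{\sigma(p)})\circ\eta(x_{\sigma(p+1)},\dots,x_{\sigma(p+q)}),$$ the sum being over $(p,q)$-shuffles. **Proposition.** (i) With this differential and product, $\Omega^\bullet_{\mathcal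 L_1}(\mathrm{Diff}_{\mathcal O_{X_1}}(\mathcal J(\mathcal L)))$ is a sheaf of differential graded $\mathbb K$-algebras: each $\Omega^p_{\mathcal L_1}$ is a sheaf, the product is associative and unital, $d^2=0$, $d(\omega\eta)=d\omega\,\eta+(-1)^p\omega\,d\eta$ for $\omega$ of degree $p$, and the restriction maps are compatible with these structures. (ii) The inclusion $\mathcal U(\mathcal L)\to\Omega^\bullet_{\mathcal L_1}(\mathrm{Diff}_{\mathcal O_{X_1}}(\mathcal J(\mathcal L)))$, which sends $D$ to the $0$-form $\phi\mapsto D\cdot_2\phi$ ($\mathcal U(\mathcal L)$ being placed in degree $0$), is a quasi-isomorphism of complexes of sheaves of $\mathbb K$-vector spaces. -/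

import Mathlib

open CategoryTheory TopologicalSpace Opposite
open scoped TensorProduct

universe u

set_option linter.unusedSectionVars false

noncomputable section

namespace LieRinehart

section Enveloping

variable (K R L : Type*) [CommRing K] [CommRing R] [Algebra K R] [LieRing L] [LieAlgebra K L]
  [Module R L] [LieRingModule L R]

/-- The defining relations of the universal enveloping algebra of a Lie–Rinehart algebra `(R, L)`
over `K`, imposed on the free `K`-algebra on `R ⊕ L`. -/
inductive EnvRel : FreeAlgebra K (R ⊕ L) → FreeAlgebra K (R ⊕ L) → Prop
  | add_fn (a b : R) : EnvRel (FreeAlgebra.ι K (.inl (a + b)))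
      (FreeAlgebra.ι K (.inl a) + FreeAlgebra.ι K (.inl b))
  | mul_fn (a b : R) : EnvRel (FreeAlgebra.ι K (.inl (a * b)))
      (FreeAlgebra.ι K (.inl a) * FreeAlgebra.ι K (.inl b))
  | scalar (c : K) : EnvRel (FreeAlgebra.ι K (.inl (algebraMap K R c)))
      (algebraMap K (FreeAlgebra K (R ⊕ L)) c)
  | add_vec (x y : L) : EnvRel (FreeAlgebra.ι K (.inr (x + y)))
      (FreeAlgebra.ι K (.inr x) + FreeAlgebra.ι K (.inr y))
  | smul_vec (a : R) (x : L) : EnvRel (FreeAlgebra.ι K (.inr (a • x)))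
      (FreeAlgebra.ι K (.inl a) * FreeAlgebra.ι K (.inr x))
  | lie_vec (x y : L) : EnvRel (FreeAlgebra.ι K (.inr ⁅x, y⁆))
      (FreeAlgebra.ι K (.inr x) * FreeAlgebra.ι K (.inr y) -
        FreeAlgebra.ι K (.inr y) * FreeAlgebra.ι K (.inr x))
  | lie_fn (x : L) (a : R) : EnvRel (FreeAlgebra.ι K (.inr x) * FreeAlgebra.ι K (.inl a))
      (FreeAlgebra.ι K (.inl a) * FreeAlgebra.ι K (.inr x) + FreeAlgebra.ι K (.inl ⁅x, a⁆))

/-- The universal enveloping algebra `U(L, R)`: the unital associative `K`-algebra generated by the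
algebra `R` and the Lie algebra `L` subject to `a · x = a x` and `x · a - a · x = x(a)`. -/
def Env : Type _ := RingQuot (EnvRel K R L)

namespace Env

instance : Ring (Env K R L) := inferInstanceAs (Ring (RingQuot (EnvRel K R L)))

instance : Algebra K (Env K R L) := inferInstanceAs (Algebra K (RingQuot (EnvRel K R L)))

/-- The canonical map `R → U(L, R)`. -/
def fn : R →ₐ[K] Env K R L where
  toFun a := RingQuot.mkAlgHom K (EnvRel K R L) (FreeAlgebra.ι K (.inl a))
  map_one' := by
    have h := RingQuot.mkAlgHom_rel K (EnvRel.scalar (K := K) (R := R) (L := L) 1)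
    simp only [map_one] at h
    exact h
  map_mul' a b := (RingQuot.mkAlgHom_rel K (EnvRel.mul_fn a b)).trans (map_mul _ _ _)
  map_zero' := by
    have h := RingQuot.mkAlgHom_rel K (EnvRel.scalar (K := K) (R := R) (L := L) 0)
    simp only [map_zero] at h
    exact h
  map_add' a b := (RingQuot.mkAlgHom_rel K (EnvRel.add_fn a b)).trans (map_add _ _ _)
  commutes' c := (RingQuot.mkAlgHom_rel K (EnvRel.scalar c)).trans (AlgHom.commutes _ _)

variable {R L} in
/-- The canonical map `L → U(L, R)`. -/
def vec (x : L) : Env K R L :=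
  RingQuot.mkAlgHom K (EnvRel K R L) (FreeAlgebra.ι K (.inr x))

variable {K R L}

theorem vec_add (x y : L) : vec K (R := R) (x + y) = vec K x + vec K y :=
  (RingQuot.mkAlgHom_rel K (EnvRel.add_vec x y)).trans (map_add _ _ _)

theorem vec_smul (a : R) (x : L) : vec K (a • x) = fn K R L a * vec K x :=
  (RingQuot.mkAlgHom_rel K (EnvRel.smul_vec a x)).trans (map_mul _ _ _)

theorem vec_lie (x y : L) :
    vec K (R := R) ⁅x, y⁆ = vec K x * vec K y - vec K y * vec K x :=
  (RingQuot.mkAlgHom_rel K (EnvRel.lie_vec x y)).trans (by rw [map_sub, map_mul, map_mul]; rfl)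

theorem vec_mul_fn (x : L) (a : R) :
    vec K x * fn K R L a = fn K R L a * vec K x + fn K R L ⁅x, a⁆ := by
  have h := RingQuot.mkAlgHom_rel K (EnvRel.lie_fn (K := K) x a)
  rw [map_add, map_mul, map_mul] at h
  exact h

/-- The universal property of the enveloping algebra. -/
def lift {A : Type*} [Ring A] [Algebra K A] (f : R →ₐ[K] A) (g : L →+ A)
    (hsmul : ∀ (a : R) (x : L), g (a • x) = f a * g x)
    (hlie : ∀ x y : L, g ⁅x, y⁆ = g x * g y - g y * g x)
    (hfn : ∀ (x : L) (a : R), g x * f a = f a * g x + f ⁅x, a⁆) : Env K R L →ₐ[K] A :=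
  RingQuot.liftAlgHom K ⟨FreeAlgebra.lift K (Sum.elim f g), by
    intro p q h
    cases h <;> simp [hsmul, hlie, hfn]⟩

section lift

variable {A : Type*} [Ring A] [Algebra K A] (f : R →ₐ[K] A) (g : L →+ A)
    (hsmul : ∀ (a : R) (x : L), g (a • x) = f a * g x)
    (hlie : ∀ x y : L, g ⁅x, y⁆ = g x * g y - g y * g x)
    (hfn : ∀ (x : L) (a : R), g x * f a = f a * g x + f ⁅x, a⁆)

@[simp] theorem lift_fn (a : R) : lift f g hsmul hlie hfn (fn K R L a) = f a := by
  change RingQuot.liftAlgHom K _ (RingQuot.mkAlgHom K _ _) = _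
  simp

@[simp] theorem lift_vec (x : L) : lift f g hsmul hlie hfn (vec K x) = g x := by
  change RingQuot.liftAlgHom K _ (RingQuot.mkAlgHom K _ _) = _
  simp

end lift

theorem algHom_ext {A : Type*} [Ring A] [Algebra K A] {F G : Env K R L →ₐ[K] A}
    (hf : ∀ a, F (fn K R L a) = G (fn K R L a)) (hv : ∀ x, F (vec K x) = G (vec K x)) :
    F = G := by
  refine RingQuot.ringQuot_ext' (S := K) (s := EnvRel K R L) F G (FreeAlgebra.hom_ext ?_)
  funext s
  rcases s with a | x
  · exact hf a
  · exact hv x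

/-- A subalgebra of the enveloping algebra containing `R` and `L` is everything. -/
theorem mem_of_generators (S : Subalgebra K (Env K R L)) (hf : ∀ a, fn K R L a ∈ S)
    (hv : ∀ x, vec K x ∈ S) (D : Env K R L) : D ∈ S := by
  let f : R →ₐ[K] S := (fn K R L).codRestrict S hf
  let g : L →+ S := AddMonoidHom.mk' (fun x ↦ ⟨vec K x, hv x⟩)
    (fun x y ↦ Subtype.ext (vec_add x y))
  let F : Env K R L →ₐ[K] S := lift f g
    (fun a x ↦ Subtype.ext (vec_smul a x)) (fun x y ↦ Subtype.ext (vec_lie x y))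
    (fun x a ↦ Subtype.ext (vec_mul_fn x a))
  have h : S.val.comp F = AlgHom.id K _ := by
    refine algHom_ext (fun a ↦ ?_) (fun x ↦ ?_)
    · simp [F, f]
    · simp [F, g]
  have := congrArg (fun φ ↦ φ D) h
  simp only [AlgHom.comp_apply, AlgHom.id_apply] at this
  rw [← this]
  exact (F D).2

/-- Induction on words, adding letters on the right. -/
theorem induction_right {p : Env K R L → Prop} (one : p 1)
    (add : ∀ D E, p D → p E → p (D + E))
    (mul_fn : ∀ D a, p D → p (D * fn K R L a)) (mul_vec : ∀ D x, p D → p (D * vec K x))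
    (D : Env K R L) : p D := by
  have key : ∀ E D : Env K R L, p D → p (D * E) := by
    let S : Subalgebra K (Env K R L) :=
      { carrier := {E | ∀ D, p D → p (D * E)}
        mul_mem' := fun {E F} hE hF D hD ↦ by rw [← mul_assoc]; exact hF _ (hE _ hD)
        add_mem' := fun {E F} hE hF D hD ↦ by rw [mul_add]; exact add _ _ (hE _ hD) (hF _ hD)
        algebraMap_mem' := fun c D hD ↦ by
          have := mul_fn D (algebraMap K R c) hD
          rwa [AlgHom.commutes] at this }
    exact fun E ↦ mem_of_generators S (fun a D ↦ mul_fn D a) (fun x D ↦ mul_vec D x) E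
  simpa using key D 1 one

/-- `U(L, R)` is an `R`-module by left multiplication. -/
instance : Module R (Env K R L) := Module.compHom _ (fn K R L).toRingHom

theorem smul_def (a : R) (D : Env K R L) : a • D = fn K R L a * D := rfl

instance : IsScalarTower K R (Env K R L) where
  smul_assoc c a D := by simp [smul_def]

instance : SMulCommClass R K (Env K R L) where
  smul_comm a c D := by simp [smul_def]

instance : IsScalarTower R (Env K R L) (Env K R L) where
  smul_assoc a D E := by simp [smul_def, mul_assoc]

end Env

variable [LieRinehartRing R L] [LieRinehartAlgebra K R L]

namespace Env

/-- The action of `U(L, R)` on `R`, written `D(a)`. -/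
def act : Env K R L →ₐ[K] Module.End K R :=
  lift (Algebra.lmul K R) (LieModule.toEnd K L R : L →ₗ[K] Module.End K R).toAddMonoidHom
    (fun a x ↦ by ext b; simp) (fun x y ↦ by ext b; simp)
    (fun x a ↦ by ext b; simp)

/-- The counit `ε(D) = D(1)`. -/
def counit : Env K R L →ₗ[R] R where
  toFun D := act K R L D 1
  map_add' D E := by simp
  map_smul' a D := by simp [smul_def, act]

/-- `x · (D ⊗ E) = x D ⊗ E + D ⊗ x E` for `x ∈ L`, on the tensor product of left `R`-modules. -/
def tensorVec (x : L) : Module.End K (Env K R L ⊗[R] Env K R L) :=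
  let h : Env K R L ⊗[R] Env K R L →+ Env K R L ⊗[R] Env K R L :=
    TensorProduct.liftAddHom
      { toFun := fun D ↦
          { toFun := fun E ↦ (vec K x * D) ⊗ₜ[R] E + D ⊗ₜ[R] (vec K x * E)
            map_zero' := by simp
            map_add' := fun E F ↦ by simp only [mul_add, TensorProduct.tmul_add]; abel }
        map_zero' := by ext; simp
        map_add' := fun D E ↦ by
          ext F
          simp only [mul_add, TensorProduct.add_tmul, AddMonoidHom.coe_mk, ZeroHom.coe_mk,
            AddMonoidHom.add_apply]
          abel }
      (fun a D E ↦ by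
        simp only [AddMonoidHom.coe_mk, ZeroHom.coe_mk, smul_def, ← mul_assoc, vec_mul_fn, add_mul,
          TensorProduct.add_tmul, TensorProduct.tmul_add]
        simp only [mul_assoc]
        simp only [← smul_def, TensorProduct.smul_tmul]
        abel)
  { toFun := h
    map_add' := map_add h
    map_smul' := fun c t ↦ by
      induction t with
      | zero => simp
      | add s t hs ht => simp only [smul_add, map_add, hs, ht]
      | tmul D E =>
        simp [h, TensorProduct.smul_tmul'] }

variable {K R L} in
@[simp] theorem tensorVec_tmul (x : L) (D E : Env K R L) :
    tensorVec K R L x (D ⊗ₜ E) = (vec K x * D) ⊗ₜ[R] E + D ⊗ₜ[R] (vec K x * E) := rfl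

/-- The diagonal left action of `U(L, R)` on `U(L, R) ⊗_R U(L, R)`. -/
def tensorAct : Env K R L →ₐ[K] Module.End K (Env K R L ⊗[R] Env K R L) :=
  lift (Algebra.lsmul K K (Env K R L ⊗[R] Env K R L))
    (AddMonoidHom.mk' (tensorVec K R L) (fun x y ↦ by
      ext t
      induction t with
      | zero => simp
      | add s t hs ht => simp only [map_add, hs, ht]
      | tmul D E =>
        simp only [tensorVec_tmul, vec_add, add_mul, TensorProduct.add_tmul,
          TensorProduct.tmul_add, LinearMap.add_apply]
        abel))
    (fun a x ↦ by
      ext t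
      induction t with
      | zero => simp
      | add s t hs ht => simp only [map_add, hs, ht]
      | tmul D E =>
        have h : a • D ⊗ₜ[R] (vec K x * E) = D ⊗ₜ[R] (a • (vec K x * E)) := by simp
        simp only [AddMonoidHom.mk'_apply, tensorVec_tmul, vec_smul, mul_assoc,
          Module.End.mul_apply, Algebra.lsmul_coe, smul_add, h]
        simp only [TensorProduct.smul_tmul', smul_def])
    (fun x y ↦ by
      ext t
      induction t with
      | zero => simp
      | add s t hs ht => simp only [map_add, hs, ht]
      | tmul D E =>
        simp only [AddMonoidHom.mk'_apply, tensorVec_tmul, vec_lie, sub_mul, TensorProduct.sub_tmul,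
          TensorProduct.tmul_sub, LinearMap.sub_apply, Module.End.mul_apply, map_add, mul_assoc]
        abel)
    (fun x a ↦ by
      ext t
      induction t with
      | zero => simp
      | add s t hs ht => simp only [map_add, hs, ht]
      | tmul D E =>
        simp only [AddMonoidHom.mk'_apply, Module.End.mul_apply, LinearMap.add_apply,
          Algebra.lsmul_coe, tensorVec_tmul, TensorProduct.smul_tmul', smul_def, smul_add,
          ← mul_assoc, vec_mul_fn, add_mul, TensorProduct.add_tmul]
        abel)

/-- The coproduct `Δ : U(L, R) → U(L, R) ⊗_R U(L, R)`, `Δ(D) = D · (1 ⊗ 1)`; so `Δ(a) = a ⊗ 1`,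
`Δ(x) = x ⊗ 1 + 1 ⊗ x`, and `Δ(x D) = x D₁ ⊗ D₂ + D₁ ⊗ x D₂`. -/
def comul : Env K R L →ₗ[R] Env K R L ⊗[R] Env K R L where
  toFun D := tensorAct K R L D (1 ⊗ₜ 1)
  map_add' D E := by simp
  map_smul' a D := by simp [smul_def, tensorAct]

end Env

end Enveloping

section Jets

variable (K R L : Type*) [CommRing K] [CommRing R] [Algebra K R] [LieRing L] [LieAlgebra K L]
  [Module R L] [LieRingModule L R]

namespace Env

variable {K R L} in
/-- Right multiplication, a map of left `R`-modules. -/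
def rmul (E : Env K R L) : Env K R L →ₗ[R] Env K R L where
  toFun D := D * E
  map_add' D F := add_mul D F E
  map_smul' a D := by simp [smul_def, mul_assoc]

@[simp] theorem rmul_apply (D E : Env K R L) : rmul E D = D * E := rfl

variable [LieRinehartRing R L] [LieRinehartAlgebra K R L]

variable {K R L}

theorem act_fn (a b : R) : act K R L (fn K R L a) b = a * b := by simp [act]

theorem act_vec (x : L) (b : R) : act K R L (vec K x) b = ⁅x, b⁆ := by simp [act]

theorem counit_apply (D : Env K R L) : counit K R L D = act K R L D 1 := rfl

theorem comul_apply (D : Env K R L) : comul K R L D = tensorAct K R L D (1 ⊗ₜ 1) := rfl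

theorem counit_one : counit K R L 1 = 1 := by simp [counit_apply]

theorem counit_mul_fn (D : Env K R L) (a : R) : counit K R L (D * fn K R L a) = act K R L D a := by
  simp [counit_apply, act_fn]

theorem lie_one (x : L) : ⁅x, (1 : R)⁆ = 0 := by
  have := LieRinehartRing.leibniz_mul_right x (1 : R) 1
  simpa using this

theorem counit_mul_vec (D : Env K R L) (x : L) : counit K R L (D * vec K x) = 0 := by
  simp [counit_apply, act_vec, lie_one]

theorem counit_vec_mul (D : Env K R L) (x : L) :
    counit K R L (vec K x * D) = ⁅x, counit K R L D⁆ := by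
  simp [counit_apply, act_vec]

theorem tensorAct_fn (a : R) (t : Env K R L ⊗[R] Env K R L) :
    tensorAct K R L (fn K R L a) t = a • t := by simp [tensorAct]

theorem tensorAct_vec (x : L) (t : Env K R L ⊗[R] Env K R L) :
    tensorAct K R L (vec K x) t = tensorVec K R L x t := by simp [tensorAct]

theorem tensorAct_map_rmul (D E F : Env K R L) (t : Env K R L ⊗[R] Env K R L) :
    tensorAct K R L D (TensorProduct.map (rmul E) (rmul F) t) =
      TensorProduct.map (rmul E) (rmul F) (tensorAct K R L D t) := by
  let S : Subalgebra K (Env K R L) :=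
    { carrier := {D | ∀ t, tensorAct K R L D (TensorProduct.map (rmul E) (rmul F) t) =
        TensorProduct.map (rmul E) (rmul F) (tensorAct K R L D t)}
      mul_mem' := fun {D D'} h h' t ↦ by
        simp only [map_mul, Module.End.mul_apply]
        rw [h', h]
      add_mem' := fun {D D'} h h' t ↦ by
        simp only [map_add, LinearMap.add_apply]
        rw [h', h]
      algebraMap_mem' := fun c t ↦ by
        rw [← AlgHom.commutes (fn K R L), tensorAct_fn, tensorAct_fn, map_smul] }
  refine mem_of_generators S (fun a t ↦ ?_) (fun x t ↦ ?_) D t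
  · rw [tensorAct_fn, tensorAct_fn, map_smul]
  · rw [tensorAct_vec, tensorAct_vec]
    induction t with
    | zero => simp
    | add s t hs ht => simp only [map_add, hs, ht]
    | tmul D E => simp [mul_assoc]

theorem comul_one : comul K R L 1 = 1 ⊗ₜ 1 := by simp [comul_apply]

theorem comul_mul (D E : Env K R L) : comul K R L (D * E) = tensorAct K R L D (comul K R L E) := by
  simp [comul_apply]

theorem comul_fn_left (a : R) :
    comul K R L (fn K R L a) = TensorProduct.map (rmul (fn K R L a)) (rmul 1) (1 ⊗ₜ 1) := by
  simp only [comul_apply, tensorAct_fn]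
  simp [TensorProduct.smul_tmul', smul_def]

theorem comul_fn_right (a : R) :
    comul K R L (fn K R L a) = TensorProduct.map (rmul 1) (rmul (fn K R L a)) (1 ⊗ₜ 1) := by
  simp only [comul_apply, tensorAct_fn]
  simp [← TensorProduct.tmul_smul, smul_def]

theorem comul_mul_fn_left (D : Env K R L) (a : R) : comul K R L (D * fn K R L a) =
    TensorProduct.map (rmul (fn K R L a)) (rmul 1) (comul K R L D) := by
  rw [comul_mul, comul_fn_left, tensorAct_map_rmul]
  rfl

theorem comul_mul_fn_right (D : Env K R L) (a : R) : comul K R L (D * fn K R L a) =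
    TensorProduct.map (rmul 1) (rmul (fn K R L a)) (comul K R L D) := by
  rw [comul_mul, comul_fn_right, tensorAct_map_rmul]
  rfl

theorem comul_mul_vec (D : Env K R L) (x : L) : comul K R L (D * vec K x) =
    TensorProduct.map (rmul (vec K x)) (rmul 1) (comul K R L D) +
      TensorProduct.map (rmul 1) (rmul (vec K x)) (comul K R L D) := by
  have h : comul K R L (vec K x) = TensorProduct.map (rmul (vec K x)) (rmul 1) (1 ⊗ₜ 1) +
      TensorProduct.map (rmul 1) (rmul (vec K x)) (1 ⊗ₜ 1) := by
    simp only [comul_apply, tensorAct_vec]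
    simp
  rw [comul_mul, h, map_add, tensorAct_map_rmul, tensorAct_map_rmul]
  rfl

theorem comul_vec_mul (D : Env K R L) (x : L) : comul K R L (vec K x * D) =
    tensorVec K R L x (comul K R L D) := by
  rw [comul_mul, tensorAct_vec]

end Env

/-- The jets of a Lie–Rinehart algebra: the left `R`-linear dual of the enveloping algebra. -/
def Jet : Type _ := Env K R L →ₗ[R] R

namespace Jet

instance : AddCommGroup (Jet K R L) := inferInstanceAs (AddCommGroup (Env K R L →ₗ[R] R))

instance {S : Type*} [CommRing S] [Algebra S R] : Module S (Jet K R L) :=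
  inferInstanceAs (Module S (Env K R L →ₗ[R] R))

instance : FunLike (Jet K R L) (Env K R L) R :=
  inferInstanceAs (FunLike (Env K R L →ₗ[R] R) (Env K R L) R)

instance : LinearMapClass (Jet K R L) R (Env K R L) R :=
  inferInstanceAs (LinearMapClass (Env K R L →ₗ[R] R) R (Env K R L) R)

variable {K R L}

@[ext] theorem ext {φ ψ : Jet K R L} (h : ∀ D, φ D = ψ D) : φ = ψ := DFunLike.ext _ _ h

@[simp] theorem add_apply (φ ψ : Jet K R L) (D : Env K R L) : (φ + ψ) D = φ D + ψ D := rfl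

@[simp] theorem sub_apply (φ ψ : Jet K R L) (D : Env K R L) : (φ - ψ) D = φ D - ψ D := rfl

@[simp] theorem zero_apply (D : Env K R L) : (0 : Jet K R L) D = 0 := rfl

@[simp] theorem smul_apply {S : Type*} [CommRing S] [Algebra S R] (c : S) (φ : Jet K R L)
    (D : Env K R L) : (c • φ) D = c • φ D := rfl

theorem map_fn_mul (φ : Jet K R L) (a : R) (D : Env K R L) : φ (Env.fn K R L a * D) = a * φ D :=
  map_smul φ a D

instance : IsScalarTower K R (Jet K R L) where
  smul_assoc c a φ := by ext D; simp

/-- The second module structure on jets, `(D ·₂ φ)(E) = φ(E D)`. -/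
def actTwo : Env K R L →ₐ[K] Module.End R (Jet K R L) where
  toFun D :=
    { toFun := fun φ ↦ (φ : Env K R L →ₗ[R] R).comp (Env.rmul D)
      map_add' := fun _ _ ↦ rfl
      map_smul' := fun _ _ ↦ rfl }
  map_one' := by
    ext φ E
    change φ (E * 1) = φ E
    rw [mul_one]
  map_mul' D D' := by
    ext φ E
    change φ (E * (D * D')) = φ (E * D * D')
    rw [mul_assoc]
  map_zero' := by
    ext φ E
    change φ (E * 0) = 0
    rw [mul_zero, map_zero]
  map_add' D D' := by
    ext φ E
    change φ (E * (D + D')) = φ (E * D) + φ (E * D')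
    rw [mul_add, map_add]
  commutes' c := by
    ext φ E
    change φ (E * algebraMap K _ c) = c • φ E
    rw [← Algebra.commutes, ← AlgHom.commutes (Env.fn K R L), map_fn_mul, Algebra.smul_def]

@[simp] theorem actTwo_apply (D : Env K R L) (φ : Jet K R L) (E : Env K R L) :
    actTwo D φ E = φ (E * D) := rfl

variable [LieRinehartRing R L] [LieRinehartAlgebra K R L]

/-- The product of jets, `(φ ψ)(D) = φ(D₁) ψ(D₂)` where `Δ(D) = D₁ ⊗ D₂`. -/
instance : Mul (Jet K R L) :=
  ⟨fun φ ψ ↦ (LinearMap.mul' R R ∘ₗ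
    TensorProduct.map (φ : Env K R L →ₗ[R] R) (ψ : Env K R L →ₗ[R] R)) ∘ₗ Env.comul K R L⟩

/-- The unit of the algebra of jets is the counit of the enveloping algebra. -/
instance : One (Jet K R L) := ⟨Env.counit K R L⟩

/-- The pairing of two jets with an element of `U ⊗ U`. -/
def pair (φ ψ : Jet K R L) : Env K R L ⊗[R] Env K R L →ₗ[R] R :=
  LinearMap.mul' R R ∘ₗ TensorProduct.map (φ : Env K R L →ₗ[R] R) (ψ : Env K R L →ₗ[R] R)

@[simp] theorem pair_tmul (φ ψ : Jet K R L) (D E : Env K R L) :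
    pair φ ψ (D ⊗ₜ E) = φ D * ψ E := rfl

theorem mul_apply (φ ψ : Jet K R L) (D : Env K R L) : (φ * ψ) D = pair φ ψ (Env.comul K R L D) :=
  rfl

theorem one_apply (D : Env K R L) : (1 : Jet K R L) D = Env.counit K R L D := rfl

theorem pair_map (φ ψ : Jet K R L) (D E : Env K R L) (t : Env K R L ⊗[R] Env K R L) :
    pair φ ψ (TensorProduct.map (Env.rmul D) (Env.rmul E) t) =
      pair (actTwo D φ) (actTwo E ψ) t := by
  induction t with
  | zero => simp
  | add s t hs ht => simp only [map_add, hs, ht]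
  | tmul D E => simp

theorem mul_apply_one (φ ψ : Jet K R L) : (φ * ψ) 1 = φ 1 * ψ 1 := by
  simp [mul_apply, Env.comul_one]

theorem actTwo_fn_mul (a : R) (φ ψ : Jet K R L) :
    actTwo (Env.fn K R L a) (φ * ψ) = actTwo (Env.fn K R L a) φ * ψ := by
  ext D
  simp [mul_apply, Env.comul_mul_fn_left, pair_map]

theorem actTwo_fn_mul' (a : R) (φ ψ : Jet K R L) :
    actTwo (Env.fn K R L a) (φ * ψ) = φ * actTwo (Env.fn K R L a) ψ := by
  ext D
  simp [mul_apply, Env.comul_mul_fn_right, pair_map]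

theorem actTwo_vec_mul (x : L) (φ ψ : Jet K R L) :
    actTwo (Env.vec K x) (φ * ψ) = actTwo (Env.vec K x) φ * ψ + φ * actTwo (Env.vec K x) ψ := by
  ext D
  simp [mul_apply, Env.comul_mul_vec, pair_map]

protected theorem add_mul (φ ψ χ : Jet K R L) : (φ + ψ) * χ = φ * χ + ψ * χ := by
  have : pair (φ + ψ) χ = pair φ χ + pair ψ χ := by
    ext D E
    simp [add_mul]
  ext D
  simp [mul_apply, this]

protected theorem mul_add (φ ψ χ : Jet K R L) : φ * (ψ + χ) = φ * ψ + φ * χ := by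
  have : pair φ (ψ + χ) = pair φ ψ + pair φ χ := by
    ext D E
    simp [mul_add]
  ext D
  simp [mul_apply, this]

protected theorem smul_mul {S : Type*} [CommRing S] [Algebra S R] (c : S) (φ ψ : Jet K R L) :
    (c • φ) * ψ = c • (φ * ψ) := by
  have : pair (c • φ) ψ = c • pair φ ψ := by
    ext D E
    simp
  ext D
  simp [mul_apply, this]

protected theorem mul_comm (φ ψ : Jet K R L) : φ * ψ = ψ * φ := by
  ext D
  induction D using Env.induction_right generalizing φ ψ with
  | one => rw [mul_apply_one, mul_apply_one, mul_comm]
  | add D E hD hE => rw [map_add, map_add, hD, hE]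
  | mul_fn D a h =>
    rw [← actTwo_apply, ← actTwo_apply, actTwo_fn_mul, actTwo_fn_mul', h]
  | mul_vec D x h =>
    rw [← actTwo_apply, ← actTwo_apply, actTwo_vec_mul, actTwo_vec_mul, add_apply, add_apply,
      h, h φ, add_comm]

protected theorem mul_assoc (φ ψ χ : Jet K R L) : φ * ψ * χ = φ * (ψ * χ) := by
  ext D
  induction D using Env.induction_right generalizing φ ψ χ with
  | one => simp only [mul_apply_one, mul_assoc]
  | add D E hD hE => rw [map_add, map_add, hD, hE]
  | mul_fn D a h =>
    rw [← actTwo_apply, ← actTwo_apply, actTwo_fn_mul, actTwo_fn_mul, actTwo_fn_mul, h]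
  | mul_vec D x h =>
    rw [← actTwo_apply, ← actTwo_apply]
    simp only [actTwo_vec_mul, Jet.add_mul, Jet.mul_add, add_apply, h]
    abel

protected theorem one_mul (φ : Jet K R L) : 1 * φ = φ := by
  ext D
  induction D using Env.induction_right generalizing φ with
  | one => rw [mul_apply_one, one_apply, Env.counit_one, one_mul]
  | add D E hD hE => rw [map_add, map_add, hD, hE]
  | mul_fn D a h =>
    rw [← actTwo_apply, actTwo_fn_mul', h, actTwo_apply]
  | mul_vec D x h =>
    have h0 : actTwo (Env.vec K x) (1 : Jet K R L) = 0 := by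
      ext E
      rw [actTwo_apply, one_apply, Env.counit_mul_vec, zero_apply]
    have h1 : (0 : Jet K R L) * φ = 0 := by
      have := Jet.add_mul (0 : Jet K R L) 0 φ
      simpa using this
    rw [← actTwo_apply, actTwo_vec_mul, h0, h1, zero_add, h, actTwo_apply]

instance : CommRing (Jet K R L) :=
  { (inferInstance : AddCommGroup (Jet K R L)) with
    mul := (· * ·)
    one := 1
    left_distrib := Jet.mul_add
    right_distrib := Jet.add_mul
    zero_mul := fun φ ↦ by
      have := Jet.add_mul (0 : Jet K R L) 0 φ
      simpa using this
    mul_zero := fun φ ↦ by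
      have := Jet.mul_add φ (0 : Jet K R L) 0
      simpa using this
    mul_assoc := Jet.mul_assoc
    one_mul := Jet.one_mul
    mul_one := fun φ ↦ by rw [Jet.mul_comm, Jet.one_mul]
    mul_comm := Jet.mul_comm }

/-- The algebra structure of jets over `R` given by `α₁`: `(a φ)(D) = a φ(D)`. -/
instance {S : Type*} [CommRing S] [Algebra S R] : Algebra S (Jet K R L) :=
  Algebra.ofModule Jet.smul_mul
    (fun c φ ψ ↦ by rw [mul_comm, Jet.smul_mul, mul_comm])

/-- The first flat connection on jets, `(∇⁽¹⁾ₓ φ)(D) = x(φ(D)) - φ(x D)`. -/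
def conn : L →ₗ[R] Module.End K (Jet K R L) where
  toFun x :=
    { toFun := fun φ ↦ show Env K R L →ₗ[R] R from
        { toFun := fun D ↦ ⁅x, φ D⁆ - φ (Env.vec K x * D)
          map_add' := fun D E ↦ by
            rw [map_add, mul_add, map_add, lie_add]
            abel
          map_smul' := fun a D ↦ by
            rw [map_smul, smul_eq_mul, LieRinehartRing.leibniz_mul_right, Env.smul_def,
              ← mul_assoc, Env.vec_mul_fn, add_mul, mul_assoc, map_add, map_fn_mul, map_fn_mul]
            simp only [RingHom.id_apply, smul_eq_mul]
            ring }
      map_add' := fun φ ψ ↦ by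
        ext D
        change ⁅x, φ D + ψ D⁆ - (φ (Env.vec K x * D) + ψ (Env.vec K x * D)) =
          (⁅x, φ D⁆ - φ (Env.vec K x * D)) + (⁅x, ψ D⁆ - ψ (Env.vec K x * D))
        rw [lie_add]
        abel
      map_smul' := fun c φ ↦ by
        ext D
        change ⁅x, c • φ D⁆ - c • φ (Env.vec K x * D) = c • (⁅x, φ D⁆ - φ (Env.vec K x * D))
        rw [show ⁅x, c • φ D⁆ = c • ⁅x, φ D⁆ from lie_smul c x (φ D), smul_sub] }
  map_add' x y := by
    ext φ D
    change ⁅x + y, φ D⁆ - φ (Env.vec K (x + y) * D) =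
      (⁅x, φ D⁆ - φ (Env.vec K x * D)) + (⁅y, φ D⁆ - φ (Env.vec K y * D))
    rw [add_lie, Env.vec_add, add_mul, map_add]
    abel
  map_smul' a x := by
    ext φ D
    change ⁅a • x, φ D⁆ - φ (Env.vec K (a • x) * D) = a • (⁅x, φ D⁆ - φ (Env.vec K x * D))
    rw [LieRinehartRing.lie_smul_eq_mul, Env.vec_smul, mul_assoc, map_fn_mul, smul_eq_mul, mul_sub]

theorem conn_apply (x : L) (φ : Jet K R L) (D : Env K R L) :
    conn x φ D = ⁅x, φ D⁆ - φ (Env.vec K x * D) := rfl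

theorem conn_smul (x : L) (a : R) (φ : Jet K R L) :
    conn x (a • φ) = a • conn x φ + ⁅x, a⁆ • φ := by
  ext D
  simp only [conn_apply, smul_apply, add_apply, smul_eq_mul, LieRinehartRing.leibniz_mul_right]
  ring

theorem conn_mul (x : L) (φ ψ : Jet K R L) : conn x (φ * ψ) = conn x φ * ψ + φ * conn x ψ := by
  have key : ∀ t, ⁅x, pair φ ψ t⁆ - pair φ ψ (Env.tensorVec K R L x t) =
      pair (conn x φ) ψ t + pair φ (conn x ψ) t := by
    intro t
    induction t with
    | zero => simp
    | add s t hs ht =>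
      have : ∀ a b c d e f g h : R, a - b = c + d → e - f = g + h →
          a + e - (b + f) = c + g + (d + h) := by
        intro a b c d e f g h h1 h2
        linear_combination h1 + h2
      simp only [map_add, lie_add]
      exact this _ _ _ _ _ _ _ _ hs ht
    | tmul D E =>
      simp only [pair_tmul, Env.tensorVec_tmul, map_add, conn_apply,
        LieRinehartRing.leibniz_mul_right, smul_eq_mul]
      ring
  ext D
  rw [conn_apply, add_apply, mul_apply, mul_apply, mul_apply, mul_apply, Env.comul_vec_mul, key]

theorem conn_actTwo (x : L) (D : Env K R L) (φ : Jet K R L) :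
    conn x (actTwo D φ) = actTwo D (conn x φ) := by
  ext E
  simp [conn_apply, mul_assoc]

end Jet

end Jets

section DiffOp

variable (R : Type*) {A : Type*} [CommRing R] [CommRing A] [Algebra R A]

/-- `P` is an `R`-linear differential operator of order at most `n` on the commutative
`R`-algebra `A`: the iterated commutators of `P` with any `n + 1` elements of `A` vanish. -/
def IsDiffOp : ℕ → Module.End R A → Prop
  | 0, P => ∀ a : A, P * LinearMap.mulLeft R a - LinearMap.mulLeft R a * P = 0
  | n + 1, P => ∀ a : A, IsDiffOp n (P * LinearMap.mulLeft R a - LinearMap.mulLeft R a * P)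

namespace IsDiffOp

variable {R}

theorem zero (n : ℕ) : IsDiffOp R n (0 : Module.End R A) := by
  induction n with
  | zero => intro a; rw [zero_mul, mul_zero, sub_zero]
  | succ n ih => intro a; rw [zero_mul, mul_zero, sub_zero]; exact ih

theorem add_comm_sub (P Q T : Module.End R A) :
    (P + Q) * T - T * (P + Q) = (P * T - T * P) + (Q * T - T * Q) := by
  rw [add_mul, mul_add]; abel

theorem mul_comm_sub (P Q T : Module.End R A) :
    P * Q * T - T * (P * Q) = P * (Q * T - T * Q) + (P * T - T * P) * Q := by
  rw [mul_sub, sub_mul, ← mul_assoc, ← mul_assoc, ← mul_assoc]; abel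

theorem add {n : ℕ} {P Q : Module.End R A} (hP : IsDiffOp R n P) (hQ : IsDiffOp R n Q) :
    IsDiffOp R n (P + Q) := by
  induction n generalizing P Q with
  | zero => intro a; rw [add_comm_sub, hP a, hQ a, add_zero]
  | succ n ih => intro a; rw [add_comm_sub]; exact ih (hP a) (hQ a)

theorem succ {n : ℕ} {P : Module.End R A} (hP : IsDiffOp R n P) : IsDiffOp R (n + 1) P := by
  induction n generalizing P with
  | zero => intro a; rw [hP a]; exact zero 0
  | succ n ih => intro a; exact ih (hP a)

theorem mono {m n : ℕ} (h : m ≤ n) {P : Module.End R A} (hP : IsDiffOp R m P) :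
    IsDiffOp R n P := by
  induction h with
  | refl => exact hP
  | step _ ih => exact ih.succ

theorem mul {m n : ℕ} {P Q : Module.End R A} (hP : IsDiffOp R m P) (hQ : IsDiffOp R n Q) :
    IsDiffOp R (m + n) (P * Q) := by
  induction m generalizing P Q n with
  | zero =>
    rw [Nat.zero_add]
    induction n generalizing Q with
    | zero => intro a; rw [mul_comm_sub, hP a, hQ a, mul_zero, zero_mul, add_zero]
    | succ n ih =>
      intro a
      rw [mul_comm_sub, hP a, zero_mul, add_zero]
      exact ih (hQ a)
  | succ m ih =>
    induction n generalizing Q with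
    | zero =>
      intro a
      rw [mul_comm_sub, hQ a, mul_zero, zero_add]
      exact ih (hP a) hQ
    | succ n ih' =>
      intro a
      rw [mul_comm_sub]
      refine add (ih' (hQ a)) ?_
      have h := ih (hP a) hQ
      rwa [show m + (n + 1) = m + 1 + n by omega] at h

theorem mulLeft (a : A) : IsDiffOp R 0 (LinearMap.mulLeft R a) := by
  intro b
  ext c
  simp only [LinearMap.sub_apply, Module.End.mul_apply, LinearMap.mulLeft_apply,
    LinearMap.zero_apply]
  ring

theorem smul {n : ℕ} {S : Type*} [CommRing S] [Algebra S R] [Module S A] [IsScalarTower S R A]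
    (c : S) {P : Module.End R A} (hP : IsDiffOp R n P) : IsDiffOp R n (c • P) := by
  have h : c • P = LinearMap.mulLeft R (algebraMap R A (algebraMap S R c)) * P := by
    ext a
    simp [← Algebra.smul_def]
  rw [h]
  simpa using (mulLeft (R := R) (algebraMap R A (algebraMap S R c))).mul hP

end IsDiffOp

end DiffOp

section Koszul

variable {K R L M : Type*} [Field K] [CharZero K] [CommRing R] [Algebra K R]
  [LieRing L] [LieAlgebra K L] [Module R L] [LieRingModule L R] [LieRinehartRing R L]
  [LieRinehartAlgebra K R L] [AddCommGroup M] [Module K M] [Module R M] [IsScalarTower K R M]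

/-- Alternating maps over `R`, regarded as alternating maps over `K`. -/
def restrictAlt {p : ℕ} (ω : L [⋀^Fin p]→ₗ[R] M) : L [⋀^Fin p]→ₗ[K] M :=
  { ω.toMultilinearMap.restrictScalars K with
    map_eq_zero_of_eq' := ω.map_eq_zero_of_eq' }

@[simp] theorem restrictAlt_apply {p : ℕ} (ω : L [⋀^Fin p]→ₗ[R] M) (v : Fin p → L) :
    restrictAlt (K := K) ω v = ω v := rfl

/-- The part `∑_{i<j} (-1)^{i+j} ω([xᵢ, xⱼ], x₀, …, x̂ᵢ, …, x̂ⱼ, …, x_p)` of the Koszul formula.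
The pairs `i < j` of elements of `Fin (n + 2)` are the pairs `(i.castSucc, j.succ)` with `i ≤ j` in
`Fin (n + 1)`; there are none when `ω` has degree zero. -/
def bracketSum : {p : ℕ} → L [⋀^Fin p]→ₗ[R] M → (Fin (p + 1) → L) → M
  | 0, _, _ => 0
  | n + 1, ω, v => ∑ i : Fin (n + 1), ∑ j ≥ i, (-1 : ℤ) ^ ((i.castSucc : ℕ) + (j.succ : ℕ)) •
      ω (Matrix.vecCons ⁅v i.castSucc, v j.succ⁆ (j.removeNth (i.castSucc.removeNth v)))

/-- The right hand side of the Koszul formula. -/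
def koszulFun (D : L →ₗ[R] Module.End K M) {p : ℕ} (ω : L [⋀^Fin p]→ₗ[R] M)
    (v : Fin (p + 1) → L) : M :=
  ∑ i : Fin (p + 1), (-1 : ℤ) ^ (i : ℕ) • D (v i) (ω (i.removeNth v)) + bracketSum ω v

/-- The Koszul formula as an alternating map over `K`. -/
theorem exists_alternating (D : L →ₗ[R] Module.End K M) {p : ℕ} (ω : L [⋀^Fin p]→ₗ[R] M) :
    ∃ f : L [⋀^Fin (p + 1)]→ₗ[K] M, ⇑f = koszulFun D ω := by
  have h1 : ∃ f : L [⋀^Fin (p + 1)]→ₗ[K] M, ∀ v,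
      f v = ∑ i : Fin (p + 1), (-1 : ℤ) ^ (i : ℕ) • D (v i) (ω (i.removeNth v)) := by
    let g : L →ₗ[K] L [⋀^Fin p]→ₗ[K] M :=
      { toFun := fun x ↦ (D x).compAlternatingMap (restrictAlt ω)
        map_add' := fun x y ↦ by ext v; simp
        map_smul' := fun c x ↦ by
          ext v
          rw [← algebraMap_smul R c x, map_smul]
          simp }
    exact ⟨AlternatingMap.alternatizeUncurryFin g,
      fun v ↦ by simp [AlternatingMap.alternatizeUncurryFin_apply, g]⟩
  have h2 : ∃ f : L [⋀^Fin (p + 1)]→ₗ[K] M, ∀ v, f v = bracketSum ω v := by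
    cases p with
    | zero => exact ⟨0, fun v ↦ rfl⟩
    | succ n =>
      let b : L →ₗ[K] L →ₗ[K] L [⋀^Fin n]→ₗ[K] M :=
        (LieModule.toEnd K L L : L →ₗ[K] Module.End K L).compr₂
          (AlternatingMap.curryLeft (restrictAlt ω))
      refine ⟨-(2 : K)⁻¹ • AlternatingMap.alternatizeUncurryFin
        (AlternatingMap.alternatizeUncurryFinLM ∘ₗ b), fun v ↦ ?_⟩
      rw [AlternatingMap.smul_apply,
        AlternatingMap.alternatizeUncurryFin_alternatizeUncurryFinLM_comp_apply]
      simp only [bracketSum, Finset.smul_sum]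
      refine Finset.sum_congr rfl fun i _ ↦ Finset.sum_congr rfl fun j _ ↦ ?_
      have hb : ∀ x y w, b x y w = ω (Matrix.vecCons ⁅x, y⁆ w) := fun x y w ↦ rfl
      have hneg : ∀ x y w, ω (Matrix.vecCons ⁅y, x⁆ w) = - ω (Matrix.vecCons ⁅x, y⁆ w) := by
        intro x y w
        rw [← lie_skew]
        have := (ω.curryLeft).map_neg ⁅x, y⁆
        have h2 := congrArg (fun f ↦ f w) this
        simpa using h2
      rw [hb, hb, hneg (v i.castSucc), sub_neg_eq_add, ← two_smul K, smul_comm, smul_smul,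
        neg_mul, inv_mul_cancel₀ two_ne_zero, neg_smul, one_smul, Fin.val_castSucc, Fin.val_succ,
        ← add_assoc, pow_succ]
      simp
  obtain ⟨f, hf⟩ := h1
  obtain ⟨g, hg⟩ := h2
  exact ⟨f + g, by funext v; simp [koszulFun, hf, hg]⟩

theorem removeNth_succ_cons {n : ℕ} (x : L) (w : Fin (n + 1) → L) (k : Fin (n + 1)) :
    k.succ.removeNth (Fin.cons x w : Fin (n + 2) → L) =
      (Fin.cons x (k.removeNth w) : Fin (n + 1) → L) :=
  funext (Fin.cases rfl fun _ ↦ by simp [Fin.removeNth])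

theorem bracketSum_smul_cons {n : ℕ} (ω : L [⋀^Fin (n + 1)]→ₗ[R] M) (a : R) (x : L)
    (w : Fin (n + 1) → L) :
    bracketSum ω (Fin.cons (a • x) w : Fin (n + 2) → L) =
      a • bracketSum ω (Fin.cons x w : Fin (n + 2) → L) +
        ∑ k : Fin (n + 1), (-1 : ℤ) ^ (k : ℕ) •
          (⁅w k, a⁆ • ω (Fin.cons x (k.removeNth w) : Fin (n + 1) → L)) := by
  have hb : ∀ v : Fin (n + 2) → L, bracketSum ω v =
      (∑ j ≥ (0 : Fin (n + 1)), (-1 : ℤ) ^ (((0 : Fin (n + 1)).castSucc : ℕ) + (j.succ : ℕ)) •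
        ω (Matrix.vecCons ⁅v (0 : Fin (n + 1)).castSucc, v j.succ⁆
          (j.removeNth ((0 : Fin (n + 1)).castSucc.removeNth v)))) +
      ∑ i : Fin n, ∑ j ≥ i.succ, (-1 : ℤ) ^ ((i.succ.castSucc : ℕ) + (j.succ : ℕ)) •
        ω (Matrix.vecCons ⁅v i.succ.castSucc, v j.succ⁆
          (j.removeNth (i.succ.castSucc.removeNth v))) := by
    intro v
    rw [bracketSum, Fin.sum_univ_succ]
  have h0 : ∑ j ≥ (0 : Fin (n + 1)), (-1 : ℤ) ^ (((0 : Fin (n + 1)).castSucc : ℕ) +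
        (j.succ : ℕ)) •
      ω (Matrix.vecCons ⁅(Fin.cons (a • x) w : Fin (n + 2) → L) (0 : Fin (n + 1)).castSucc,
          (Fin.cons (a • x) w : Fin (n + 2) → L) j.succ⁆
        (j.removeNth ((0 : Fin (n + 1)).castSucc.removeNth
          (Fin.cons (a • x) w : Fin (n + 2) → L)))) =
      a • ∑ j ≥ (0 : Fin (n + 1)), (-1 : ℤ) ^ (((0 : Fin (n + 1)).castSucc : ℕ) +
        (j.succ : ℕ)) •
      ω (Matrix.vecCons ⁅(Fin.cons x w : Fin (n + 2) → L) (0 : Fin (n + 1)).castSucc,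
          (Fin.cons x w : Fin (n + 2) → L) j.succ⁆
        (j.removeNth ((0 : Fin (n + 1)).castSucc.removeNth
          (Fin.cons x w : Fin (n + 2) → L)))) +
      ∑ k : Fin (n + 1), (-1 : ℤ) ^ (k : ℕ) •
          (⁅w k, a⁆ • ω (Fin.cons x (k.removeNth w) : Fin (n + 1) → L)) := by
    have : (Finset.Ici (0 : Fin (n + 1))) = Finset.univ := by ext; simp
    rw [this, Finset.smul_sum, ← Finset.sum_add_distrib]
    refine Finset.sum_congr rfl fun j _ ↦ ?_
    have hl : ⁅a • x, w j⁆ = a • ⁅x, w j⁆ - ⁅w j, a⁆ • x := by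
      rw [← lie_skew, LieRinehartRing.leibniz_smul_right, ← lie_skew x (w j), smul_neg]
      abel
    have hs : ω (Matrix.vecCons (a • ⁅x, w j⁆ - ⁅w j, a⁆ • x) (j.removeNth w)) =
        a • ω (Matrix.vecCons ⁅x, w j⁆ (j.removeNth w)) -
          ⁅w j, a⁆ • ω (Matrix.vecCons x (j.removeNth w)) := by
      have := congrArg (fun f ↦ f (j.removeNth w))
        ((ω.curryLeft).map_sub (a • ⁅x, w j⁆) (⁅w j, a⁆ • x))
      simp only [map_smul] at this
      exact this
    have ht : ∀ y : L, Fin.removeNth 0 (Fin.cons y w : Fin (n + 2) → L) = w :=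
      fun y ↦ by simp
    simp only [Fin.castSucc_zero, ht, Fin.cons_zero, Fin.cons_succ, hl, hs, Fin.val_zero,
      Fin.val_succ, zero_add, pow_succ, mul_neg, mul_one, neg_smul, smul_sub, neg_sub]
    rw [smul_neg, smul_comm a]
    change _ = _ + (-1 : ℤ) ^ (j : ℕ) • (⁅w j, a⁆ • ω (Matrix.vecCons x (j.removeNth w)))
    abel
  have h1 : ∀ i : Fin n, ∑ j ≥ i.succ, (-1 : ℤ) ^ ((i.succ.castSucc : ℕ) + (j.succ : ℕ)) •
      ω (Matrix.vecCons ⁅(Fin.cons (a • x) w : Fin (n + 2) → L) i.succ.castSucc,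
          (Fin.cons (a • x) w : Fin (n + 2) → L) j.succ⁆
        (j.removeNth (i.succ.castSucc.removeNth (Fin.cons (a • x) w : Fin (n + 2) → L)))) =
      a • ∑ j ≥ i.succ, (-1 : ℤ) ^ ((i.succ.castSucc : ℕ) + (j.succ : ℕ)) •
      ω (Matrix.vecCons ⁅(Fin.cons x w : Fin (n + 2) → L) i.succ.castSucc,
          (Fin.cons x w : Fin (n + 2) → L) j.succ⁆
        (j.removeNth (i.succ.castSucc.removeNth (Fin.cons x w : Fin (n + 2) → L)))) := by
    intro i
    rw [Finset.smul_sum]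
    refine Finset.sum_congr rfl fun j hj ↦ ?_
    rw [Finset.mem_Ici] at hj
    obtain ⟨m, rfl⟩ : ∃ m, n = m + 1 := ⟨n - 1, by have := i.2; omega⟩
    obtain ⟨j', rfl⟩ : ∃ j' : Fin (m + 1), j = j'.succ :=
      ⟨j.pred (by rintro rfl; simp at hj), by simp⟩
    have hr : ∀ y : L, j'.succ.removeNth (i.succ.castSucc.removeNth
        (Fin.cons y w : Fin (m + 1 + 2) → L)) =
        (Fin.cons y (j'.removeNth (i.castSucc.removeNth w)) : Fin (m + 1) → L) := by
      intro y
      rw [← Fin.succ_castSucc, removeNth_succ_cons, removeNth_succ_cons]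
    rw [hr, hr, ← Fin.succ_castSucc, Fin.cons_succ, Fin.cons_succ, Fin.cons_succ, Fin.cons_succ,
      smul_comm a]
    congr 1
    exact (ω.curryLeft ⁅w i.castSucc, w j'.succ⁆).map_vecCons_smul _ a x
  rw [hb, hb, h0, Finset.sum_congr rfl fun i _ ↦ h1 i, ← Finset.smul_sum, smul_add]
  abel

theorem koszulFun_smul_cons (D : L →ₗ[R] Module.End K M)
    (hD : ∀ (x : L) (a : R) (m : M), D x (a • m) = a • D x m + ⁅x, a⁆ • m)
    {p : ℕ} (ω : L [⋀^Fin p]→ₗ[R] M) (a : R) (x : L) (w : Fin p → L) :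
    koszulFun D ω (Fin.cons (a • x) w : Fin (p + 1) → L) =
      a • koszulFun D ω (Fin.cons x w : Fin (p + 1) → L) := by
  cases p with
  | zero => simp [koszulFun, bracketSum]
  | succ n =>
    have hω : ∀ (u : Fin n → L), ω (Fin.cons (a • x) u : Fin (n + 1) → L) =
        a • ω (Fin.cons x u : Fin (n + 1) → L) :=
      fun u ↦ ω.map_vecCons_smul u a x
    simp only [koszulFun, bracketSum_smul_cons, Fin.sum_univ_succ (n := n + 1),
      removeNth_succ_cons, hω, hD, smul_add, Finset.sum_add_distrib, Finset.smul_sum,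
      Fin.cons_succ, Fin.cons_zero, Fin.val_succ, pow_succ, mul_neg, mul_one, neg_smul,
      Finset.sum_neg_distrib, smul_neg, map_smul, Fin.removeNth_zero, Fin.tail_cons, Fin.val_zero,
      pow_zero, one_smul, LinearMap.smul_apply, smul_comm a ((-1 : ℤ) ^ _)]
    abel

/-- The Chevalley–Eilenberg differential of a module `M` with an `L`-connection `D`, given by the
Koszul formula. -/
def koszul (D : L →ₗ[R] Module.End K M)
    (hD : ∀ (x : L) (a : R) (m : M), D x (a • m) = a • D x m + ⁅x, a⁆ • m)
    {p : ℕ} (ω : L [⋀^Fin p]→ₗ[R] M) : L [⋀^Fin (p + 1)]→ₗ[R] M where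
  toFun := koszulFun D ω
  map_update_add' := by
    intro inst v i x y
    obtain rfl : inst = instDecidableEqFin _ := Subsingleton.elim _ _
    obtain ⟨f, hf⟩ := exists_alternating D ω
    rw [← hf]
    exact f.map_update_add v i x y
  map_update_smul' := by
    intro inst v i a x
    obtain rfl : inst = instDecidableEqFin _ := Subsingleton.elim _ _
    obtain ⟨f, hf⟩ := exists_alternating D ω
    have h0 : ∀ (u : Fin (p + 1) → L) (y : L), Function.update u 0 y =
        (Fin.cons y (Fin.tail u) : Fin (p + 1) → L) := by
      intro u y
      refine funext (Fin.cases (by simp) fun k ↦ ?_)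
      simp [Fin.tail]
    by_cases hi : i = 0
    · subst hi
      rw [h0, h0]
      exact koszulFun_smul_cons D hD ω a x _
    · have hsw : ∀ y : L, Function.update v i y ∘ Equiv.swap 0 i =
          (Fin.cons y (Fin.tail (Function.update v i (v 0) )) : Fin (p + 1) → L) := by
        intro y
        refine funext (Fin.cases (by simp) fun k ↦ ?_)
        by_cases hk : k.succ = i
        · subst hk
          simp [Fin.tail, Function.update_of_ne (Fin.succ_ne_zero k).symm]
        · simp [Fin.tail, Equiv.swap_apply_of_ne_of_ne (Fin.succ_ne_zero k) hk, hk]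
      have hneg : ∀ y : L, koszulFun D ω (Function.update v i y) = - koszulFun D ω
          (Fin.cons y (Fin.tail (Function.update v i (v 0))) : Fin (p + 1) → L) := by
        intro y
        rw [← hsw, ← hf, f.map_swap _ (Ne.symm hi), neg_neg]
      rw [hneg, hneg, koszulFun_smul_cons D hD, smul_neg]
  map_eq_zero_of_eq' := by
    intro v i j hv hij
    obtain ⟨f, hf⟩ := exists_alternating D ω
    rw [← hf]
    exact f.map_eq_zero_of_eq v hv hij

theorem koszul_apply (D : L →ₗ[R] Module.End K M)
    (hD : ∀ (x : L) (a : R) (m : M), D x (a • m) = a • D x m + ⁅x, a⁆ • m)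
    {p : ℕ} (ω : L [⋀^Fin p]→ₗ[R] M) (v : Fin (p + 1) → L) :
    koszul D hD ω v = koszulFun D ω v := rfl

end Koszul

section Wedge

variable {R L A : Type*} [CommRing R] [AddCommGroup L] [Module R L] [Ring A] [Algebra R A]

/-- The wedge product of alternating maps with values in an algebra `A`:
`(ω ∧ η)(x₁, …, x_{p+q}) = ∑ sign(σ) ω(x_{σ(1)}, …, x_{σ(p)}) η(x_{σ(p+1)}, …, x_{σ(p+q)})`, the sum
being over all `(p, q)`-shuffles `σ`. -/
def wedge {p q : ℕ} (ω : L [⋀^Fin p]→ₗ[R] A) (η : L [⋀^Fin q]→ₗ[R] A) :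
    L [⋀^Fin (p + q)]→ₗ[R] A :=
  ((LinearMap.mul' R A).compAlternatingMap (ω.domCoprod η)).domDomCongr finSumFinEquiv

/-- The wedge product is natural. -/
theorem wedge_map {R' L' A' : Type*} [CommRing R'] [AddCommGroup L'] [Module R' L'] [Ring A']
    [Algebra R' A'] {p q : ℕ} (ω : L [⋀^Fin p]→ₗ[R] A) (η : L [⋀^Fin q]→ₗ[R] A)
    (ω' : L' [⋀^Fin p]→ₗ[R'] A') (η' : L' [⋀^Fin q]→ₗ[R'] A') (g : A →+* A') (f : L → L')
    (hω : ∀ v, g (ω v) = ω' (f ∘ v)) (hη : ∀ v, g (η v) = η' (f ∘ v)) (v : Fin (p + q) → L) :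
    g (wedge ω η v) = wedge ω' η' (f ∘ v) := by
  simp only [wedge, AlternatingMap.domDomCongr_apply, LinearMap.compAlternatingMap_apply,
    AlternatingMap.domCoprod_apply, _root_.sum_apply, map_sum]
  refine Finset.sum_congr rfl fun σ _ ↦ ?_
  induction σ using Quotient.inductionOn' with
  | h σ =>
    change g (LinearMap.mul' R A (Equiv.Perm.sign σ •
        ((ω fun i ↦ v (finSumFinEquiv (σ (.inl i)))) ⊗ₜ[R]
          (η fun i ↦ v (finSumFinEquiv (σ (.inr i))))))) =
      LinearMap.mul' R' A' (Equiv.Perm.sign σ •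
        ((ω' fun i ↦ f (v (finSumFinEquiv (σ (.inl i))))) ⊗ₜ[R']
          (η' fun i ↦ f (v (finSumFinEquiv (σ (.inr i)))))))
    simp only [Units.smul_def, map_zsmul, LinearMap.mul'_apply, map_mul, hω, hη]
    rfl

end Wedge

section Functoriality

variable {K R L R' L' : Type*} [CommRing K] [CommRing R] [Algebra K R] [LieRing L] [LieAlgebra K L]
  [CommRing R'] [Algebra K R'] {σ : R →ₐ[K] R'} [LieRing L'] [LieAlgebra K L']
  [Module R' L'] [LieRingModule L' R'] [Module R L] [LieRingModule L R]

/-- Functoriality of the enveloping algebra for morphisms of Lie–Rinehart algebras. -/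
def Env.map (f : LieRinehartAlgebra.Hom σ L L') : Env K R L →ₐ[K] Env K R' L' :=
  Env.lift ((Env.fn K R' L').comp σ)
    (AddMonoidHom.mk' (fun x ↦ Env.vec K (f x)) (fun x y ↦ by
      rw [← Env.vec_add]
      exact congrArg (Env.vec K) (f.toLieHom.toLinearMap.map_add x y)))
    (fun a x ↦ by
      simp only [AddMonoidHom.mk'_apply, f.map_smul_apply, Env.vec_smul, AlgHom.comp_apply])
    (fun x y ↦ by
      simp only [AddMonoidHom.mk'_apply, LieHom.map_lie, Env.vec_lie])
    (fun x a ↦ by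
      simp only [AddMonoidHom.mk'_apply, AlgHom.comp_apply, f.apply_lie, Env.vec_mul_fn])

@[simp] theorem Env.map_fn (f : LieRinehartAlgebra.Hom σ L L') (a : R) :
    Env.map f (Env.fn K R L a) = Env.fn K R' L' (σ a) := by simp [Env.map]

@[simp] theorem Env.map_vec (f : LieRinehartAlgebra.Hom σ L L') (x : L) :
    Env.map f (Env.vec K x) = Env.vec K (f x) := by simp [Env.map]

variable [LieRinehartRing R L] [LieRinehartAlgebra K R L] [LieRinehartRing R' L']
  [LieRinehartAlgebra K R' L']

theorem Env.map_act (f : LieRinehartAlgebra.Hom σ L L') (D : Env K R L) (a : R) :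
    σ (Env.act K R L D a) = Env.act K R' L' (Env.map f D) (σ a) := by
  let S : Subalgebra K (Env K R L) :=
    { carrier := {D | ∀ a, σ (Env.act K R L D a) = Env.act K R' L' (Env.map f D) (σ a)}
      mul_mem' := fun {D D'} h h' a ↦ by
        simp only [map_mul, Module.End.mul_apply]
        rw [h, h']
      add_mem' := fun {D D'} h h' a ↦ by
        simp only [map_add, LinearMap.add_apply]
        rw [h, h']
      algebraMap_mem' := fun c a ↦ by
        simp }
  refine Env.mem_of_generators S (fun b a ↦ ?_) (fun x a ↦ ?_) D a
  · rw [Env.map_fn, Env.act_fn, Env.act_fn, map_mul]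
  · rw [Env.map_vec, Env.act_vec, Env.act_vec, f.apply_lie]

/-- `φ'` restricts `φ` along a morphism of Lie–Rinehart algebras. -/
def Jet.Compat (f : LieRinehartAlgebra.Hom σ L L') (φ : Jet K R L) (φ' : Jet K R' L') : Prop :=
  ∀ D : Env K R L, σ (φ D) = φ' (Env.map f D)

namespace Jet.Compat

variable {f : LieRinehartAlgebra.Hom σ L L'} {φ ψ : Jet K R L} {φ' ψ' : Jet K R' L'}

theorem zero : Compat f (0 : Jet K R L) (0 : Jet K R' L') := fun D ↦ by simp

theorem add (h : Compat f φ φ') (h' : Compat f ψ ψ') : Compat f (φ + ψ) (φ' + ψ') := fun D ↦ by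
  rw [Jet.add_apply, Jet.add_apply, map_add, h, h']

theorem smul (h : Compat f φ φ') (a : R) : Compat f (a • φ) (σ a • φ') := fun D ↦ by
  rw [Jet.smul_apply, Jet.smul_apply, smul_eq_mul, smul_eq_mul, map_mul, h]

theorem one : Compat f (1 : Jet K R L) (1 : Jet K R' L') := fun D ↦ by
  rw [Jet.one_apply, Jet.one_apply, Env.counit_apply, Env.counit_apply, Env.map_act f, map_one]

theorem actTwo (h : Compat f φ φ') (D : Env K R L) :
    Compat f (Jet.actTwo D φ) (Jet.actTwo (Env.map f D) φ') := fun E ↦ by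
  rw [Jet.actTwo_apply, Jet.actTwo_apply, h, map_mul]

theorem conn (h : Compat f φ φ') (x : L) : Compat f (Jet.conn x φ) (Jet.conn (f x) φ') := fun D ↦ by
  rw [Jet.conn_apply, Jet.conn_apply, map_sub, f.apply_lie, h, h, map_mul, Env.map_vec]

theorem mul (h : Compat f φ φ') (h' : Compat f ψ ψ') : Compat f (φ * ψ) (φ' * ψ') := by
  intro D
  induction D using Env.induction_right generalizing φ ψ φ' ψ' with
  | one => rw [map_one (Env.map f), Jet.mul_apply_one, Jet.mul_apply_one, map_mul, h, h',
      map_one (Env.map f)]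
  | add D E hD hE => rw [map_add, map_add, map_add, hD h h', hE h h', map_add]
  | mul_fn D a ih =>
    rw [← Jet.actTwo_apply, map_mul (Env.map f), ← Jet.actTwo_apply, Env.map_fn, Jet.actTwo_fn_mul,
      Jet.actTwo_fn_mul, ← Env.map_fn f]
    exact ih (h.actTwo _) h'
  | mul_vec D x ih =>
    rw [← Jet.actTwo_apply, map_mul (Env.map f), ← Jet.actTwo_apply, Env.map_vec, Jet.actTwo_vec_mul,
      Jet.actTwo_vec_mul, ← Env.map_vec f, Jet.add_apply, Jet.add_apply, map_add,
      ih (h.actTwo _) h', ih h (h'.actTwo _)]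

end Jet.Compat

end Functoriality

section Sheaves

variable {K : Type u} [Field K] {X : TopCat.{u}} (𝒪 : TopCat.Sheaf (CommAlgCat.{u} K) X)

/-- The sections of the structure sheaf. -/
def Fn (U : Opens X) : Type u := 𝒪.presheaf.obj (op U)

instance (U : Opens X) : CommRing (Fn 𝒪 U) := inferInstanceAs (CommRing (𝒪.presheaf.obj (op U)))

instance (U : Opens X) : Algebra K (Fn 𝒪 U) :=
  inferInstanceAs (Algebra K (𝒪.presheaf.obj (op U)))

/-- Restriction of sections of the structure sheaf. -/
def Fn.res {U V : Opens X} (h : V ≤ U) : Fn 𝒪 U →ₐ[K] Fn 𝒪 V :=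
  (𝒪.presheaf.map (homOfLE h).op).hom

theorem Fn.res_refl {U : Opens X} (a : Fn 𝒪 U) : Fn.res 𝒪 (le_refl U) a = a := by
  have h : 𝒪.presheaf.map (homOfLE (le_refl U)).op = 𝟙 _ := 𝒪.presheaf.map_id _
  exact congrArg (fun f ↦ f.hom a) h

theorem Fn.res_trans {U V W : Opens X} (h : V ≤ U) (h' : W ≤ V) (a : Fn 𝒪 U) :
    Fn.res 𝒪 h' (Fn.res 𝒪 h a) = Fn.res 𝒪 (h'.trans h) a := by
  have h : 𝒪.presheaf.map (homOfLE (h'.trans h)).op =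
      𝒪.presheaf.map (homOfLE h).op ≫ 𝒪.presheaf.map (homOfLE h').op :=
    𝒪.presheaf.map_comp _ _
  exact (congrArg (fun f ↦ f.hom a) h).symm

/-- A presheaf of Lie–Rinehart algebras over the sheaf of commutative `K`-algebras `𝒪`: for every
open `U` a Lie–Rinehart algebra `(𝒪(U), 𝓛(U))`, with restriction maps that are morphisms of
Lie–Rinehart algebras. -/
structure LieRinehartPresheaf where
  /-- The sections over an open subset. -/
  sec : Opens X → Type u
  [lieRing : ∀ U, LieRing (sec U)]
  [lieAlgebra : ∀ U, LieAlgebra K (sec U)]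
  [module : ∀ U, Module (Fn 𝒪 U) (sec U)]
  [lieRingModule : ∀ U, LieRingModule (sec U) (Fn 𝒪 U)]
  [lieRinehartRing : ∀ U, LieRinehartRing (Fn 𝒪 U) (sec U)]
  [lieRinehartAlgebra : ∀ U, LieRinehartAlgebra K (Fn 𝒪 U) (sec U)]
  /-- The restriction maps. -/
  res : ∀ {U V : Opens X} (h : V ≤ U), LieRinehartAlgebra.Hom (Fn.res 𝒪 h) (sec U) (sec V)
  res_refl : ∀ {U : Opens X} (x : sec U), res (le_refl U) x = x
  res_trans : ∀ {U V W : Opens X} (h : V ≤ U) (h' : W ≤ V) (x : sec U),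
    res h' (res h x) = res (h'.trans h) x

attribute [instance] LieRinehartPresheaf.lieRing LieRinehartPresheaf.lieAlgebra
  LieRinehartPresheaf.module LieRinehartPresheaf.lieRingModule LieRinehartPresheaf.lieRinehartRing
  LieRinehartPresheaf.lieRinehartAlgebra

variable {𝒪}

/-- The underlying presheaf of `K`-modules. -/
def LieRinehartPresheaf.toPresheaf (𝓛 : LieRinehartPresheaf 𝒪) :
    TopCat.Presheaf (ModuleCat.{u} K) X where
  obj U := ModuleCat.of K (𝓛.sec U.unop)
  map f := ModuleCat.ofHom (𝓛.res f.unop.le).toLieHom.toLinearMap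
  map_id U := by
    ext x
    exact 𝓛.res_refl x
  map_comp f g := by
    ext x
    exact (𝓛.res_trans f.unop.le g.unop.le x).symm

variable (𝒪) in
/-- A Lie algebroid over the ringed space `(X, 𝒪)`: a sheaf of Lie–Rinehart algebras. -/
structure LieAlgebroid extends LieRinehartPresheaf 𝒪 where
  isSheaf : toLieRinehartPresheaf.toPresheaf.IsSheaf

namespace LieAlgebroid

variable (𝓛 : LieAlgebroid 𝒪)

/-- `𝓛` is locally free of constant rank `r` as an `𝒪`-module: near every point there are `r`
sections whose restrictions to every smaller open subset form a basis. -/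
def IsLocallyFreeOfRank (r : ℕ) : Prop :=
  ∀ x : X, ∃ U : Opens X, x ∈ U ∧ ∃ e : Fin r → 𝓛.sec U, ∀ (V : Opens X) (h : V ≤ U),
    ∃ b : Module.Basis (Fin r) (Fn 𝒪 V) (𝓛.sec V), ∀ i, b i = 𝓛.res h (e i)

/-- The enveloping algebra of the Lie–Rinehart algebra of sections over `U`. -/
abbrev EnvSec (U : Opens X) : Type u := Env K (Fn 𝒪 U) (𝓛.sec U)

/-- Restriction on enveloping algebras. -/
def envRes {U V : Opens X} (h : V ≤ U) : 𝓛.EnvSec U →ₐ[K] 𝓛.EnvSec V := Env.map (𝓛.res h)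

theorem envRes_refl {U : Opens X} (D : 𝓛.EnvSec U) : 𝓛.envRes (le_refl U) D = D := by
  have : 𝓛.envRes (le_refl U) = AlgHom.id K _ :=
    Env.algHom_ext (fun a ↦ by simp [envRes, Fn.res_refl])
      (fun x ↦ by simp [envRes, 𝓛.res_refl])
  rw [this, AlgHom.id_apply]

theorem envRes_trans {U V W : Opens X} (h : V ≤ U) (h' : W ≤ V) (D : 𝓛.EnvSec U) :
    𝓛.envRes h' (𝓛.envRes h D) = 𝓛.envRes (h'.trans h) D := by
  have : (𝓛.envRes h').comp (𝓛.envRes h) = 𝓛.envRes (h'.trans h) :=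
    Env.algHom_ext (fun a ↦ by simp [envRes, Fn.res_trans])
      (fun x ↦ by simp [envRes, 𝓛.res_trans])
  rw [← this, AlgHom.comp_apply]

/-- The presheaf `U ↦ U(𝓛(U), 𝒪(U))` of enveloping algebras. -/
def envPresheaf : TopCat.Presheaf (ModuleCat.{u} K) X where
  obj U := ModuleCat.of K (𝓛.EnvSec U.unop)
  map f := ModuleCat.ofHom (𝓛.envRes f.unop.le).toLinearMap
  map_id U := by
    ext D
    exact 𝓛.envRes_refl D
  map_comp f g := by
    ext D
    exact (𝓛.envRes_trans f.unop.le g.unop.le D).symm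

/-- The sections over `U` of the sheaf of jets `𝒥(𝓛)`, the sheaf of `𝒪`-linear maps
`𝒰(𝓛) → 𝒪`: families of `𝒪(V)`-linear maps `U(𝓛(V), 𝒪(V)) → 𝒪(V)`, one for each open `V ⊆ U`,
which commute with restriction. (As `𝒪` is a sheaf, such a family is the same as a morphism from
the sheaf associated with `V ↦ U(𝓛(V), 𝒪(V))`.) -/
def jetSubalgebra (U : Opens X) :
    Subalgebra K (∀ V : Set.Iic U, Jet K (Fn 𝒪 V.1) (𝓛.sec V.1)) where
  carrier := {φ | ∀ (V W : Set.Iic U) (h : W.1 ≤ V.1), (φ V).Compat (𝓛.res h) (φ W)}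
  mul_mem' hφ hψ V W h := (hφ V W h).mul (hψ V W h)
  add_mem' hφ hψ V W h := (hφ V W h).add (hψ V W h)
  algebraMap_mem' c V W h := by
    have := (Jet.Compat.one (f := 𝓛.res h)).smul (algebraMap K _ c)
    rw [AlgHom.commutes, algebraMap_smul, algebraMap_smul] at this
    simpa [Algebra.algebraMap_eq_smul_one] using this

/-- The sections of the sheaf of jets. -/
def JetSec (U : Opens X) : Type u := 𝓛.jetSubalgebra U

instance (U : Opens X) : CommRing (𝓛.JetSec U) := inferInstanceAs (CommRing (𝓛.jetSubalgebra U))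

instance (U : Opens X) : Algebra K (𝓛.JetSec U) :=
  inferInstanceAs (Algebra K (𝓛.jetSubalgebra U))

variable {𝓛}

/-- The component of a jet on a smaller open subset. -/
def JetSec.on {U : Opens X} (φ : 𝓛.JetSec U) (V : Opens X) (h : V ≤ U) :
    Jet K (Fn 𝒪 V) (𝓛.sec V) := φ.1 ⟨V, h⟩

theorem JetSec.compat {U V W : Opens X} (φ : 𝓛.JetSec U) (hV : V ≤ U) (h : W ≤ V) :
    (φ.on V hV).Compat (𝓛.res h) (φ.on W (h.trans hV)) := φ.2 ⟨V, hV⟩ ⟨W, h.trans hV⟩ h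

/-- Build a jet from its components. -/
def JetSec.mk {U : Opens X} (φ : ∀ V : Opens X, V ≤ U → Jet K (Fn 𝒪 V) (𝓛.sec V))
    (hφ : ∀ (V W : Opens X) (hV : V ≤ U) (h : W ≤ V),
      (φ V hV).Compat (𝓛.res h) (φ W (h.trans hV))) : 𝓛.JetSec U :=
  ⟨fun V ↦ φ V.1 V.2, fun V W h ↦ hφ V.1 W.1 V.2 h⟩

@[simp] theorem JetSec.mk_on {U : Opens X}
    (φ : ∀ V : Opens X, V ≤ U → Jet K (Fn 𝒪 V) (𝓛.sec V)) (hφ) (V : Opens X) (h : V ≤ U) :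
    (JetSec.mk φ hφ : 𝓛.JetSec U).on V h = φ V h := rfl

theorem JetSec.ext {U : Opens X} {φ ψ : 𝓛.JetSec U} (h : ∀ V hV, φ.on V hV = ψ.on V hV) : φ = ψ :=
  Subtype.ext (funext fun V ↦ h V.1 V.2)

@[simp] theorem JetSec.add_on {U : Opens X} (φ ψ : 𝓛.JetSec U) (V : Opens X) (h : V ≤ U) :
    (φ + ψ).on V h = φ.on V h + ψ.on V h := rfl

@[simp] theorem JetSec.sub_on {U : Opens X} (φ ψ : 𝓛.JetSec U) (V : Opens X) (h : V ≤ U) :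
    (φ - ψ).on V h = φ.on V h - ψ.on V h := rfl

@[simp] theorem JetSec.mul_on {U : Opens X} (φ ψ : 𝓛.JetSec U) (V : Opens X) (h : V ≤ U) :
    (φ * ψ).on V h = φ.on V h * ψ.on V h := rfl

@[simp] theorem JetSec.kSmul_on {U : Opens X} (c : K) (φ : 𝓛.JetSec U) (V : Opens X) (h : V ≤ U) :
    (c • φ).on V h = c • φ.on V h := rfl

@[simp] theorem JetSec.zero_on {U : Opens X} (V : Opens X) (h : V ≤ U) :
    (0 : 𝓛.JetSec U).on V h = 0 := rfl

/-- The first `𝒪`-algebra structure `α₁` on jets, `(α₁(a) φ)(D) = a φ(D)`. -/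
def JetSec.alphaOne (U : Opens X) : Fn 𝒪 U →+* 𝓛.JetSec U where
  toFun a := JetSec.mk (fun V h ↦ algebraMap _ _ (Fn.res 𝒪 h a)) (fun V W hV h ↦ by
    have := (Jet.Compat.one (f := 𝓛.res h)).smul (Fn.res 𝒪 hV a)
    rw [Fn.res_trans] at this
    rw [Algebra.algebraMap_eq_smul_one, Algebra.algebraMap_eq_smul_one]
    exact this)
  map_one' := JetSec.ext fun V h ↦ by
    rw [JetSec.mk_on, map_one, map_one]
    rfl
  map_mul' a b := JetSec.ext fun V h ↦ by
    simp
  map_zero' := JetSec.ext fun V h ↦ by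
    simp
  map_add' a b := JetSec.ext fun V h ↦ by
    simp

instance (U : Opens X) : Algebra (Fn 𝒪 U) (𝓛.JetSec U) := (JetSec.alphaOne U).toAlgebra

@[simp] theorem JetSec.smul_on {U : Opens X} (a : Fn 𝒪 U) (φ : 𝓛.JetSec U) (V : Opens X)
    (h : V ≤ U) : (a • φ).on V h = Fn.res 𝒪 h a • φ.on V h := by
  rw [Algebra.smul_def (Fn.res 𝒪 h a)]
  rfl

instance (U : Opens X) : IsScalarTower K (Fn 𝒪 U) (𝓛.JetSec U) where
  smul_assoc c a φ := JetSec.ext fun V h ↦ by simp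

/-- Restriction of jets. -/
def jetRes {U V : Opens X} (h : V ≤ U) : 𝓛.JetSec U →ₐ[K] 𝓛.JetSec V where
  toFun φ := JetSec.mk (fun W hW ↦ φ.on W (hW.trans h)) (fun _ _ hW h' ↦ φ.compat (hW.trans h) h')
  map_one' := rfl
  map_mul' _ _ := rfl
  map_zero' := rfl
  map_add' _ _ := rfl
  commutes' _ := rfl

@[simp] theorem jetRes_on {U V W : Opens X} (h : V ≤ U) (φ : 𝓛.JetSec U) (hW : W ≤ V) :
    (jetRes h φ).on W hW = φ.on W (hW.trans h) := rfl

theorem jetRes_smul {U V : Opens X} (h : V ≤ U) (a : Fn 𝒪 U) (φ : 𝓛.JetSec U) :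
    jetRes h (a • φ) = Fn.res 𝒪 h a • jetRes h φ := JetSec.ext fun W hW ↦ by
  simp [Fn.res_trans]

/-- The flat connection `∇⁽¹⁾` on the sheaf of jets. -/
def jetConn (U : Opens X) : 𝓛.sec U →ₗ[Fn 𝒪 U] Module.End K (𝓛.JetSec U) where
  toFun x :=
    { toFun := fun φ ↦ JetSec.mk (fun V h ↦ Jet.conn (𝓛.res h x) (φ.on V h)) (fun V W hV h ↦ by
        have := (φ.compat hV h).conn (𝓛.res hV x)
        rwa [𝓛.res_trans] at this)
      map_add' := fun φ ψ ↦ JetSec.ext fun V h ↦ by simp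
      map_smul' := fun c φ ↦ JetSec.ext fun V h ↦ by simp }
  map_add' x y := by
    ext φ
    exact JetSec.ext fun V h ↦ by
      simp only [LinearMap.coe_mk, AddHom.coe_mk, JetSec.mk_on, LinearMap.add_apply, JetSec.add_on,
        map_add]
  map_smul' a x := by
    ext φ
    exact JetSec.ext fun V h ↦ by
      simp only [LinearMap.coe_mk, AddHom.coe_mk, JetSec.mk_on, LinearMap.smul_apply,
        JetSec.smul_on, (𝓛.res h).map_smul_apply, map_smul, RingHom.id_apply]

@[simp] theorem jetConn_on {U : Opens X} (x : 𝓛.sec U) (φ : 𝓛.JetSec U) (V : Opens X) (h : V ≤ U) :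
    (jetConn U x φ).on V h = Jet.conn (𝓛.res h x) (φ.on V h) := rfl

theorem jetConn_smul {U : Opens X} (x : 𝓛.sec U) (a : Fn 𝒪 U) (φ : 𝓛.JetSec U) :
    jetConn U x (a • φ) = a • jetConn U x φ + ⁅x, a⁆ • φ := JetSec.ext fun V h ↦ by
  simp [Jet.conn_smul, (𝓛.res h).apply_lie]

theorem jetConn_mul {U : Opens X} (x : 𝓛.sec U) (φ ψ : 𝓛.JetSec U) :
    jetConn U x (φ * ψ) = jetConn U x φ * ψ + φ * jetConn U x ψ := JetSec.ext fun V h ↦ by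
  simp [Jet.conn_mul]

theorem jetRes_conn {U V : Opens X} (h : V ≤ U) (x : 𝓛.sec U) (φ : 𝓛.JetSec U) :
    jetRes h (jetConn U x φ) = jetConn V (𝓛.res h x) (jetRes h φ) := JetSec.ext fun W hW ↦ by
  simp [𝓛.res_trans]

/-- The second module structure of `U(𝓛(U), 𝒪(U))` on jets. -/
def jetActTwo (U : Opens X) : 𝓛.EnvSec U →ₐ[K] Module.End (Fn 𝒪 U) (𝓛.JetSec U) where
  toFun D :=
    { toFun := fun φ ↦ JetSec.mk (fun V h ↦ Jet.actTwo (𝓛.envRes h D) (φ.on V h))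
        (fun V W hV h ↦ by
          have := (φ.compat hV h).actTwo (𝓛.envRes hV D)
          rwa [show Env.map (𝓛.res h) (𝓛.envRes hV D) = 𝓛.envRes (h.trans hV) D from
            𝓛.envRes_trans hV h D] at this)
      map_add' := fun φ ψ ↦ JetSec.ext fun V h ↦ by simp
      map_smul' := fun c φ ↦ JetSec.ext fun V h ↦ by simp }
  map_one' := by
    ext φ
    exact JetSec.ext fun V h ↦ by simp
  map_mul' D E := by
    ext φ
    exact JetSec.ext fun V h ↦ by simp
  map_zero' := by
    ext φ
    exact JetSec.ext fun V h ↦ by simp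
  map_add' D E := by
    ext φ
    exact JetSec.ext fun V h ↦ by simp
  commutes' c := by
    ext φ
    exact JetSec.ext fun V h ↦ by simp [AlgHom.commutes]

@[simp] theorem jetActTwo_on {U : Opens X} (D : 𝓛.EnvSec U) (φ : 𝓛.JetSec U) (V : Opens X)
    (h : V ≤ U) : (jetActTwo U D φ).on V h = Jet.actTwo (𝓛.envRes h D) (φ.on V h) := rfl

theorem jetRes_actTwo {U V : Opens X} (h : V ≤ U) (D : 𝓛.EnvSec U) (φ : 𝓛.JetSec U) :
    jetRes h (jetActTwo U D φ) = jetActTwo V (𝓛.envRes h D) (jetRes h φ) :=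
  JetSec.ext fun W hW ↦ by simp [envRes_trans]

theorem jetConn_actTwo {U : Opens X} (x : 𝓛.sec U) (D : 𝓛.EnvSec U) (φ : 𝓛.JetSec U) :
    jetConn U x (jetActTwo U D φ) = jetActTwo U D (jetConn U x φ) :=
  JetSec.ext fun V h ↦ by simp [Jet.conn_actTwo]

end LieAlgebroid

end Sheaves

/-- A differential graded algebra over `K`, given by its graded pieces `A p`, differential `d` and
product `mul`. Identities between elements of `A p` and `A q` with `p = q` are stated in the direct
sum of the graded pieces. -/
structure IsDGAlgebra (K : Type*) [CommRing K] (A : ℕ → Type*) [∀ p, AddCommGroup (A p)]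
    [∀ p, Module K (A p)] (d : ∀ p, A p →ₗ[K] A (p + 1))
    (mul : ∀ {p q : ℕ}, A p → A q → A (p + q)) (one : A 0) : Prop where
  add_mul : ∀ {p q : ℕ} (a b : A p) (c : A q), mul (a + b) c = mul a c + mul b c
  mul_add : ∀ {p q : ℕ} (a : A p) (b c : A q), mul a (b + c) = mul a b + mul a c
  smul_mul : ∀ {p q : ℕ} (k : K) (a : A p) (b : A q), mul (k • a) b = k • mul a b
  mul_smul : ∀ {p q : ℕ} (k : K) (a : A p) (b : A q), mul a (k • b) = k • mul a b
  one_mul : ∀ {p : ℕ} (a : A p), DirectSum.of A _ (mul one a) = DirectSum.of A _ a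
  mul_one : ∀ {p : ℕ} (a : A p), DirectSum.of A _ (mul a one) = DirectSum.of A _ a
  mul_assoc : ∀ {p q r : ℕ} (a : A p) (b : A q) (c : A r),
    DirectSum.of A _ (mul (mul a b) c) = DirectSum.of A _ (mul a (mul b c))
  d_comp_d : ∀ p, d (p + 1) ∘ₗ d p = 0
  leibniz : ∀ {p q : ℕ} (a : A p) (b : A q),
    DirectSum.of A _ (d (p + q) (mul a b)) =
      DirectSum.of A _ (mul (d p a) b) + (-1 : ℤ) ^ p • DirectSum.of A _ (mul a (d q b))

theorem IsDiffOp.conn {K R A : Type*} [Field K] [CommRing R] [CommRing A] [Algebra K R]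
    [Algebra K A] [Algebra R A] [IsScalarTower K R A] (D : Module.End K A)
    (hmul : ∀ a b, D (a * b) = D a * b + a * D b) {n : ℕ} {P Q : Module.End R A}
    (hP : IsDiffOp R n P) (hQ : ∀ a, Q a = D (P a) - P (D a)) : IsDiffOp R n Q := by
  have key : ∀ (P Q : Module.End R A), (∀ a, Q a = D (P a) - P (D a)) → ∀ a b,
      (Q * LinearMap.mulLeft R a - LinearMap.mulLeft R a * Q) b =
        D ((P * LinearMap.mulLeft R a - LinearMap.mulLeft R a * P) b) -
          (P * LinearMap.mulLeft R a - LinearMap.mulLeft R a * P) (D b) -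
          (P * LinearMap.mulLeft R (D a) - LinearMap.mulLeft R (D a) * P) b := by
    intro P Q hQ a b
    simp only [LinearMap.sub_apply, Module.End.mul_apply, LinearMap.mulLeft_apply, hQ, hmul,
      map_sub, map_add]
    ring
  induction n generalizing P Q with
  | zero =>
    intro a
    ext b
    rw [key P Q hQ a b, hP a, hP (D a)]
    simp
  | succ n ih =>
    intro a
    have h1 := ih (P := P * LinearMap.mulLeft R a - LinearMap.mulLeft R a * P)
      (Q := (Q * LinearMap.mulLeft R a - LinearMap.mulLeft R a * Q) +
        (P * LinearMap.mulLeft R (D a) - LinearMap.mulLeft R (D a) * P)) (hP a) (fun b ↦ by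
          rw [LinearMap.add_apply, key P Q hQ a b]
          abel)
    have h2 := h1.add ((hP (D a)).smul (S := ℤ) (-1))
    rwa [neg_one_smul, add_neg_cancel_right] at h2

namespace LieAlgebroid

variable {K : Type u} [Field K] {X : TopCat.{u}} {𝒪 : TopCat.Sheaf (CommAlgCat.{u} K) X}
  (𝓛 : LieAlgebroid 𝒪)

/-- The sections over `U` of the sheaf `Diff_{𝒪₁}(𝒥(𝓛))` of differential operators on the
sheaf of algebras `𝒥(𝓛)`, linear for the first `𝒪`-module structure: endomorphisms of the sheaf
`𝒥(𝓛)|_U` that are linear over `𝒪` and are, locally, of finite order. -/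
def diffSubalgebra (U : Opens X) :
    Subalgebra K (∀ V : Set.Iic U, Module.End (Fn 𝒪 V.1) (𝓛.JetSec V.1)) where
  carrier := {P |
    (∀ (V W : Set.Iic U) (h : W.1 ≤ V.1) (φ : 𝓛.JetSec V.1),
      jetRes h (P V φ) = P W (jetRes h φ)) ∧
    ∀ x ∈ U, ∃ V : Set.Iic U, x ∈ V.1 ∧ ∃ n : ℕ, ∀ W : Set.Iic U, W.1 ≤ V.1 →
      IsDiffOp (Fn 𝒪 W.1) n (P W)}
  mul_mem' := by
    rintro P Q ⟨hP, hP'⟩ ⟨hQ, hQ'⟩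
    refine ⟨fun V W h φ ↦ ?_, fun x hx ↦ ?_⟩
    · simp only [Pi.mul_apply, Module.End.mul_apply]
      rw [hP V W h, hQ V W h]
    · obtain ⟨V, hxV, m, hm⟩ := hP' x hx
      obtain ⟨V', hxV', n, hn⟩ := hQ' x hx
      exact ⟨⟨V.1 ⊓ V'.1, le_trans (b := V.1) inf_le_left V.2⟩, ⟨hxV, hxV'⟩, m + n, fun W hW ↦
        (hm W (hW.trans inf_le_left)).mul (hn W (hW.trans inf_le_right))⟩
  add_mem' := by
    rintro P Q ⟨hP, hP'⟩ ⟨hQ, hQ'⟩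
    refine ⟨fun V W h φ ↦ ?_, fun x hx ↦ ?_⟩
    · simp only [Pi.add_apply, LinearMap.add_apply]
      rw [map_add, hP V W h, hQ V W h]
    · obtain ⟨V, hxV, m, hm⟩ := hP' x hx
      obtain ⟨V', hxV', n, hn⟩ := hQ' x hx
      exact ⟨⟨V.1 ⊓ V'.1, le_trans (b := V.1) inf_le_left V.2⟩, ⟨hxV, hxV'⟩, m + n, fun W hW ↦
        ((hm W (hW.trans inf_le_left)).mono (by omega)).add
          ((hn W (hW.trans inf_le_right)).mono (by omega))⟩
  algebraMap_mem' c := by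
    refine ⟨fun V W h φ ↦ by simp, fun x hx ↦ ⟨⟨U, le_refl U⟩, hx, 0, fun W _ ↦ ?_⟩⟩
    have h1 : algebraMap K (∀ V : Set.Iic U, Module.End (Fn 𝒪 V.1) (𝓛.JetSec V.1)) c W =
        c • LinearMap.mulLeft (Fn 𝒪 W.1) (1 : 𝓛.JetSec W.1) := by
      ext φ
      simp
    rw [h1]
    exact (IsDiffOp.mulLeft _).smul c

/-- The sections of the sheaf of differential operators on jets. -/
def DiffSec (U : Opens X) : Type u := 𝓛.diffSubalgebra U

instance (U : Opens X) : Ring (𝓛.DiffSec U) := inferInstanceAs (Ring (𝓛.diffSubalgebra U))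

instance (U : Opens X) : Algebra K (𝓛.DiffSec U) :=
  inferInstanceAs (Algebra K (𝓛.diffSubalgebra U))

variable {𝓛}

/-- The component of a differential operator on a smaller open subset. -/
def DiffSec.on {U : Opens X} (P : 𝓛.DiffSec U) (V : Opens X) (h : V ≤ U) :
    Module.End (Fn 𝒪 V) (𝓛.JetSec V) := P.1 ⟨V, h⟩

theorem DiffSec.compat {U V W : Opens X} (P : 𝓛.DiffSec U) (hV : V ≤ U) (h : W ≤ V)
    (φ : 𝓛.JetSec V) : jetRes h (P.on V hV φ) = P.on W (h.trans hV) (jetRes h φ) :=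
  P.2.1 ⟨V, hV⟩ ⟨W, h.trans hV⟩ h φ

theorem DiffSec.order {U : Opens X} (P : 𝓛.DiffSec U) (x : X) (hx : x ∈ U) :
    ∃ (V : Opens X) (hV : V ≤ U), x ∈ V ∧ ∃ n : ℕ, ∀ (W : Opens X) (h : W ≤ V),
      IsDiffOp (Fn 𝒪 W) n (P.on W (h.trans hV)) := by
  obtain ⟨V, hxV, n, hn⟩ := P.2.2 x hx
  exact ⟨V.1, V.2, hxV, n, fun W h ↦ hn ⟨W, h.trans V.2⟩ h⟩

/-- Build a differential operator from its components. -/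
def DiffSec.mk {U : Opens X} (P : ∀ V : Opens X, V ≤ U → Module.End (Fn 𝒪 V) (𝓛.JetSec V))
    (hP : ∀ (V W : Opens X) (hV : V ≤ U) (h : W ≤ V) (φ : 𝓛.JetSec V),
      jetRes h (P V hV φ) = P W (h.trans hV) (jetRes h φ))
    (hP' : ∀ x ∈ U, ∃ (V : Opens X) (hV : V ≤ U), x ∈ V ∧ ∃ n : ℕ, ∀ (W : Opens X) (h : W ≤ V),
      IsDiffOp (Fn 𝒪 W) n (P W (h.trans hV))) : 𝓛.DiffSec U :=
  ⟨fun V ↦ P V.1 V.2, fun V W h ↦ hP V.1 W.1 V.2 h, fun x hx ↦ by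
    obtain ⟨V, hV, hxV, n, hn⟩ := hP' x hx
    exact ⟨⟨V, hV⟩, hxV, n, fun W h ↦ hn W.1 h⟩⟩

@[simp] theorem DiffSec.mk_on {U : Opens X}
    (P : ∀ V : Opens X, V ≤ U → Module.End (Fn 𝒪 V) (𝓛.JetSec V)) (hP hP') (V : Opens X)
    (h : V ≤ U) : (DiffSec.mk P hP hP' : 𝓛.DiffSec U).on V h = P V h := rfl

theorem DiffSec.ext {U : Opens X} {P Q : 𝓛.DiffSec U} (h : ∀ V hV, P.on V hV = Q.on V hV) :
    P = Q :=
  Subtype.ext (funext fun V ↦ h V.1 V.2)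

@[simp] theorem DiffSec.add_on {U : Opens X} (P Q : 𝓛.DiffSec U) (V : Opens X) (h : V ≤ U) :
    (P + Q).on V h = P.on V h + Q.on V h := rfl

@[simp] theorem DiffSec.mul_on {U : Opens X} (P Q : 𝓛.DiffSec U) (V : Opens X) (h : V ≤ U) :
    (P * Q).on V h = P.on V h * Q.on V h := rfl

@[simp] theorem DiffSec.one_on {U : Opens X} (V : Opens X) (h : V ≤ U) :
    (1 : 𝓛.DiffSec U).on V h = 1 := rfl

@[simp] theorem DiffSec.zero_on {U : Opens X} (V : Opens X) (h : V ≤ U) :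
    (0 : 𝓛.DiffSec U).on V h = 0 := rfl

@[simp] theorem DiffSec.kSmul_on {U : Opens X} (c : K) (P : 𝓛.DiffSec U) (V : Opens X)
    (h : V ≤ U) : (c • P).on V h = c • P.on V h := rfl

/-- Multiplication by functions, for the first `𝒪`-module structure. -/
def DiffSec.scalar (U : Opens X) : Fn 𝒪 U →+* 𝓛.DiffSec U where
  toFun a := DiffSec.mk (fun V h ↦ algebraMap _ _ (Fn.res 𝒪 h a))
    (fun V W hV h φ ↦ by
      simp only [Module.algebraMap_end_apply, jetRes_smul, Fn.res_trans])
    (fun x hx ↦ ⟨U, le_refl U, hx, 0, fun W h ↦ by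
      have h1 : algebraMap _ (Module.End (Fn 𝒪 W) (𝓛.JetSec W)) (Fn.res 𝒪 h a) =
          LinearMap.mulLeft (Fn 𝒪 W) (algebraMap _ (𝓛.JetSec W) (Fn.res 𝒪 h a)) := by
        ext φ
        simp [← Algebra.smul_def]
      rw [h1]
      exact IsDiffOp.mulLeft _⟩)
  map_one' := DiffSec.ext fun V h ↦ by simp
  map_mul' a b := DiffSec.ext fun V h ↦ by simp
  map_zero' := DiffSec.ext fun V h ↦ by simp
  map_add' a b := DiffSec.ext fun V h ↦ by simp

instance (U : Opens X) : Algebra (Fn 𝒪 U) (𝓛.DiffSec U) :=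
  (DiffSec.scalar U).toAlgebra' fun a P ↦ DiffSec.ext fun V h ↦ by
    simp only [DiffSec.mul_on, DiffSec.scalar, RingHom.coe_mk, MonoidHom.coe_mk, OneHom.coe_mk,
      DiffSec.mk_on]
    exact Algebra.commutes _ _

@[simp] theorem DiffSec.smul_on {U : Opens X} (a : Fn 𝒪 U) (P : 𝓛.DiffSec U) (V : Opens X)
    (h : V ≤ U) : (a • P).on V h = Fn.res 𝒪 h a • P.on V h := by
  rw [Algebra.smul_def (Fn.res 𝒪 h a)]
  rfl

instance (U : Opens X) : IsScalarTower K (Fn 𝒪 U) (𝓛.DiffSec U) where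
  smul_assoc c a P := DiffSec.ext fun V h ↦ by simp

/-- Restriction of differential operators. -/
def diffRes {U V : Opens X} (h : V ≤ U) : 𝓛.DiffSec U →ₐ[K] 𝓛.DiffSec V where
  toFun P := DiffSec.mk (fun W hW ↦ P.on W (hW.trans h)) (fun _ _ hW h' ↦ P.compat (hW.trans h) h')
    (fun x hx ↦ by
      obtain ⟨W, hW, hxW, n, hn⟩ := P.order x (h hx)
      exact ⟨W ⊓ V, inf_le_right, ⟨hxW, hx⟩, n, fun W' h' ↦ hn W' (h'.trans inf_le_left)⟩)
  map_one' := rfl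
  map_mul' _ _ := rfl
  map_zero' := rfl
  map_add' _ _ := rfl
  commutes' _ := rfl

@[simp] theorem diffRes_on {U V W : Opens X} (h : V ≤ U) (P : 𝓛.DiffSec U) (hW : W ≤ V) :
    (diffRes h P).on W hW = P.on W (hW.trans h) := rfl

/-- The commutator `[∇⁽¹⁾ₓ, P]` of the first connection on jets with an `𝒪`-linear operator. -/
def connCommutator {U : Opens X} (x : 𝓛.sec U) (P : Module.End (Fn 𝒪 U) (𝓛.JetSec U)) :
    Module.End (Fn 𝒪 U) (𝓛.JetSec U) where
  toFun φ := jetConn U x (P φ) - P (jetConn U x φ)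
  map_add' φ ψ := by
    simp only [map_add]
    abel
  map_smul' a φ := by
    simp only [map_smul, map_add, jetConn_smul, smul_sub, RingHom.id_apply]
    abel

@[simp] theorem connCommutator_apply {U : Opens X} (x : 𝓛.sec U)
    (P : Module.End (Fn 𝒪 U) (𝓛.JetSec U)) (φ : 𝓛.JetSec U) :
    connCommutator x P φ = jetConn U x (P φ) - P (jetConn U x φ) := rfl

/-- The operator `[∇⁽¹⁾ₓ, P]` for a section `P` of `Diff_{𝒪₁}(𝒥(𝓛))`. -/
def diffCommutator {U : Opens X} (x : 𝓛.sec U) (P : 𝓛.DiffSec U) : 𝓛.DiffSec U :=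
  DiffSec.mk (fun V h ↦ connCommutator (𝓛.res h x) (P.on V h))
    (fun V W hV h φ ↦ by
      simp only [connCommutator_apply, map_sub, jetRes_conn, P.compat, 𝓛.res_trans])
    (fun y hy ↦ by
      obtain ⟨V, hV, hyV, n, hn⟩ := P.order y hy
      exact ⟨V, hV, hyV, n, fun W h ↦
        (hn W h).conn (jetConn W (𝓛.res (h.trans hV) x)) (jetConn_mul _) (fun φ ↦ rfl)⟩)

@[simp] theorem diffCommutator_on {U : Opens X} (x : 𝓛.sec U) (P : 𝓛.DiffSec U) (V : Opens X)
    (h : V ≤ U) : (diffCommutator x P).on V h = connCommutator (𝓛.res h x) (P.on V h) := rfl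

/-- The flat connection on `Diff_{𝒪₁}(𝒥(𝓛))` induced by `∇⁽¹⁾`: `P ↦ [∇⁽¹⁾ₓ, P]`. -/
def diffConn (U : Opens X) : 𝓛.sec U →ₗ[Fn 𝒪 U] Module.End K (𝓛.DiffSec U) where
  toFun x :=
    { toFun := diffCommutator x
      map_add' := fun P Q ↦ DiffSec.ext fun V h ↦ by
        ext φ
        simp only [diffCommutator_on, DiffSec.add_on, connCommutator_apply, LinearMap.add_apply,
          map_add]
        abel
      map_smul' := fun c P ↦ DiffSec.ext fun V h ↦ by
        ext φ
        simp only [diffCommutator_on, DiffSec.kSmul_on, connCommutator_apply, LinearMap.smul_apply,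
          map_smul, RingHom.id_apply, smul_sub] }
  map_add' x y := by
    ext P
    refine DiffSec.ext fun V h ↦ ?_
    ext φ
    simp only [LinearMap.coe_mk, AddHom.coe_mk, diffCommutator_on, DiffSec.add_on,
      connCommutator_apply, LinearMap.add_apply, map_add]
    abel
  map_smul' a x := by
    ext P
    refine DiffSec.ext fun V h ↦ ?_
    ext φ
    simp only [LinearMap.coe_mk, AddHom.coe_mk, diffCommutator_on, DiffSec.smul_on,
      connCommutator_apply, LinearMap.smul_apply, map_smul, (𝓛.res h).map_smul_apply, smul_sub,
      RingHom.id_apply]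

theorem diffConn_on {U : Opens X} (x : 𝓛.sec U) (P : 𝓛.DiffSec U) (V : Opens X) (h : V ≤ U) :
    (diffConn U x P).on V h = connCommutator (𝓛.res h x) (P.on V h) := rfl

theorem diffConn_smul {U : Opens X} (x : 𝓛.sec U) (a : Fn 𝒪 U) (P : 𝓛.DiffSec U) :
    diffConn U x (a • P) = a • diffConn U x P + ⁅x, a⁆ • P := DiffSec.ext fun V h ↦ by
  ext φ
  simp only [diffConn_on, DiffSec.smul_on, DiffSec.add_on, connCommutator_apply,
    LinearMap.smul_apply, LinearMap.add_apply, jetConn_smul, (𝓛.res h).apply_lie, smul_sub]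
  abel

theorem diffRes_conn {U V : Opens X} (h : V ≤ U) (x : 𝓛.sec U) (P : 𝓛.DiffSec U) :
    diffRes h (diffConn U x P) = diffConn V (𝓛.res h x) (diffRes h P) :=
  DiffSec.ext fun W hW ↦ by
    simp only [diffRes_on, diffConn_on, 𝓛.res_trans]

theorem isDiffOp_fn {U : Opens X} (a : Fn 𝒪 U) :
    IsDiffOp (Fn 𝒪 U) 0 (jetActTwo U (Env.fn K (Fn 𝒪 U) (𝓛.sec U) a)) := by
  intro ψ
  ext φ
  refine JetSec.ext fun V h ↦ ?_
  simp [envRes, Jet.actTwo_fn_mul']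

theorem isDiffOp_vec {U : Opens X} (x : 𝓛.sec U) :
    IsDiffOp (Fn 𝒪 U) 1 (jetActTwo U (Env.vec K (R := Fn 𝒪 U) x)) := by
  intro ψ
  have h1 : jetActTwo U (Env.vec K (R := Fn 𝒪 U) x) * LinearMap.mulLeft (Fn 𝒪 U) ψ -
      LinearMap.mulLeft (Fn 𝒪 U) ψ * jetActTwo U (Env.vec K (R := Fn 𝒪 U) x) =
        LinearMap.mulLeft (Fn 𝒪 U) (jetActTwo U (Env.vec K (R := Fn 𝒪 U) x) ψ) := by
    ext φ
    refine JetSec.ext fun V h ↦ ?_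
    simp [envRes, Jet.actTwo_vec_mul]
  rw [h1]
  exact IsDiffOp.mulLeft _

/-- The map `D ↦ (φ ↦ D ·₂ φ)` from the enveloping algebra to differential operators on jets. -/
def envToDiff (U : Opens X) : 𝓛.EnvSec U →ₐ[K] 𝓛.DiffSec U :=
  let F : 𝓛.EnvSec U →ₐ[K] ∀ V : Set.Iic U, Module.End (Fn 𝒪 V.1) (𝓛.JetSec V.1) :=
    AlgHom.pi fun V : Set.Iic U ↦ (jetActTwo V.1).comp (𝓛.envRes (show V.1 ≤ U from V.2))
  F.codRestrict (𝓛.diffSubalgebra U) (fun D ↦ by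
    have hcompat : ∀ (D : 𝓛.EnvSec U) (V W : Set.Iic U) (h : W.1 ≤ V.1) (φ : 𝓛.JetSec V.1),
        jetRes h (F D V φ) = F D W (jetRes h φ) := fun D V W h φ ↦
      (jetRes_actTwo h _ φ).trans
        (congrArg (fun E ↦ jetActTwo W.1 E (jetRes h φ)) (𝓛.envRes_trans (show V.1 ≤ U from V.2) h D))
    have := Env.mem_of_generators ((𝓛.diffSubalgebra U).comap F)
      (fun a ↦ ⟨hcompat _, fun x hx ↦ ⟨⟨U, le_refl U⟩, hx, 0, fun W hW ↦ by
        have h1 := isDiffOp_fn (𝓛 := 𝓛) (Fn.res 𝒪 hW a)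
        rw [← Env.map_fn (𝓛.res hW) a] at h1
        exact h1⟩⟩)
      (fun y ↦ ⟨hcompat _, fun x hx ↦ ⟨⟨U, le_refl U⟩, hx, 1, fun W hW ↦ by
        have h1 := isDiffOp_vec (𝓛 := 𝓛) (𝓛.res hW y)
        rw [← Env.map_vec (𝓛.res hW) y] at h1
        exact h1⟩⟩) D
    exact this)

theorem envToDiff_on {U : Opens X} (D : 𝓛.EnvSec U) (V : Opens X) (h : V ≤ U) :
    (envToDiff U D).on V h = jetActTwo V (𝓛.envRes h D) := rfl

theorem diffRes_envToDiff {U V : Opens X} (h : V ≤ U) (D : 𝓛.EnvSec U) :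
    diffRes h (envToDiff U D) = envToDiff V (𝓛.envRes h D) := DiffSec.ext fun W hW ↦ by
  rw [diffRes_on, envToDiff_on, envToDiff_on, envRes_trans]

theorem diffConn_envToDiff {U : Opens X} (x : 𝓛.sec U) (D : 𝓛.EnvSec U) :
    diffConn U x (envToDiff U D) = 0 := DiffSec.ext fun V h ↦ by
  ext φ
  rw [diffConn_on, connCommutator_apply, envToDiff_on, jetConn_actTwo, sub_self]
  rfl

variable (𝓛)

/-- The sections over `U` of the sheaf `Ω^p_{𝓛₁}(Diff_{𝒪₁}(𝒥(𝓛)))` of `p`-forms on `𝓛` with values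
in `Diff_{𝒪₁}(𝒥(𝓛))`: morphisms of sheaves `𝓛|_U × ⋯ × 𝓛|_U → Diff_{𝒪₁}(𝒥(𝓛))|_U` that are
alternating and `𝒪`-multilinear for the first `𝒪`-module structure. -/
def formSubmodule (p : ℕ) (U : Opens X) :
    Submodule K (∀ V : Set.Iic U, 𝓛.sec V.1 [⋀^Fin p]→ₗ[Fn 𝒪 V.1] 𝓛.DiffSec V.1) where
  carrier := {ω | ∀ (V W : Set.Iic U) (h : W.1 ≤ V.1) (v : Fin p → 𝓛.sec V.1),
    diffRes h (ω V v) = ω W (𝓛.res h ∘ v)}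
  add_mem' hω hη V W h v := by
    simp only [Pi.add_apply, AlternatingMap.add_apply, map_add]
    rw [hω V W h, hη V W h]
  zero_mem' V W h v := by simp
  smul_mem' c ω hω V W h v := by
    simp only [Pi.smul_apply, AlternatingMap.smul_apply, map_smul]
    rw [hω V W h]

/-- The sections of the sheaf of `p`-forms with values in differential operators on jets. -/
def FormSec (p : ℕ) (U : Opens X) : Type u := 𝓛.formSubmodule p U

instance (p : ℕ) (U : Opens X) : AddCommGroup (𝓛.FormSec p U) :=
  inferInstanceAs (AddCommGroup (𝓛.formSubmodule p U))

instance (p : ℕ) (U : Opens X) : Module K (𝓛.FormSec p U) :=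
  inferInstanceAs (Module K (𝓛.formSubmodule p U))

variable {𝓛}

/-- The component of a form on a smaller open subset. -/
def FormSec.on {p : ℕ} {U : Opens X} (ω : 𝓛.FormSec p U) (V : Opens X) (h : V ≤ U) :
    𝓛.sec V [⋀^Fin p]→ₗ[Fn 𝒪 V] 𝓛.DiffSec V := ω.1 ⟨V, h⟩

theorem FormSec.compat {p : ℕ} {U V W : Opens X} (ω : 𝓛.FormSec p U) (hV : V ≤ U) (h : W ≤ V)
    (v : Fin p → 𝓛.sec V) : diffRes h (ω.on V hV v) = ω.on W (h.trans hV) (𝓛.res h ∘ v) :=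
  ω.2 ⟨V, hV⟩ ⟨W, h.trans hV⟩ h v

/-- Build a form from its components. -/
def FormSec.mk {p : ℕ} {U : Opens X}
    (ω : ∀ V : Opens X, V ≤ U → 𝓛.sec V [⋀^Fin p]→ₗ[Fn 𝒪 V] 𝓛.DiffSec V)
    (hω : ∀ (V W : Opens X) (hV : V ≤ U) (h : W ≤ V) (v : Fin p → 𝓛.sec V),
      diffRes h (ω V hV v) = ω W (h.trans hV) (𝓛.res h ∘ v)) : 𝓛.FormSec p U :=
  ⟨fun V ↦ ω V.1 V.2, fun V W h ↦ hω V.1 W.1 V.2 h⟩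

@[simp] theorem FormSec.mk_on {p : ℕ} {U : Opens X}
    (ω : ∀ V : Opens X, V ≤ U → 𝓛.sec V [⋀^Fin p]→ₗ[Fn 𝒪 V] 𝓛.DiffSec V) (hω) (V : Opens X)
    (h : V ≤ U) : (FormSec.mk ω hω : 𝓛.FormSec p U).on V h = ω V h := rfl

theorem FormSec.ext {p : ℕ} {U : Opens X} {ω η : 𝓛.FormSec p U}
    (h : ∀ V hV, ω.on V hV = η.on V hV) : ω = η :=
  Subtype.ext (funext fun V ↦ h V.1 V.2)

@[simp] theorem FormSec.add_on {p : ℕ} {U : Opens X} (ω η : 𝓛.FormSec p U) (V : Opens X)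
    (h : V ≤ U) : (ω + η).on V h = ω.on V h + η.on V h := rfl

@[simp] theorem FormSec.smul_on {p : ℕ} {U : Opens X} (c : K) (ω : 𝓛.FormSec p U) (V : Opens X)
    (h : V ≤ U) : (c • ω).on V h = c • ω.on V h := rfl

/-- Restriction of forms. -/
def formRes {p : ℕ} {U V : Opens X} (h : V ≤ U) : 𝓛.FormSec p U →ₗ[K] 𝓛.FormSec p V where
  toFun ω := FormSec.mk (fun W hW ↦ ω.on W (hW.trans h)) (fun _ _ hW h' ↦ ω.compat (hW.trans h) h')
  map_add' _ _ := rfl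
  map_smul' _ _ := rfl

@[simp] theorem formRes_on {p : ℕ} {U V W : Opens X} (h : V ≤ U) (ω : 𝓛.FormSec p U)
    (hW : W ≤ V) : (formRes h ω).on W hW = ω.on W (hW.trans h) := rfl

/-- The product of forms: the wedge product combined with the composition of differential
operators. -/
def formMul {p q : ℕ} {U : Opens X} (ω : 𝓛.FormSec p U) (η : 𝓛.FormSec q U) :
    𝓛.FormSec (p + q) U :=
  FormSec.mk (fun V h ↦ wedge (ω.on V h) (η.on V h)) (fun _ _ hV h v ↦
    wedge_map _ _ _ _ (diffRes h : _ →ₐ[K] _).toRingHom (𝓛.res h) (ω.compat hV h)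
      (η.compat hV h) v)

/-- The unit `0`-form. -/
def formOne (U : Opens X) : 𝓛.FormSec 0 U :=
  FormSec.mk (fun _ _ ↦ AlternatingMap.constOfIsEmpty _ _ (Fin 0) 1) (fun _ _ _ h _ ↦
    map_one (diffRes h))

/-- The inclusion of the enveloping algebra in the `0`-forms. -/
def envToForm (U : Opens X) : 𝓛.EnvSec U →ₗ[K] 𝓛.FormSec 0 U where
  toFun D := FormSec.mk
    (fun V h ↦ AlternatingMap.constOfIsEmpty _ _ (Fin 0) (envToDiff V (𝓛.envRes h D)))
    (fun V W hV h v ↦ by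
      change diffRes h (envToDiff V (𝓛.envRes hV D)) = envToDiff W (𝓛.envRes (h.trans hV) D)
      rw [diffRes_envToDiff, envRes_trans])
  map_add' D E := FormSec.ext fun V h ↦ by
    ext v
    simp
  map_smul' c D := FormSec.ext fun V h ↦ by
    ext v
    simp

variable [CharZero K]

theorem diffRes_koszul {p : ℕ} {U : Opens X} (ω : 𝓛.FormSec p U) {V W : Opens X} (hV : V ≤ U)
    (h : W ≤ V) (v : Fin (p + 1) → 𝓛.sec V) :
    diffRes h (koszulFun (diffConn V) (ω.on V hV) v) =
      koszulFun (diffConn W) (ω.on W (h.trans hV)) (𝓛.res h ∘ v) := by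
  have h1 : diffRes h (bracketSum (ω.on V hV) v) =
      bracketSum (ω.on W (h.trans hV)) (𝓛.res h ∘ v) := by
    cases p with
    | zero => exact map_zero (diffRes h)
    | succ n =>
      simp only [bracketSum, map_sum, map_zsmul, ω.compat hV h]
      refine Finset.sum_congr rfl fun i _ ↦ Finset.sum_congr rfl fun j _ ↦ ?_
      congr 2
      refine funext (Fin.cases ?_ fun k ↦ ?_)
      · exact LieHom.map_lie _ _ _
      · rfl
  rw [koszulFun, koszulFun, map_add, h1]
  simp only [map_sum, map_zsmul, diffRes_conn, ω.compat hV h]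
  rfl

/-- The Chevalley–Eilenberg differential of a form. -/
def formDFun {p : ℕ} {U : Opens X} (ω : 𝓛.FormSec p U) : 𝓛.FormSec (p + 1) U :=
  FormSec.mk (fun V h ↦ koszul (diffConn V) diffConn_smul (ω.on V h))
    (fun _ _ hV h v ↦ diffRes_koszul ω hV h v)

theorem formDFun_on {p : ℕ} {U : Opens X} (ω : 𝓛.FormSec p U) (V : Opens X) (h : V ≤ U)
    (v : Fin (p + 1) → 𝓛.sec V) :
    (formDFun ω).on V h v = koszulFun (diffConn V) (ω.on V h) v := rfl

/-- The Chevalley–Eilenberg differential. -/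
def formD (p : ℕ) (U : Opens X) : 𝓛.FormSec p U →ₗ[K] 𝓛.FormSec (p + 1) U where
  toFun := formDFun
  map_add' ω η := FormSec.ext fun V h ↦ by
    ext v
    cases p <;>
    simp only [formDFun_on, FormSec.add_on, AlternatingMap.add_apply, koszulFun,
      bracketSum, map_add, smul_add, Finset.sum_add_distrib, add_zero]
    abel
  map_smul' c ω := FormSec.ext fun V h ↦ by
    ext v
    cases p <;>
    simp only [formDFun_on, FormSec.smul_on, AlternatingMap.smul_apply, koszulFun,
      bracketSum, map_smul, smul_add, Finset.smul_sum, smul_zero, RingHom.id_apply,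
      smul_comm _ c]

theorem formD_envToForm {U : Opens X} (D : 𝓛.EnvSec U) : formD 0 U (envToForm U D) = 0 :=
  FormSec.ext fun V h ↦ by
    ext v
    have h0 : ∀ w, (envToForm U D).on V h w = envToDiff V (𝓛.envRes h D) := fun _ ↦ rfl
    change koszulFun (diffConn V) ((envToForm U D).on V h) v = 0
    simp only [koszulFun, bracketSum, h0, diffConn_envToDiff, smul_zero, Finset.sum_const_zero,
      add_zero]

variable (𝓛)

/-- The presheaf of `p`-forms with values in differential operators on jets. -/
def formPresheaf (p : ℕ) : TopCat.Presheaf (ModuleCat.{u} K) X where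
  obj U := ModuleCat.of K (𝓛.FormSec p U.unop)
  map f := ModuleCat.ofHom (formRes f.unop.le)
  map_id _ := rfl
  map_comp _ _ := rfl

/-- The Chevalley–Eilenberg differential as a morphism of presheaves. -/
def formDHom (p : ℕ) : 𝓛.formPresheaf p ⟶ 𝓛.formPresheaf (p + 1) where
  app U := ModuleCat.ofHom (formD p U.unop)
  naturality _ _ _ := rfl

/-- The inclusion of the presheaf of enveloping algebras in the `0`-forms. -/
def envToFormHom : 𝓛.envPresheaf ⟶ 𝓛.formPresheaf 0 where
  app U := ModuleCat.ofHom (envToForm U.unop)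
  naturality U V f := by
    ext D
    refine FormSec.ext fun W hW ↦ ?_
    ext v
    exact congrArg (envToDiff W) (𝓛.envRes_trans f.unop.le hW D)

/-- The Chevalley–Eilenberg complex `Ω^•_{𝓛₁}(Diff_{𝒪₁}(𝒥(𝓛)))` is a sheaf of differential graded
algebras. -/
structure IsSheafOfDGAlgebras : Prop where
  isSheaf : ∀ p, (𝓛.formPresheaf p).IsSheaf
  isDGAlgebra : ∀ U : Opens X, IsDGAlgebra K (fun p ↦ 𝓛.FormSec p U) (fun p ↦ formD p U)
    formMul (formOne U)
  res_d : ∀ {U V : Opens X} (h : V ≤ U) {p : ℕ} (ω : 𝓛.FormSec p U),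
    formRes h (formD p U ω) = formD p V (formRes h ω)
  res_mul : ∀ {U V : Opens X} (h : V ≤ U) {p q : ℕ} (ω : 𝓛.FormSec p U) (η : 𝓛.FormSec q U),
    formRes h (formMul ω η) = formMul (formRes h ω) (formRes h η)
  res_one : ∀ {U V : Opens X} (h : V ≤ U), formRes h (formOne (𝓛 := 𝓛) U) = formOne V

variable {𝓛}

/-- The sheaf of `p`-forms with values in differential operators on jets. -/
def formSheaf (h : 𝓛.IsSheafOfDGAlgebras) (p : ℕ) : TopCat.Sheaf (ModuleCat.{u} K) X :=
  ⟨𝓛.formPresheaf p, h.isSheaf p⟩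

/-- The Chevalley–Eilenberg differential as a morphism of sheaves. -/
def formSheafD (h : 𝓛.IsSheafOfDGAlgebras) (p : ℕ) : formSheaf h p ⟶ formSheaf h (p + 1) :=
  ⟨𝓛.formDHom p⟩

/-- The Chevalley–Eilenberg complex as a cochain complex of sheaves of `K`-modules. -/
def formComplex (h : 𝓛.IsSheafOfDGAlgebras) :
    CochainComplex (TopCat.Sheaf (ModuleCat.{u} K) X) ℕ :=
  CochainComplex.of (formSheaf h) (formSheafD h) (fun p ↦ by
    apply Sheaf.hom_ext
    ext U ω
    exact LinearMap.congr_fun ((h.isDGAlgebra U.unop).d_comp_d p) ω)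

variable (𝓛) in
/-- The sheaf `𝒰(𝓛)` associated with the presheaf of enveloping algebras. -/
def envSheaf : TopCat.Sheaf (ModuleCat.{u} K) X :=
  (presheafToSheaf (Opens.grothendieckTopology X) (ModuleCat.{u} K)).obj 𝓛.envPresheaf

/-- The inclusion of `𝒰(𝓛)` in the sheaf of `0`-forms, induced by `D ↦ (φ ↦ D ·₂ φ)`. -/
def envToFormSheaf (h : 𝓛.IsSheafOfDGAlgebras) : 𝓛.envSheaf ⟶ formSheaf h 0 :=
  ⟨sheafifyLift (Opens.grothendieckTopology X) 𝓛.envToFormHom (h.isSheaf 0)⟩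

theorem envToFormSheaf_comp_d (h : 𝓛.IsSheafOfDGAlgebras) :
    envToFormSheaf h ≫ (formComplex h).d 0 1 = 0 := by
  have h1 : (formComplex h).d 0 1 = formSheafD h 0 :=
    CochainComplex.of_d (formSheaf h) (formSheafD h) 0
  rw [h1]
  apply Sheaf.hom_ext
  refine sheafify_hom_ext (Opens.grothendieckTopology X) _ _ (h.isSheaf 1) ?_
  have h2 : toSheafify (Opens.grothendieckTopology X) 𝓛.envPresheaf ≫ (envToFormSheaf h).hom =
      𝓛.envToFormHom := toSheafify_sheafifyLift _ _ _
  have h3 : 𝓛.envToFormHom ≫ 𝓛.formDHom 0 = 0 := by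
    ext U D
    exact formD_envToForm D
  exact (Category.assoc _ _ _).symm.trans ((congrArg (· ≫ 𝓛.formDHom 0) h2).trans
    (h3.trans Limits.comp_zero.symm))

/-- The inclusion of `𝒰(𝓛)`, as a complex concentrated in degree `0`, in the Chevalley–Eilenberg
complex. -/
def envInclusion (h : 𝓛.IsSheafOfDGAlgebras) :
    (CochainComplex.single₀ _).obj 𝓛.envSheaf ⟶ formComplex h :=
  (CochainComplex.fromSingle₀Equiv (formComplex h) 𝓛.envSheaf).symm
    ⟨envToFormSheaf h, envToFormSheaf_comp_d h⟩

end LieAlgebroid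

end LieRinehart

end

/-! Part (ii) is local, and near a point `𝓛` has a frame `b₁, …, b_r`. By the Poincaré–Birkhoff–Witt
theorem (`PBW.equiv`) the ordered monomials in the frame are a basis of the enveloping algebra over
functions. A jet is therefore the family of its values on these monomials, and jets multiply by
convolution (`PBW.coord`): they are formal power series in `r` variables, in divided power
normalisation. To leading order `∇⁽¹⁾` acts along `bᵢ` as `-∂ᵢ`. This gives a Poincaré lemma for
jet-valued forms (`Coord.IsCoordConn.exists_primitive`): if `ω` is a closed `(p + 1)`-form vanishing
to order `k`, the differential of its contraction with the Euler field is `-(p + 1 + k) ω` up to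
order `k + 1`, so a primitive is found by successive corrections.

In characteristic zero the second actions of the ordered monomials of degree at most `n` form a
basis, over jets, of the differential operators of order at most `n` (`Coord.sum_coeffs`,
`Coord.eq_zero_of_sum_eq_zero`). These operators commute with `∇⁽¹⁾`, so forms with values in
operators of order at most `n` split into copies of jet-valued forms. Hence closed forms of positive
degree are locally exact. In degree zero a flat operator has flat coefficients; flat jets are the
functions of the second module structure (`Jet.eq_actTwo_of_conn_eq_zero`), so flat operators of
bounded order come from the enveloping algebra. A form has finitely many values on a frame, so a
common bound on the order exists after shrinking. Jets separate elements of the enveloping algebra,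
which gives injectivity.

For part (i), forms are viewed as functions of lists, where differential and product are defined by
recursion on the head of the list (Cartan's formula and the graded derivation property of
contraction); `d² = 0`, the Leibniz rule and associativity become list inductions. `ofAlt_koszul`
and `ofAlt_wedge` identify these with the Koszul formula and the shuffle product. The sheaf property
holds because natural families of maps into a sheaf glue; this is applied in turn to jets, operators
and forms. -/

namespace LieRinehart

/-! ### Cartan calculus for functions of lists. -/

namespace ListForm

section Module

variable {L M : Type*} [LieRing L] [AddCommGroup M]

/-- The contraction of a function of lists with a vector. -/
def contract (x : L) (f : List L → M) : List L → M := fun l ↦ f (x :: l)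

/-- The Lie derivative of a function of lists. -/
def lieDer (D : L → M →+ M) (x : L) : (List L → M) → List L → M
  | f, [] => D x (f [])
  | f, y :: l => lieDer D x (contract y f) l - f (⁅x, y⁆ :: l)

/-- The Chevalley–Eilenberg differential of a function of lists, defined by Cartan's formula. -/
def diff (D : L → M →+ M) : (List L → M) → List L → M
  | _, [] => 0
  | f, x :: l => lieDer D x f l - diff D (contract x f) l

/-- The grading involution. -/
def signed (f : List L → M) : List L → M := fun l ↦ (-1 : ℤ) ^ l.length • f l

/-- Additivity in every argument. -/
def Additive (f : List L → M) : Prop :=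
  ∀ (l₁ l₂ : List L) (x y : L), f (l₁ ++ (x - y) :: l₂) = f (l₁ ++ x :: l₂) - f (l₁ ++ y :: l₂)

theorem Additive.contract {f : List L → M} (hf : Additive f) (x : L) :
    Additive (contract x f) := fun l₁ l₂ y z ↦ hf (x :: l₁) l₂ y z

theorem Additive.sub_cons {f : List L → M} (hf : Additive f) (x y : L) (l : List L) :
    f ((x - y) :: l) = f (x :: l) - f (y :: l) := hf [] l x y

theorem contract_add (x : L) (f g : List L → M) :
    contract x (f + g) = contract x f + contract x g := rfl

theorem contract_sub (x : L) (f g : List L → M) :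
    contract x (f - g) = contract x f - contract x g := rfl

theorem contract_signed (x : L) (f : List L → M) :
    contract x (signed f) = -signed (contract x f) := by
  funext l
  simp [contract, signed, pow_succ]

theorem contract_neg (x : L) (f : List L → M) : contract x (-f) = -contract x f := rfl

variable (D : L → M →+ M)

theorem contract_lieDer (x y : L) (f : List L → M) :
    contract y (lieDer D x f) = lieDer D x (contract y f) - contract ⁅x, y⁆ f := rfl

theorem contract_diff (x : L) (f : List L → M) :
    contract x (diff D f) = lieDer D x f - diff D (contract x f) := rfl

theorem lieDer_sub (x : L) (f g : List L → M) :
    lieDer D x (f - g) = lieDer D x f - lieDer D x g := by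
  funext l
  induction l generalizing f g with
  | nil => simp [lieDer]
  | cons y l ih =>
    simp only [lieDer, contract_sub, ih, Pi.sub_apply]
    abel

theorem lieDer_neg (x : L) (f : List L → M) : lieDer D x (-f) = -lieDer D x f := by
  funext l
  induction l generalizing f with
  | nil => simp [lieDer]
  | cons y l ih =>
    simp only [lieDer, contract_neg, ih, Pi.neg_apply]
    abel

theorem diff_sub (f g : List L → M) : diff D (f - g) = diff D f - diff D g := by
  funext l
  induction l generalizing f g with
  | nil => simp [diff]
  | cons y l ih =>
    simp only [diff, contract_sub, ih, lieDer_sub, Pi.sub_apply]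
    abel

theorem diff_neg (f : List L → M) : diff D (-f) = -diff D f := by
  funext l
  induction l generalizing f with
  | nil => simp [diff]
  | cons y l ih =>
    simp only [diff, contract_neg, ih, lieDer_neg, Pi.neg_apply]
    abel

theorem diff_add (f g : List L → M) : diff D (f + g) = diff D f + diff D g := by
  rw [← sub_neg_eq_add f g, diff_sub, diff_neg, sub_neg_eq_add]

theorem signed_add (f g : List L → M) : signed (f + g) = signed f + signed g := by
  funext l
  simp [signed]

theorem lieDer_signed (x : L) (f : List L → M) :
    lieDer D x (signed f) = signed (lieDer D x f) := by
  funext l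
  induction l generalizing f with
  | nil => simp [lieDer, signed]
  | cons y l ih =>
    simp only [lieDer, contract_signed, lieDer_neg, ih, Pi.neg_apply]
    simp only [signed, lieDer, List.length_cons, pow_succ, mul_neg, mul_one, neg_smul, smul_sub]

theorem diff_signed (f : List L → M) : diff D (signed f) = -signed (diff D f) := by
  funext l
  induction l generalizing f with
  | nil => simp [diff, signed]
  | cons y l ih =>
    simp only [diff, contract_signed, diff_neg, ih, lieDer_signed, Pi.neg_apply, neg_neg]
    simp only [signed, diff, List.length_cons, pow_succ, mul_neg, mul_one, neg_smul, smul_sub,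
      neg_sub]
    abel

variable {D} (hD : ∀ x y m, D ⁅x, y⁆ m = D x (D y m) - D y (D x m))
include hD

/-- Flatness of `D` settles the empty list. On a longer list the bracket terms match by the Jacobi
identity, with additivity of `f` used to split `⁅⁅x, y⁆, z⁆`. No alternation of `f` is needed. -/
theorem lieDer_lie {f : List L → M} (hf : Additive f) (x y : L) :
    lieDer D ⁅x, y⁆ f = lieDer D x (lieDer D y f) - lieDer D y (lieDer D x f) := by
  funext l
  induction l generalizing f with
  | nil => simp [lieDer, hD]
  | cons z l ih =>
    have h1 : f (⁅⁅x, y⁆, z⁆ :: l) = f (⁅x, ⁅y, z⁆⁆ :: l) - f (⁅y, ⁅x, z⁆⁆ :: l) := by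
      rw [lie_lie, hf.sub_cons]
    have h2 : ∀ u v : L, lieDer D u (lieDer D v f) (z :: l) =
        lieDer D u (lieDer D v (contract z f)) l - lieDer D u (contract ⁅v, z⁆ f) l
          - (lieDer D v (contract ⁅u, z⁆ f) l - f (⁅v, ⁅u, z⁆⁆ :: l)) := by
      intro u v
      simp only [lieDer, contract_lieDer, lieDer_sub, Pi.sub_apply]
    rw [Pi.sub_apply, h2, h2, lieDer, ih (hf.contract z), h1, Pi.sub_apply]
    abel

/-- Contracting with the head of the list leaves `lieDer_lie` and the same identity on a shorter
list. -/
theorem lieDer_diff {f : List L → M} (hf : Additive f) (x : L) :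
    lieDer D x (diff D f) = diff D (lieDer D x f) := by
  funext l
  induction l generalizing f with
  | nil => simp [lieDer, diff]
  | cons y l ih =>
    have h1 : lieDer D x (diff D f) (y :: l) = lieDer D x (lieDer D y f) l -
        lieDer D x (diff D (contract y f)) l -
        (lieDer D ⁅x, y⁆ f l - diff D (contract ⁅x, y⁆ f) l) := by
      simp only [lieDer, contract_diff, lieDer_sub, Pi.sub_apply, diff]
    have h2 : diff D (lieDer D x f) (y :: l) = lieDer D y (lieDer D x f) l -
        (diff D (lieDer D x (contract y f)) l - diff D (contract ⁅x, y⁆ f) l) := by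
      simp only [diff, contract_lieDer, diff_sub, Pi.sub_apply]
    rw [h1, h2, ih (hf.contract y), lieDer_lie hD hf, Pi.sub_apply]
    abel

/-- By Cartan's formula `ι_x d d = L_x d - d L_x + d d ι_x`; the first two terms cancel and the last
vanishes by induction. -/
theorem diff_diff {f : List L → M} (hf : Additive f) : diff D (diff D f) = 0 := by
  funext l
  induction l generalizing f with
  | nil => simp [diff]
  | cons x l ih =>
    have h1 : diff D (diff D f) (x :: l) = lieDer D x (diff D f) l -
        (diff D (lieDer D x f) l - diff D (diff D (contract x f)) l) := by
      rw [diff, contract_diff, diff_sub, Pi.sub_apply]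
    rw [h1, lieDer_diff hD hf, ih (hf.contract x)]
    simp

end Module

section Algebra

variable {L A : Type*} [LieRing L] [Ring A]

/-- The shuffle product of functions of lists. -/
def mul : (List L → A) → (List L → A) → List L → A
  | f, g, [] => f [] * g []
  | f, g, x :: l => mul (contract x f) g l + mul (signed f) (contract x g) l

theorem contract_mul (x : L) (f g : List L → A) :
    contract x (mul f g) = mul (contract x f) g + mul (signed f) (contract x g) := rfl

theorem signed_signed (f : List L → A) : signed (signed f) = f := by
  funext l
  simp only [signed, smul_smul, ← mul_pow]
  simp

theorem add_mul (f g h : List L → A) : mul (f + g) h = mul f h + mul g h := by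
  funext l
  induction l generalizing f g h with
  | nil => simp [mul, _root_.add_mul]
  | cons x l ih =>
    simp only [mul, contract_add, signed_add, ih, Pi.add_apply]
    abel

theorem mul_add (f g h : List L → A) : mul f (g + h) = mul f g + mul f h := by
  funext l
  induction l generalizing f g h with
  | nil => simp [mul, _root_.mul_add]
  | cons x l ih =>
    simp only [mul, contract_add, ih, Pi.add_apply]
    abel

theorem zero_mul (g : List L → A) : mul 0 g = 0 := by
  have := add_mul 0 0 g
  simpa using this

theorem mul_zero (f : List L → A) : mul f 0 = 0 := by
  have := mul_add f 0 0
  simpa using this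

theorem neg_mul (f g : List L → A) : mul (-f) g = -mul f g := by
  have := add_mul (-f) f g
  rw [neg_add_cancel, zero_mul] at this
  exact eq_neg_of_add_eq_zero_left this.symm

theorem mul_neg (f g : List L → A) : mul f (-g) = -mul f g := by
  have := mul_add f (-g) g
  rw [neg_add_cancel, mul_zero] at this
  exact eq_neg_of_add_eq_zero_left this.symm

theorem sub_mul (f g h : List L → A) : mul (f - g) h = mul f h - mul g h := by
  rw [sub_eq_add_neg, add_mul, neg_mul, sub_eq_add_neg]

theorem mul_sub (f g h : List L → A) : mul f (g - h) = mul f g - mul f h := by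
  rw [sub_eq_add_neg, mul_add, mul_neg, sub_eq_add_neg]

theorem signed_mul (f g : List L → A) : signed (mul f g) = mul (signed f) (signed g) := by
  funext l
  induction l generalizing f g with
  | nil => simp [mul, signed]
  | cons x l ih =>
    simp only [mul, contract_signed, neg_mul, mul_neg, ← ih, Pi.neg_apply]
    simp only [signed, mul, List.length_cons, pow_succ, _root_.mul_neg, mul_one, neg_smul,
      smul_add]

/-- Contraction with the head is a graded derivation of the product by definition, so both sides
obey the same recursion. -/
theorem mul_assoc (f g h : List L → A) : mul (mul f g) h = mul f (mul g h) := by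
  funext l
  induction l generalizing f g h with
  | nil => simp [mul, _root_.mul_assoc]
  | cons x l ih =>
    simp only [mul, contract_mul, signed_mul, add_mul, mul_add, ih, Pi.add_apply]
    abel

/-- The unit for the shuffle product. -/
def one : List L → A
  | [] => 1
  | _ :: _ => 0

theorem contract_one (x : L) : contract x (one : List L → A) = 0 := rfl

theorem signed_one : signed (one : List L → A) = one := by
  funext l
  cases l <;> simp [signed, one]

theorem one_mul (f : List L → A) : mul one f = f := by
  funext l
  induction l generalizing f with
  | nil => simp [mul, one]
  | cons x l ih =>
    simp only [mul, contract_one, zero_mul, signed_one, ih]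
    simp [contract]

theorem mul_one (f : List L → A) : mul f one = f := by
  funext l
  induction l generalizing f with
  | nil => simp [mul, one]
  | cons x l ih =>
    simp only [mul, contract_one, mul_zero, ih]
    simp [contract]

variable {D : L → A →+ A} (hD : ∀ x a b, D x (a * b) = D x a * b + a * D x b)
include hD

theorem lieDer_mul (x : L) (f g : List L → A) :
    lieDer D x (mul f g) = mul (lieDer D x f) g + mul f (lieDer D x g) := by
  have hadd : ∀ f g : List L → A, lieDer D x (f + g) = lieDer D x f + lieDer D x g := by
    intro f g
    rw [← sub_neg_eq_add f g, lieDer_sub, lieDer_neg, sub_neg_eq_add]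
  funext l
  induction l generalizing f g with
  | nil => simp [mul, lieDer, hD]
  | cons y l ih =>
    have h1 : lieDer D x (mul f g) (y :: l) = lieDer D x (mul (contract y f) g) l +
        lieDer D x (mul (signed f) (contract y g)) l -
        (mul (contract ⁅x, y⁆ f) g l + mul (signed f) (contract ⁅x, y⁆ g) l) := by
      rw [lieDer, contract_mul, hadd]
      rfl
    rw [h1, ih, ih]
    simp only [Pi.add_apply, mul, contract_lieDer, sub_mul, mul_sub, Pi.sub_apply, lieDer_signed]
    abel

/-- Contraction with the head reduces this to `lieDer_mul` and the inductive hypothesis. The signs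
agree because both contraction and differential anticommute with `signed`. -/
theorem diff_mul (f g : List L → A) :
    diff D (mul f g) = mul (diff D f) g + mul (signed f) (diff D g) := by
  funext l
  induction l generalizing f g with
  | nil => simp [diff, mul]
  | cons x l ih =>
    simp only [diff, contract_mul, diff_add, Pi.add_apply, ih, lieDer_mul hD, mul, contract_diff,
      sub_mul, mul_sub, Pi.sub_apply, contract_signed, diff_signed, neg_mul, Pi.neg_apply,
      signed_signed]
    abel

end Algebra

end ListForm

end LieRinehart

/-! ### Alternating maps as functions of lists; the wedge product as a recursive shuffle product. -/

namespace LieRinehart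

namespace ListForm

/-- A function of lists concentrated on lists of length `p`. -/
def Homogeneous {L M : Type*} [Zero M] (p : ℕ) (f : List L → M) : Prop :=
  ∀ l : List L, l.length ≠ p → f l = 0

theorem Homogeneous.ext {L M : Type*} [Zero M] {p : ℕ} {f g : List L → M} (hf : Homogeneous p f)
    (hg : Homogeneous p g) (h : ∀ v : Fin p → L, f (List.ofFn v) = g (List.ofFn v)) : f = g := by
  funext l
  by_cases hl : l.length = p
  · subst hl
    simpa using h l.get
  · rw [hf l hl, hg l hl]

section Module

variable {L M : Type*} [LieRing L] [AddCommGroup M]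

theorem Homogeneous.contract {p : ℕ} {f : List L → M} (hf : Homogeneous (p + 1) f) (x : L) :
    Homogeneous p (contract x f) := fun l hl ↦ hf (x :: l) (by simpa using hl)

theorem Homogeneous.contract_zero {f : List L → M} (hf : Homogeneous 0 f) (x : L) :
    ListForm.contract x f = 0 := funext fun l ↦ hf (x :: l) (by simp)

theorem Homogeneous.signed_eq {p : ℕ} {f : List L → M} (hf : Homogeneous p f) :
    signed f = (-1 : ℤ) ^ p • f := by
  funext l
  by_cases hl : l.length = p
  · simp [signed, hl]
  · simp [signed, hf l hl]

variable (D : L → M →+ M)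

theorem lieDer_zero (x : L) : lieDer D x 0 = 0 := by
  have := lieDer_sub D x 0 0
  simpa using this

theorem diff_zero : diff D (0 : List L → M) = 0 := by
  have := diff_sub D 0 0
  simpa using this

theorem Homogeneous.lieDer {p : ℕ} {f : List L → M} (hf : Homogeneous p f) (x : L) :
    Homogeneous p (lieDer D x f) := by
  intro l hl
  induction l generalizing f p with
  | nil => simp [ListForm.lieDer, hf [] hl]
  | cons y l ih =>
    rw [ListForm.lieDer, hf (⁅x, y⁆ :: l) hl, sub_zero]
    cases p with
    | zero => rw [hf.contract_zero, lieDer_zero]; rfl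
    | succ p => exact ih (hf.contract y) (by simpa using hl)

theorem Homogeneous.diff {p : ℕ} {f : List L → M} (hf : Homogeneous p f) :
    Homogeneous (p + 1) (diff D f) := by
  intro l hl
  induction l generalizing f p with
  | nil => rfl
  | cons y l ih =>
    rw [ListForm.diff, hf.lieDer D y l (by simpa using hl), zero_sub, neg_eq_zero]
    cases p with
    | zero => rw [hf.contract_zero, diff_zero]; rfl
    | succ p => exact ih (hf.contract y) (by simpa using hl)

end Module

theorem Homogeneous.mul {L A : Type*} [LieRing L] [Ring A] {p q : ℕ} {f g : List L → A}
    (hf : Homogeneous p f) (hg : Homogeneous q g) : Homogeneous (p + q) (mul f g) := by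
  intro l hl
  induction l generalizing f g p q with
  | nil =>
    rw [ListForm.mul]
    by_cases hp : p = 0
    · subst hp
      rw [hg [] (by simpa using hl), MulZeroClass.mul_zero]
    · rw [hf [] (by simpa using Ne.symm hp), MulZeroClass.zero_mul]
  | cons x l ih =>
    have h1 : ListForm.mul (ListForm.contract x f) g l = 0 := by
      cases p with
      | zero => rw [hf.contract_zero, zero_mul]; rfl
      | succ p => exact ih (hf.contract x) hg (by simp only [List.length_cons] at hl; omega)
    have h2 : ListForm.mul (signed f) (ListForm.contract x g) l = 0 := by
      cases q with
      | zero => rw [hg.contract_zero, mul_zero]; rfl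
      | succ q =>
        exact ih (p := p) (fun l hl ↦ by simp [signed, hf l hl]) (hg.contract x)
          (by simp only [List.length_cons] at hl; omega)
    rw [ListForm.mul, h1, h2, add_zero]

section Alternating

variable {R L M : Type*} [CommRing R] [AddCommGroup L] [Module R L] [AddCommGroup M] [Module R M]

/-- An alternating map as a function of lists. -/
def ofAlt : {p : ℕ} → L [⋀^Fin p]→ₗ[R] M → List L → M
  | 0, ω, [] => ω ![]
  | 0, _, _ :: _ => 0
  | _ + 1, _, [] => 0
  | _ + 1, ω, x :: l => ofAlt (ω.curryLeft x) l

theorem ofAlt_ofFn {p : ℕ} (ω : L [⋀^Fin p]→ₗ[R] M) (v : Fin p → L) :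
    ofAlt ω (List.ofFn v) = ω v := by
  induction p with
  | zero => exact congrArg ω (Subsingleton.elim _ _)
  | succ p ih =>
    rw [List.ofFn_succ, ofAlt, ih]
    exact congrArg ω (Fin.cons_self_tail v)

theorem homogeneous_ofAlt {p : ℕ} (ω : L [⋀^Fin p]→ₗ[R] M) : Homogeneous p (ofAlt ω) := by
  induction p with
  | zero => rintro (_ | ⟨x, l⟩) hl; exacts [absurd rfl hl, rfl]
  | succ p ih => rintro (_ | ⟨x, l⟩) hl; exacts [rfl, ih _ l (by simpa using hl)]

theorem ofAlt_injective {p : ℕ} {ω η : L [⋀^Fin p]→ₗ[R] M} (h : ofAlt ω = ofAlt η) : ω = η := by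
  ext v
  rw [← ofAlt_ofFn, h, ofAlt_ofFn]

theorem ofAlt_add {p : ℕ} (ω η : L [⋀^Fin p]→ₗ[R] M) : ofAlt (ω + η) = ofAlt ω + ofAlt η := by
  refine (homogeneous_ofAlt _).ext (fun l hl ↦ ?_) (fun v ↦ ?_)
  · rw [Pi.add_apply, homogeneous_ofAlt ω l hl, homogeneous_ofAlt η l hl, add_zero]
  · simp [ofAlt_ofFn]

theorem ofAlt_smul {S : Type*} [Monoid S] [DistribMulAction S M] [SMulCommClass R S M] {p : ℕ}
    (c : S) (ω : L [⋀^Fin p]→ₗ[R] M) : ofAlt (c • ω) = c • ofAlt ω := by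
  refine (homogeneous_ofAlt _).ext (fun l hl ↦ ?_) (fun v ↦ ?_)
  · rw [Pi.smul_apply, homogeneous_ofAlt ω l hl, smul_zero]
  · simp [ofAlt_ofFn]

theorem ofAlt_sub {p : ℕ} (ω η : L [⋀^Fin p]→ₗ[R] M) : ofAlt (ω - η) = ofAlt ω - ofAlt η := by
  refine (homogeneous_ofAlt _).ext (fun l hl ↦ ?_) (fun v ↦ ?_)
  · rw [Pi.sub_apply, homogeneous_ofAlt ω l hl, homogeneous_ofAlt η l hl, sub_zero]
  · simp [ofAlt_ofFn]

end Alternating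

section Lie

variable {R L M : Type*} [CommRing R] [LieRing L] [Module R L] [AddCommGroup M] [Module R M]

theorem additive_ofAlt {p : ℕ} (ω : L [⋀^Fin p]→ₗ[R] M) : Additive (ofAlt ω) := by
  intro l₁ l₂ x y
  induction l₁ generalizing p with
  | nil =>
    cases p with
    | zero => simp [ofAlt]
    | succ p =>
      simp only [List.nil_append, ofAlt, map_sub]
      rw [ofAlt_sub, Pi.sub_apply]
  | cons z l₁ ih =>
    cases p with
    | zero => simp [ofAlt]
    | succ p => exact ih _

theorem contract_ofAlt {p : ℕ} (ω : L [⋀^Fin (p + 1)]→ₗ[R] M) (x : L) :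
    contract x (ofAlt ω) = ofAlt (ω.curryLeft x) := rfl

theorem contract_ofAlt_zero (ω : L [⋀^Fin 0]→ₗ[R] M) (x : L) :
    contract x (ofAlt ω) = 0 := rfl

/-- The recursion solved in closed form, as needed for comparison with the Koszul formula in
`ofAlt_koszul`. -/
theorem lieDer_ofAlt (D : L → M →+ M) (x : L) {p : ℕ} (ω : L [⋀^Fin p]→ₗ[R] M) (w : Fin p → L) :
    lieDer D x (ofAlt ω) (List.ofFn w) =
      D x (ω w) - ∑ i, ω (Function.update w i ⁅x, w i⁆) := by
  induction p with
  | zero =>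
    simp only [List.ofFn_zero, lieDer, Finset.univ_eq_empty, Finset.sum_empty, sub_zero]
    exact congrArg (fun v ↦ D x (ω v)) (Subsingleton.elim _ _)
  | succ p ih =>
    rw [List.ofFn_succ, lieDer, contract_ofAlt, ih, Fin.sum_univ_succ, ofAlt, ofAlt_ofFn]
    have h0 : ∀ y, (ω.curryLeft y) (fun i ↦ w i.succ) = ω (Function.update w 0 y) := by
      intro y
      refine congrArg ω (funext (Fin.cases ?_ fun i ↦ ?_)) <;> simp
    have h1 : ∀ i : Fin p, ω.curryLeft (w 0)
        (Function.update (fun i ↦ w i.succ) i ⁅x, w i.succ⁆) =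
        ω (Function.update w i.succ ⁅x, w i.succ⁆) := by
      intro i
      refine congrArg ω (funext (Fin.cases ?_ fun j ↦ ?_))
      · rw [Function.update_of_ne (Fin.succ_ne_zero i).symm]; rfl
      · by_cases hj : j = i
        · subst hj; simp
        · simp [Function.update_of_ne, hj]
    simp only [h0, h1, Function.update_eq_self]
    abel

end Lie

section Wedge

variable {R L A : Type*} [CommRing R] [LieRing L] [Module R L] [Ring A] [Algebra R A]

/-- The alternating sum of a function over all permutations of its arguments. -/
def permSum {n : ℕ} (T : (Fin n → L) → A) (v : Fin n → L) : A :=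
  ∑ σ : Equiv.Perm (Fin n), (Equiv.Perm.sign σ : ℤ) • T (v ∘ σ)

/-- A permutation is determined by the index `k` that it sends to `0` and by what it does to the
others: `k.cycleRange` carries `k` to `0` keeping the order of the rest, and the other factor fixes
`0`. -/
theorem sum_perm_succ {B : Type*} [AddCommMonoid B] {n : ℕ} (f : Equiv.Perm (Fin (n + 1)) → B) :
    ∑ σ, f σ = ∑ k : Fin (n + 1), ∑ e : Equiv.Perm (Fin n),
      f (Equiv.Perm.decomposeFin.symm (0, e) * k.cycleRange) := by
  rw [← Fintype.sum_prod_type' (f := fun (k : Fin (n + 1)) (e : Equiv.Perm (Fin n)) ↦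
    f (Equiv.Perm.decomposeFin.symm (0, e) * k.cycleRange))]
  refine (Function.Bijective.sum_comp (e := fun q : Fin (n + 1) × Equiv.Perm (Fin n) ↦
    Equiv.Perm.decomposeFin.symm (0, q.2) * q.1.cycleRange) ?_ f).symm
  rw [Fintype.bijective_iff_injective_and_card]
  -- The count `(n + 1)! = (n + 1) · n!` leaves only injectivity, where `k` is recovered as the
  -- preimage of `0`.
  refine ⟨?_, by simp [Fintype.card_perm, Nat.factorial_succ]⟩
  rintro ⟨k, e⟩ ⟨k', e'⟩ h
  have hk : ∀ (k : Fin (n + 1)) (e : Equiv.Perm (Fin n)),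
      (Equiv.Perm.decomposeFin.symm (0, e) * k.cycleRange) k = 0 := by
    intro k e
    simp
  have h0 : k = k' := by
    apply (Equiv.Perm.decomposeFin.symm (0, e) * k.cycleRange).injective
    rw [hk]
    dsimp only at h
    rw [h, hk]
  subst h0
  have h1 := Equiv.Perm.decomposeFin.symm.injective (mul_right_cancel h)
  simpa using h1

/-- The permutations are sorted by the slot `k` of `T` that receives `x`; the sign of `k.cycleRange`
is `(-1) ^ k`. -/
theorem permSum_cons {n : ℕ} (T : (Fin (n + 1) → L) → A) (x : L) (w : Fin n → L) :
    permSum T (Fin.cons x w : Fin (n + 1) → L) =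
      ∑ k : Fin (n + 1), permSum (fun u ↦ (-1 : ℤ) ^ (k : ℕ) • T (k.insertNth x u)) w := by
  rw [permSum, sum_perm_succ]
  refine Finset.sum_congr rfl fun k _ ↦ Finset.sum_congr rfl fun e _ ↦ ?_
  have h1 : (Fin.cons x w : Fin (n + 1) → L) ∘
      ⇑(Equiv.Perm.decomposeFin.symm (0, e) * k.cycleRange) =
      (k.insertNth x (w ∘ e) : Fin (n + 1) → L) := by
    rw [← Fin.cons_comp_cycleRange, Equiv.Perm.coe_mul, ← Function.comp_assoc]
    congr 1
    refine funext (Fin.cases ?_ fun i ↦ ?_)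
    · simp
    · simp
  rw [h1, Equiv.Perm.sign_mul, Equiv.Perm.decomposeFin.symm_sign, Fin.sign_cycleRange, smul_smul]
  simp

/-- The tensor product of two alternating maps, composed with multiplication. -/
def tensorFun {p q n : ℕ} (h : p + q = n) (ω : L [⋀^Fin p]→ₗ[R] A) (η : L [⋀^Fin q]→ₗ[R] A)
    (u : Fin n → L) : A :=
  ω (fun i ↦ u ⟨i, by omega⟩) * η (fun j ↦ u ⟨p + j, by omega⟩)

/-- Moving `x` to the front of the first block costs exactly `(-1) ^ i`, so all slots of that block
contribute equally. -/
theorem tensorFun_insertNth_left {p q n : ℕ} (h : p + 1 + q = n + 1) (ω : L [⋀^Fin (p + 1)]→ₗ[R] A)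
    (η : L [⋀^Fin q]→ₗ[R] A) (i : Fin (p + 1)) (x : L) (u : Fin n → L) :
    (-1 : ℤ) ^ (i : ℕ) • tensorFun h ω η ((⟨i, by omega⟩ : Fin (n + 1)).insertNth x u) =
      tensorFun (by omega) (ω.curryLeft x) η u := by
  have h1 : (fun k : Fin (p + 1) ↦ ((⟨i, by omega⟩ : Fin (n + 1)).insertNth x u : Fin (n + 1) → L)
      ⟨k, by omega⟩) = i.insertNth x (fun k : Fin p ↦ u ⟨k, by omega⟩) := by
    funext k
    refine Fin.succAboveCases i ?_ (fun k ↦ ?_) k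
    · simp
    · have : (⟨(i.succAbove k : Fin (p + 1)), by omega⟩ : Fin (n + 1)) =
          (⟨i, by omega⟩ : Fin (n + 1)).succAbove ⟨k, by omega⟩ := by
        apply Fin.ext
        simp only [Fin.succAbove, Fin.lt_def, Fin.val_castSucc]
        split_ifs <;> simp
      rw [this, Fin.insertNth_apply_succAbove, Fin.insertNth_apply_succAbove]
  have h2 : (fun k : Fin q ↦ ((⟨i, by omega⟩ : Fin (n + 1)).insertNth x u : Fin (n + 1) → L)
      ⟨p + 1 + k, by omega⟩) = (fun k : Fin q ↦ u ⟨p + k, by omega⟩) := by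
    funext k
    have : (⟨p + 1 + k, by omega⟩ : Fin (n + 1)) =
        (⟨i, by omega⟩ : Fin (n + 1)).succAbove ⟨p + k, by omega⟩ := by
      apply Fin.ext
      rw [Fin.succAbove_of_le_castSucc _ _ (by simp [Fin.le_def]; omega)]
      simp
      omega
    rw [this, Fin.insertNth_apply_succAbove]
  rw [tensorFun, h1, h2, ← smul_mul_assoc, ω.neg_one_pow_smul_map_insertNth]
  rfl

/-- Only `(-1) ^ j` is absorbed by moving `x` to the front of the second block; the remaining `(-1)
^ p` is the sign that `signed` puts into `mul`. -/
theorem tensorFun_insertNth_right {p q n : ℕ} (h : p + (q + 1) = n + 1) (ω : L [⋀^Fin p]→ₗ[R] A)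
    (η : L [⋀^Fin (q + 1)]→ₗ[R] A) (j : Fin (q + 1)) (x : L) (u : Fin n → L) :
    (-1 : ℤ) ^ (p + j : ℕ) • tensorFun h ω η ((⟨p + j, by omega⟩ : Fin (n + 1)).insertNth x u) =
      (-1 : ℤ) ^ p • tensorFun (by omega) ω (η.curryLeft x) u := by
  have h1 : (fun k : Fin (q + 1) ↦ ((⟨p + j, by omega⟩ : Fin (n + 1)).insertNth x u :
      Fin (n + 1) → L) ⟨p + k, by omega⟩) = j.insertNth x (fun k : Fin q ↦ u ⟨p + k, by omega⟩) := by
    funext k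
    refine Fin.succAboveCases j ?_ (fun k ↦ ?_) k
    · simp
    · have : (⟨p + (j.succAbove k : Fin (q + 1)), by omega⟩ : Fin (n + 1)) =
          (⟨p + j, by omega⟩ : Fin (n + 1)).succAbove ⟨p + k, by omega⟩ := by
        apply Fin.ext
        simp only [Fin.succAbove, Fin.lt_def, Fin.val_castSucc, add_lt_add_iff_left]
        split_ifs <;> simp [add_assoc]
      rw [this, Fin.insertNth_apply_succAbove, Fin.insertNth_apply_succAbove]
  have h2 : (fun k : Fin p ↦ ((⟨p + j, by omega⟩ : Fin (n + 1)).insertNth x u : Fin (n + 1) → L)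
      ⟨k, by omega⟩) = (fun k : Fin p ↦ u ⟨k, by omega⟩) := by
    funext k
    have : (⟨k, by omega⟩ : Fin (n + 1)) =
        (⟨p + j, by omega⟩ : Fin (n + 1)).succAbove ⟨k, by omega⟩ := by
      apply Fin.ext
      rw [Fin.succAbove_of_castSucc_lt _ _ (by simp [Fin.lt_def]; omega)]
      simp
    rw [this, Fin.insertNth_apply_succAbove]
  rw [tensorFun, h1, h2, pow_add, mul_smul, ← mul_smul_comm, η.neg_one_pow_smul_map_insertNth]
  rfl

theorem sum_fin_eq_add {B : Type*} [AddCommMonoid B] {p q n : ℕ} (h : p + q = n) (f : Fin n → B) :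
    ∑ k, f k = ∑ i : Fin p, f ⟨i, by omega⟩ + ∑ j : Fin q, f ⟨p + j, by omega⟩ := by
  subst h
  exact Fin.sum_univ_add f

theorem smul_mul {S : Type*} [Monoid S] [DistribMulAction S A] [IsScalarTower S A A]
    [SMulCommClass ℤ S A] (c : S) (f g : List L → A) : mul (c • f) g = c • mul f g := by
  have hs : ∀ f : List L → A, signed (c • f) = c • signed f := fun f ↦ funext fun l ↦ by
    simp only [signed, Pi.smul_apply]
    exact smul_comm _ _ _
  funext l
  induction l generalizing f g with
  | nil => exact smul_mul_assoc c (f []) (g [])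
  | cons x l ih =>
    have h1 : contract x (c • f) = c • contract x f := rfl
    simp only [mul, h1, hs, ih, Pi.smul_apply, smul_add]

theorem mul_smul {S : Type*} [Monoid S] [DistribMulAction S A] [SMulCommClass S A A]
    (c : S) (f g : List L → A) : mul f (c • g) = c • mul f g := by
  funext l
  induction l generalizing f g with
  | nil => exact mul_smul_comm c (f []) (g [])
  | cons x l ih =>
    have h1 : contract x (c • g) = c • contract x g := rfl
    simp only [mul, h1, ih, Pi.smul_apply, smul_add]

/-- The first argument lands in one of the `p` slots of the first block or the `q` slots of the
second. Within a block all terms are equal, which builds up the factorials, and the two blocks give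
the two summands in the recursion for `mul`. -/
theorem permSum_tensorFun {n p q : ℕ} (h : p + q = n) (ω : L [⋀^Fin p]→ₗ[R] A)
    (η : L [⋀^Fin q]→ₗ[R] A) (v : Fin n → L) :
    permSum (tensorFun h ω η) v =
      (p.factorial * q.factorial) • mul (ofAlt ω) (ofAlt η) (List.ofFn v) := by
  induction n generalizing p q with
  | zero =>
    obtain ⟨rfl, rfl⟩ : p = 0 ∧ q = 0 := by omega
    simp [permSum, tensorFun, mul, ofAlt, Subsingleton.elim _ (![] : Fin 0 → L)]
  | succ n ih =>
    obtain ⟨x, w, rfl⟩ : ∃ x w, v = (Fin.cons x w : Fin (n + 1) → L) :=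
      ⟨v 0, Fin.tail v, (Fin.cons_self_tail v).symm⟩
    rw [permSum_cons, sum_fin_eq_add h, List.ofFn_succ]
    simp only [Fin.cons_zero, Fin.cons_succ, mul, smul_add]
    congr 1
    · cases p with
      | zero => simp [contract_ofAlt_zero, zero_mul]
      | succ p =>
        simp only [tensorFun_insertNth_left, Finset.sum_const, Finset.card_univ,
          Fintype.card_fin]
        rw [ih, smul_smul, contract_ofAlt, Nat.factorial_succ, Nat.mul_assoc]
    · cases q with
      | zero => simp [contract_ofAlt_zero, mul_zero]
      | succ q =>
        simp only [tensorFun_insertNth_right, Finset.sum_const, Finset.card_univ,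
          Fintype.card_fin]
        have : permSum (fun u ↦ (-1 : ℤ) ^ p • tensorFun (by omega) ω (η.curryLeft x) u) w =
            (-1 : ℤ) ^ p • permSum (tensorFun (by omega) ω (η.curryLeft x)) w := by
          simp only [permSum, Finset.smul_sum]
          exact Finset.sum_congr rfl fun σ _ ↦ smul_comm _ _ _
        rw [this, ih, (homogeneous_ofAlt ω).signed_eq, smul_mul, contract_ofAlt,
          smul_comm (q + 1), smul_smul, Nat.factorial_succ, Pi.smul_apply,
          smul_comm _ ((-1 : ℤ) ^ p)]
        congr 2
        ring

/-- In the sum over all permutations each shuffle class is counted `p! q!` times, since `ω` and `η`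
are alternating. -/
theorem factorial_smul_wedge {p q : ℕ} (ω : L [⋀^Fin p]→ₗ[R] A) (η : L [⋀^Fin q]→ₗ[R] A)
    (v : Fin (p + q) → L) :
    (p.factorial * q.factorial) • wedge ω η v = permSum (tensorFun rfl ω η) v := by
  have h1 := congrArg (fun f ↦ LinearMap.mul' R A (f (v ∘ finSumFinEquiv)))
    (MultilinearMap.domCoprod_alternization_eq ω η)
  simp only [Fintype.card_fin, AlternatingMap.smul_apply, map_nsmul] at h1
  rw [wedge, AlternatingMap.domDomCongr_apply, LinearMap.compAlternatingMap_apply]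
  refine h1.symm.trans ?_
  rw [MultilinearMap.alternatization_apply, map_sum, permSum,
    ← (finSumFinEquiv (m := p) (n := q)).permCongr.sum_comp]
  refine Finset.sum_congr rfl fun σ _ ↦ ?_
  rw [Equiv.Perm.sign_permCongr, Units.smul_def, map_zsmul]
  congr 1
  have h2 : ∀ s, v (finSumFinEquiv (σ s)) = (v ∘ finSumFinEquiv.permCongr σ) (finSumFinEquiv s) :=
    fun s ↦ by simp [Equiv.permCongr_apply]
  simp only [MultilinearMap.domDomCongr_apply, MultilinearMap.domCoprod_apply,
    LinearMap.mul'_apply, tensorFun, Function.comp_apply, h2]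
  rfl

theorem ofAlt_wedge {K : Type*} [Field K] [CharZero K] [Algebra K A] {p q : ℕ}
    (ω : L [⋀^Fin p]→ₗ[R] A) (η : L [⋀^Fin q]→ₗ[R] A) :
    ofAlt (wedge ω η) = mul (ofAlt ω) (ofAlt η) := by
  refine (homogeneous_ofAlt _).ext ((homogeneous_ofAlt _).mul (homogeneous_ofAlt _)) fun v ↦ ?_
  have h := (factorial_smul_wedge ω η v).trans (permSum_tensorFun rfl ω η v)
  rw [← Nat.cast_smul_eq_nsmul K, ← Nat.cast_smul_eq_nsmul K] at h
  rw [ofAlt_ofFn]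
  -- Characteristic zero enters here, to cancel `p! q!`.
  exact smul_right_injective A (Nat.cast_ne_zero.mpr
    (Nat.mul_ne_zero p.factorial_ne_zero q.factorial_ne_zero)) h

end Wedge

end ListForm

end LieRinehart

/-! ### Cartan's formula for the Koszul differential; the differential graded algebra of forms. -/

namespace LieRinehart

section Koszul

variable {K R L M : Type*} [Field K] [CharZero K] [CommRing R] [Algebra K R]
  [LieRing L] [LieAlgebra K L] [Module R L] [LieRingModule L R] [LieRinehartRing R L]
  [LieRinehartAlgebra K R L] [AddCommGroup M] [Module K M] [Module R M] [IsScalarTower K R M]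

/-- The pairs are split according to whether `x` takes part in the bracket. A bracket `⁅x, w j⁆` is
moved from the front to the place of `w j`, with total sign `-1`. In the other pairs the bracket is
exchanged with `x`, which accounts for the minus sign of the second term. -/
theorem bracketSum_cons {n : ℕ} (ω : L [⋀^Fin (n + 1)]→ₗ[R] M) (x : L) (w : Fin (n + 1) → L) :
    bracketSum ω (Fin.cons x w : Fin (n + 2) → L) =
      -∑ i, ω (Function.update w i ⁅x, w i⁆) - bracketSum (ω.curryLeft x) w := by
  rw [bracketSum, Fin.sum_univ_succ, sub_eq_add_neg]
  congr 1
  · have : (Finset.Ici (0 : Fin (n + 1))) = Finset.univ := by ext; simp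
    rw [this, ← Finset.sum_neg_distrib]
    refine Finset.sum_congr rfl fun j _ ↦ ?_
    rw [← Fin.insertNth_removeNth, AlternatingMap.map_insertNth]
    simp [pow_succ]
  · cases n with
    | zero => simp [bracketSum]
    | succ m =>
      rw [bracketSum, ← Finset.sum_neg_distrib]
      refine Finset.sum_congr rfl fun i _ ↦ ?_
      rw [← Fin.map_succEmb_Ici, Finset.sum_map, ← Finset.sum_neg_distrib]
      refine Finset.sum_congr rfl fun j _ ↦ ?_
      have h1 : ∀ (y : L) (u : Fin m → L), ω (Matrix.vecCons y (Fin.cons x u : Fin (m + 1) → L)) =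
          -ω (Matrix.vecCons x (Matrix.vecCons y u)) := by
        intro y u
        -- Here `x` sits in the second place, so bringing it to the front costs one sign.
        have h2 : (1 : Fin (m + 2)).insertNth x (Fin.cons y u : Fin (m + 1) → L) =
            Matrix.vecCons y (Fin.cons x u : Fin (m + 1) → L) := by
          refine funext (Fin.cases ?_ (Fin.cases ?_ fun i ↦ ?_))
          · exact Fin.insertNth_apply_below (α := fun _ ↦ L) (i := 1) (j := 0) Fin.zero_lt_one x _
          · exact Fin.insertNth_apply_same (α := fun _ ↦ L) 1 x _
          · have h3 : i.succ.succ = (1 : Fin (m + 2)).succAbove i.succ := by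
              have h4 : (1 : Fin (m + 2)) ≤ i.succ.castSucc := by
                rw [Fin.le_def, Fin.val_castSucc, Fin.val_succ, Fin.val_one]
                omega
              rw [Fin.succAbove_of_le_castSucc _ _ h4]
            rw [h3, Fin.insertNth_apply_succAbove]
            rfl
        rw [← h2, AlternatingMap.map_insertNth]
        simp [Matrix.vecCons]
      rw [Fin.coe_succEmb, ← Fin.succ_castSucc, removeNth_succ_cons, removeNth_succ_cons, h1]
      simp only [Fin.cons_succ, AlternatingMap.curryLeft_apply_apply, Fin.val_succ, smul_neg]
      rw [show (i.castSucc : ℕ) + 1 + (j + 1 + 1) = (i.castSucc : ℕ) + (j + 1) + 2 by omega,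
        pow_add]
      simp

/-- Cartan's formula for the Chevalley–Eilenberg differential. -/
theorem koszulFun_cons (D : L →ₗ[R] Module.End K M) {p : ℕ} (ω : L [⋀^Fin (p + 1)]→ₗ[R] M) (x : L)
    (w : Fin (p + 1) → L) :
    koszulFun D ω (Fin.cons x w : Fin (p + 2) → L) =
      D x (ω w) - ∑ i, ω (Function.update w i ⁅x, w i⁆) - koszulFun D (ω.curryLeft x) w := by
  rw [koszulFun, bracketSum_cons, koszulFun, Fin.sum_univ_succ]
  have : ∀ i : Fin (p + 1), (-1 : ℤ) ^ (i.succ : ℕ) •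
      D ((Fin.cons x w : Fin (p + 2) → L) i.succ)
        (ω (i.succ.removeNth (Fin.cons x w : Fin (p + 2) → L))) =
      -((-1 : ℤ) ^ (i : ℕ) • D (w i) (ω.curryLeft x (i.removeNth w))) := by
    intro i
    rw [removeNth_succ_cons, Fin.cons_succ, Fin.val_succ, pow_succ]
    simp [Matrix.vecCons]
  simp only [this, Finset.sum_neg_distrib, Fin.val_zero, pow_zero, one_smul, Fin.cons_zero,
    Fin.removeNth_zero, Fin.tail_cons]
  abel

theorem koszulFun_cons_zero (D : L →ₗ[R] Module.End K M) (ω : L [⋀^Fin 0]→ₗ[R] M) (x : L)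
    (w : Fin 0 → L) : koszulFun D ω (Fin.cons x w : Fin 1 → L) = D x (ω w) := by
  simp [koszulFun, bracketSum, Subsingleton.elim _ w]

/-- A connection as a family of additive maps. -/
def connAddHom (D : L →ₗ[R] Module.End K M) (x : L) : M →+ M := (D x).toAddMonoidHom

@[simp] theorem connAddHom_apply (D : L →ₗ[R] Module.End K M) (x : L) (m : M) :
    connAddHom D x m = D x m := rfl

/-- By `koszulFun_cons` the Koszul formula satisfies the recursion that defines `ListForm.diff`.
This carries the identities for lists over to forms. -/
theorem ofAlt_koszul (D : L →ₗ[R] Module.End K M)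
    (hD : ∀ (x : L) (a : R) (m : M), D x (a • m) = a • D x m + ⁅x, a⁆ • m)
    {p : ℕ} (ω : L [⋀^Fin p]→ₗ[R] M) :
    ListForm.ofAlt (koszul D hD ω) = ListForm.diff (connAddHom D) (ListForm.ofAlt ω) := by
  refine (ListForm.homogeneous_ofAlt _).ext ((ListForm.homogeneous_ofAlt _).diff _) fun v ↦ ?_
  rw [ListForm.ofAlt_ofFn, koszul_apply]
  induction p with
  | zero =>
    obtain ⟨x, w, rfl⟩ : ∃ x w, v = (Fin.cons x w : Fin 1 → L) :=
      ⟨v 0, Fin.tail v, (Fin.cons_self_tail v).symm⟩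
    rw [koszulFun_cons_zero]
    simp [ListForm.diff, ListForm.lieDer, ListForm.ofAlt, Subsingleton.elim w ![]]
  | succ p ih =>
    obtain ⟨x, w, rfl⟩ : ∃ x w, v = (Fin.cons x w : Fin (p + 2) → L) :=
      ⟨v 0, Fin.tail v, (Fin.cons_self_tail v).symm⟩
    rw [koszulFun_cons, List.ofFn_succ, ListForm.diff]
    simp only [Fin.cons_zero, Fin.cons_succ]
    rw [ListForm.lieDer_ofAlt, ListForm.contract_ofAlt, ih]
    rfl

theorem koszul_koszul (D : L →ₗ[R] Module.End K M)
    (hD : ∀ (x : L) (a : R) (m : M), D x (a • m) = a • D x m + ⁅x, a⁆ • m)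
    (hflat : ∀ x y m, D ⁅x, y⁆ m = D x (D y m) - D y (D x m))
    {p : ℕ} (ω : L [⋀^Fin p]→ₗ[R] M) : koszul D hD (koszul D hD ω) = 0 := by
  refine ListForm.ofAlt_injective ?_
  rw [ofAlt_koszul, ofAlt_koszul, ListForm.diff_diff (D := connAddHom D) hflat
    (ListForm.additive_ofAlt ω)]
  refine ListForm.Homogeneous.ext (p := p + 2) (fun _ _ ↦ rfl) (ListForm.homogeneous_ofAlt _)
    fun v ↦ ?_
  rw [ListForm.ofAlt_ofFn]
  rfl

end Koszul

section Flat

variable {K R L : Type*} [CommRing K] [CommRing R] [Algebra K R] [LieRing L] [LieAlgebra K L]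
  [Module R L] [LieRingModule L R] [LieRinehartRing R L] [LieRinehartAlgebra K R L]

theorem Jet.conn_lie (x y : L) (φ : Jet K R L) :
    Jet.conn ⁅x, y⁆ φ = Jet.conn x (Jet.conn y φ) - Jet.conn y (Jet.conn x φ) := by
  ext D
  simp only [Jet.conn_apply, Jet.sub_apply, lie_lie, Env.vec_lie, _root_.sub_mul, map_sub,
    _root_.mul_assoc, lie_sub]
  abel

end Flat

namespace LieAlgebroid

section Connection

variable {K : Type u} [Field K] {X : TopCat.{u}} {𝒪 : TopCat.Sheaf (CommAlgCat.{u} K) X}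
  {𝓛 : LieAlgebroid 𝒪}

theorem jetConn_lie {U : Opens X} (x y : 𝓛.sec U) (φ : 𝓛.JetSec U) :
    jetConn U ⁅x, y⁆ φ = jetConn U x (jetConn U y φ) - jetConn U y (jetConn U x φ) :=
  JetSec.ext fun V h ↦ by
    rw [JetSec.sub_on, jetConn_on, jetConn_on, jetConn_on, jetConn_on, jetConn_on, ← Jet.conn_lie]
    exact congrArg (fun z ↦ Jet.conn z (φ.on V h)) (LieHom.map_lie _ _ _)

theorem diffConn_lie {U : Opens X} (x y : 𝓛.sec U) (P : 𝓛.DiffSec U) :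
    diffConn U ⁅x, y⁆ P = diffConn U x (diffConn U y P) - diffConn U y (diffConn U x P) :=
  DiffSec.ext fun V h ↦ by
    ext φ
    have h0 : ∀ Q Q' : 𝓛.DiffSec U, (Q - Q').on V h = Q.on V h - Q'.on V h := fun _ _ ↦ rfl
    have h1 : 𝓛.res h ⁅x, y⁆ = ⁅𝓛.res h x, 𝓛.res h y⁆ := LieHom.map_lie _ _ _
    rw [h0, LinearMap.sub_apply, diffConn_on, h1]
    simp only [diffConn_on, connCommutator_apply, jetConn_lie, map_sub]
    abel

theorem diffConn_mul {U : Opens X} (x : 𝓛.sec U) (P Q : 𝓛.DiffSec U) :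
    diffConn U x (P * Q) = diffConn U x P * Q + P * diffConn U x Q :=
  DiffSec.ext fun V h ↦ by
    ext φ
    simp only [diffConn_on, DiffSec.add_on, DiffSec.mul_on, LinearMap.add_apply,
      Module.End.mul_apply, connCommutator_apply, map_sub]
    abel

end Connection

section DGAlgebra

variable {K : Type u} [Field K] [CharZero K] {X : TopCat.{u}}
  {𝒪 : TopCat.Sheaf (CommAlgCat.{u} K) X} {𝓛 : LieAlgebroid 𝒪}

theorem ofAlt_formMul {p q : ℕ} {U : Opens X} (ω : 𝓛.FormSec p U) (η : 𝓛.FormSec q U)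
    (V : Opens X) (h : V ≤ U) : ListForm.ofAlt ((formMul ω η).on V h) =
      ListForm.mul (ListForm.ofAlt (ω.on V h)) (ListForm.ofAlt (η.on V h)) :=
  ListForm.ofAlt_wedge (K := K) (ω.on V h) (η.on V h)

theorem ofAlt_formD {p : ℕ} {U : Opens X} (ω : 𝓛.FormSec p U) (V : Opens X) (h : V ≤ U) :
    ListForm.ofAlt ((formD p U ω).on V h) =
      ListForm.diff (connAddHom (diffConn V)) (ListForm.ofAlt (ω.on V h)) :=
  ofAlt_koszul (diffConn V) diffConn_smul (ω.on V h)

theorem ofAlt_formOne {U : Opens X} (V : Opens X) (h : V ≤ U) :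
    ListForm.ofAlt ((formOne (𝓛 := 𝓛) U).on V h) = ListForm.one := by
  funext l
  cases l <;> rfl

theorem FormSec.ext_ofAlt {p : ℕ} {U : Opens X} {ω η : 𝓛.FormSec p U}
    (h : ∀ V hV, ListForm.ofAlt (ω.on V hV) = ListForm.ofAlt (η.on V hV)) : ω = η :=
  FormSec.ext fun V hV ↦ ListForm.ofAlt_injective (h V hV)

/-- Functions of lists carry no degree index, so forms whose degrees are only propositionally equal
are compared there without transport. -/
theorem of_eq_of_ofAlt {p q : ℕ} {U : Opens X} {ω : 𝓛.FormSec p U} {η : 𝓛.FormSec q U}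
    (hpq : p = q) (h : ∀ V hV, ListForm.ofAlt (ω.on V hV) = ListForm.ofAlt (η.on V hV)) :
    DirectSum.of (fun p ↦ 𝓛.FormSec p U) p ω = DirectSum.of (fun p ↦ 𝓛.FormSec p U) q η := by
  subst hpq
  rw [FormSec.ext_ofAlt h]

/-- Moves the term `da · b`, of degree `p + 1 + q`, to degree `p + q + 1`, so that the right side of
the Leibniz rule is a sum in one graded piece. -/
theorem exists_of_eq {p q : ℕ} {U : Opens X} (ω : 𝓛.FormSec p U) (hpq : p = q) :
    ∃ η : 𝓛.FormSec q U, DirectSum.of (fun p ↦ 𝓛.FormSec p U) p ω = DirectSum.of _ q η ∧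
      ∀ V hV, ListForm.ofAlt (η.on V hV) = ListForm.ofAlt (ω.on V hV) := by
  subst hpq
  exact ⟨ω, rfl, fun _ _ ↦ rfl⟩

theorem isDGAlgebra_form (U : Opens X) : IsDGAlgebra K (fun p ↦ 𝓛.FormSec p U)
    (fun p ↦ formD p U) formMul (formOne U) where
  add_mul a b c := FormSec.ext_ofAlt fun V hV ↦ by
    have hadd : ∀ {n : ℕ} (a b : 𝓛.FormSec n U), ListForm.ofAlt ((a + b).on V hV) =
        ListForm.ofAlt (a.on V hV) + ListForm.ofAlt (b.on V hV) :=
      fun a b ↦ ListForm.ofAlt_add (a.on V hV) (b.on V hV)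
    simp only [ofAlt_formMul, hadd, ListForm.add_mul]
  mul_add a b c := FormSec.ext_ofAlt fun V hV ↦ by
    have hadd : ∀ {n : ℕ} (a b : 𝓛.FormSec n U), ListForm.ofAlt ((a + b).on V hV) =
        ListForm.ofAlt (a.on V hV) + ListForm.ofAlt (b.on V hV) :=
      fun a b ↦ ListForm.ofAlt_add (a.on V hV) (b.on V hV)
    simp only [ofAlt_formMul, hadd, ListForm.mul_add]
  smul_mul k a b := FormSec.ext_ofAlt fun V hV ↦ by
    have hsmul : ∀ {n : ℕ} (a : 𝓛.FormSec n U), ListForm.ofAlt ((k • a).on V hV) =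
        k • ListForm.ofAlt (a.on V hV) := fun a ↦ ListForm.ofAlt_smul k (a.on V hV)
    simp only [ofAlt_formMul, hsmul, ListForm.smul_mul]
  mul_smul k a b := FormSec.ext_ofAlt fun V hV ↦ by
    have hsmul : ∀ {n : ℕ} (a : 𝓛.FormSec n U), ListForm.ofAlt ((k • a).on V hV) =
        k • ListForm.ofAlt (a.on V hV) := fun a ↦ ListForm.ofAlt_smul k (a.on V hV)
    simp only [ofAlt_formMul, hsmul, ListForm.mul_smul]
  one_mul a := of_eq_of_ofAlt (Nat.zero_add _) fun V hV ↦ by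
    rw [ofAlt_formMul, ofAlt_formOne, ListForm.one_mul]
  mul_one a := of_eq_of_ofAlt rfl fun V hV ↦ by
    rw [ofAlt_formMul, ofAlt_formOne, ListForm.mul_one]
  mul_assoc a b c := of_eq_of_ofAlt (Nat.add_assoc _ _ _) fun V hV ↦ by
    rw [ofAlt_formMul, ofAlt_formMul, ofAlt_formMul, ofAlt_formMul, ListForm.mul_assoc]
  d_comp_d p := LinearMap.ext fun ω ↦ FormSec.ext fun V hV ↦
    koszul_koszul (diffConn V) diffConn_smul diffConn_lie (ω.on V hV)
  leibniz {p q} a b := by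
    obtain ⟨c, hc, hc'⟩ := exists_of_eq (formMul (formD p U a) b) (Nat.succ_add_eq_add_succ p q)
    rw [hc, ← map_zsmul, ← map_add]
    refine of_eq_of_ofAlt rfl fun V hV ↦ ?_
    have hadd : ∀ {n : ℕ} (a b : 𝓛.FormSec n U), ListForm.ofAlt ((a + b).on V hV) =
        ListForm.ofAlt (a.on V hV) + ListForm.ofAlt (b.on V hV) :=
      fun a b ↦ ListForm.ofAlt_add (a.on V hV) (b.on V hV)
    have hsmul : ∀ {n : ℕ} (k : ℤ) (a : 𝓛.FormSec n U), ListForm.ofAlt ((k • a).on V hV) =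
        k • ListForm.ofAlt (a.on V hV) := fun k a ↦ ListForm.ofAlt_smul k (a.on V hV)
    rw [hadd, hsmul, hc', ofAlt_formMul, ofAlt_formD, ofAlt_formMul, ofAlt_formMul, ofAlt_formD,
      ofAlt_formD, ListForm.diff_mul (D := connAddHom (diffConn V)) diffConn_mul,
      (ListForm.homogeneous_ofAlt _).signed_eq, ListForm.smul_mul]

end DGAlgebra

end LieAlgebroid

end LieRinehart

/-! ### Gluing of natural families of maps, and the sheaf property of forms. -/

namespace LieRinehart

section Gluing

variable {X : TopCat.{u}}

/-- A family of types on the open subsets of a space, with restriction maps, in which compatible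
families have unique gluings. -/
def HasGluing (F : Opens X → Type u) (res : ∀ U V : Opens X, V ≤ U → F U → F V) : Prop :=
  ∀ (ι : Type u) (U : Opens X) (c : ι → Opens X) (hc : ∀ i, c i ≤ U) (_ : U ≤ iSup c)
    (s : ∀ i, F (c i)), (∀ i j V (hi : V ≤ c i) (hj : V ≤ c j), res _ _ hi (s i) = res _ _ hj (s j)) →
    ∃! t : F U, ∀ i, res _ _ (hc i) t = s i

variable {S G : Opens X → Type u} {resS : ∀ U V : Opens X, V ≤ U → S U → S V}
  {resG : ∀ U V : Opens X, V ≤ U → G U → G V}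

theorem le_iSup_inf {ι : Type u} {U V : Opens X} {c : ι → Opens X} (hU : U ≤ iSup c) (hV : V ≤ U) :
    V ≤ ⨆ i, V ⊓ c i := by
  rw [← inf_iSup_eq]
  exact le_inf le_rfl (hV.trans hU)

/-- Uniqueness of gluing for the cover of `V` by the `V ⊓ c i`, phrased so that equality is tested
only on opens inside a member of the cover. -/
theorem HasGluing.ext (hG : HasGluing G resG)
    (htrans : ∀ {U V W : Opens X} (h : V ≤ U) (h' : W ≤ V) (s : G U),
      resG _ _ h' (resG _ _ h s) = resG _ _ (h'.trans h) s)
    {ι : Type u} {U V : Opens X} {c : ι → Opens X} (hU : U ≤ iSup c) (hV : V ≤ U) {t t' : G V}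
    (h : ∀ i W (hW : W ≤ V), W ≤ c i → resG _ _ hW t = resG _ _ hW t') : t = t' :=
  (hG ι V (fun i ↦ V ⊓ c i) (fun _ ↦ inf_le_left) (le_iSup_inf hU hV)
    (fun _ ↦ resG _ _ inf_le_left t) (fun i j W hi hj ↦ by rw [htrans, htrans])).unique
    (fun _ ↦ rfl) (fun i ↦ (h i _ inf_le_left inf_le_right).symm)

/-- Gluing of natural families of maps with values in a family with gluing. -/
theorem HasGluing.glue_maps (hG : HasGluing G resG)
    (htransS : ∀ {U V W : Opens X} (h : V ≤ U) (h' : W ≤ V) (s : S U),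
      resS _ _ h' (resS _ _ h s) = resS _ _ (h'.trans h) s)
    (htransG : ∀ {U V W : Opens X} (h : V ≤ U) (h' : W ≤ V) (s : G U),
      resG _ _ h' (resG _ _ h s) = resG _ _ (h'.trans h) s)
    {ι : Type u} {U : Opens X} {c : ι → Opens X} (hc : ∀ i, c i ≤ U) (hU : U ≤ iSup c)
    (m : ∀ i (V : Opens X), V ≤ c i → S V → G V)
    (hnat : ∀ i (V W : Opens X) (hV : V ≤ c i) (h : W ≤ V) (s : S V),
      resG _ _ h (m i V hV s) = m i W (h.trans hV) (resS _ _ h s))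
    (hagree : ∀ i j (V : Opens X) (hi : V ≤ c i) (hj : V ≤ c j) (s : S V),
      m i V hi s = m j V hj s) :
    ∃ M : ∀ V : Opens X, V ≤ U → S V → G V,
      (∀ (V W : Opens X) (hV : V ≤ U) (h : W ≤ V) (s : S V),
        resG _ _ h (M V hV s) = M W (h.trans hV) (resS _ _ h s)) ∧
      ∀ i (V : Opens X) (hV : V ≤ c i) (s : S V), M V (hV.trans (hc i)) s = m i V hV s := by
  -- The value on `s` is glued from the values of `m i` on the restrictions of `s` to `V ⊓ c i`.
  -- Only functoriality of restriction is used for `S`, so a presheaf such as that of enveloping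
  -- algebras is allowed.
  have key : ∀ (V : Opens X) (_ : V ≤ U) (s : S V), ∃ t : G V, ∀ i (W : Opens X) (hW : W ≤ V)
      (hi : W ≤ c i), resG _ _ hW t = m i W hi (resS _ _ hW s) := by
    intro V hV s
    obtain ⟨t, ht, -⟩ := hG ι V (fun i ↦ V ⊓ c i) (fun _ ↦ inf_le_left) (le_iSup_inf hU hV)
      (fun i ↦ m i _ inf_le_right (resS _ _ inf_le_left s)) (fun i j W hi hj ↦ by
        rw [hnat, hnat, htransS, htransS, hagree])
    refine ⟨t, fun i W hW hi ↦ ?_⟩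
    rw [← htransG inf_le_left (le_inf hW hi), ht, hnat, htransS]
  choose M hM using key
  refine ⟨M, fun V W hV h s ↦ ?_, fun i V hV s ↦ ?_⟩
  · refine hG.ext htransG hU (h.trans hV) fun i W' hW' hi ↦ ?_
    rw [htransG, hM _ _ _ i _ _ hi, hM _ _ _ i _ _ hi, htransS]
  · refine hG.ext htransG hU (hV.trans (hc i)) fun j W hW hj ↦ ?_
    rw [hM _ _ _ j _ _ hj, hnat, hagree i j]

end Gluing

section Structure

variable {K : Type u} [Field K] {X : TopCat.{u}} (𝒪 : TopCat.Sheaf (CommAlgCat.{u} K) X)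

/-- The forgetful functor is represented by `K[X]`, hence preserves limits; this is what lets
sections of a sheaf of algebras be glued as elements. -/
instance : (forget (CommAlgCat.{u} K)).IsCorepresentable :=
  ⟨CommAlgCat.of K (Polynomial K), ⟨
    { homEquiv := fun {A} ↦
        { toFun := fun f ↦ f.hom Polynomial.X
          invFun := fun a ↦ CommAlgCat.ofHom (Polynomial.aeval (R := K) (A := A) a)
          left_inv := fun f ↦ by
            ext1
            refine Polynomial.algHom_ext ?_
            simp
          right_inv := fun a ↦ by simp }
      homEquiv_comp := fun _ _ ↦ rfl }⟩⟩

theorem hasGluing_fn : HasGluing (Fn 𝒪) (fun _ _ h ↦ Fn.res 𝒪 h) := by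
  intro ι U c hc hU s hs
  exact 𝒪.existsUnique_gluing' c U (fun i ↦ homOfLE (hc i)) hU s
    (fun i j ↦ hs i j _ inf_le_left inf_le_right)

end Structure

namespace LieAlgebroid

variable {K : Type u} [Field K] {X : TopCat.{u}} {𝒪 : TopCat.Sheaf (CommAlgCat.{u} K) X}
  {𝓛 : LieAlgebroid 𝒪}

/-- Jets are natural families of maps with values in the sheaf `𝒪`, so `HasGluing.glue_maps` applies
and linearity is checked on the cover. The same scheme then serves operators, with values in jets,
and forms, with values in operators. -/
theorem hasGluing_jet : HasGluing 𝓛.JetSec (fun _ _ h ↦ jetRes h) := by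
  intro ι U c hc hU s hs
  have hG := hasGluing_fn 𝒪
  have hext : ∀ {V : Opens X} (_ : V ≤ U) {a b : Fn 𝒪 V}, (∀ i W (hW : W ≤ V), W ≤ c i →
      Fn.res 𝒪 hW a = Fn.res 𝒪 hW b) → a = b := fun hV _ _ h ↦
    hG.ext (fun h h' ↦ Fn.res_trans 𝒪 h h') hU hV h
  obtain ⟨M, hM, hM'⟩ := hG.glue_maps (S := 𝓛.EnvSec) (resS := fun _ _ h ↦ 𝓛.envRes h)
    (fun h h' ↦ 𝓛.envRes_trans h h') (fun h h' ↦ Fn.res_trans 𝒪 h h') hc hU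
    (fun i V hV D ↦ (s i).on V hV D) (fun i V W hV h D ↦ (s i).compat hV h D)
    (fun i j V hi hj D ↦ congrArg (fun φ : 𝓛.JetSec V ↦ φ.on V le_rfl D) (hs i j V hi hj))
  refine ⟨JetSec.mk (fun V hV ↦ show 𝓛.EnvSec V →ₗ[Fn 𝒪 V] Fn 𝒪 V from
    { toFun := M V hV
      map_add' := fun D E ↦ hext hV fun i W hW hi ↦ by
        simp only [map_add, hM]
        rw [hM' i W hi, hM' i W hi, hM' i W hi, map_add]
      map_smul' := fun a D ↦ hext hV fun i W hW hi ↦ by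
        simp only [smul_eq_mul, RingHom.id_apply, map_mul, hM, Env.smul_def, envRes, Env.map_fn]
        rw [hM' i W hi, hM' i W hi, Jet.map_fn_mul] }) (fun V W hV h D ↦ hM V W hV h D), ?_, ?_⟩
  · exact fun i ↦ JetSec.ext fun V hV ↦ Jet.ext fun D ↦ hM' i V hV D
  · intro φ hφ
    refine JetSec.ext fun V hV ↦ Jet.ext fun D ↦ hext hV fun i W hW hi ↦ ?_
    refine (φ.compat hV hW D).trans (Eq.trans ?_ (hM V W hV hW D).symm)
    refine Eq.trans ?_ (hM' i W hi (𝓛.envRes hW D)).symm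
    exact congrArg (fun ψ : 𝓛.JetSec (c i) ↦ ψ.on W hi (𝓛.envRes hW D)) (hφ i)

theorem hasGluing_diff : HasGluing 𝓛.DiffSec (fun _ _ h ↦ diffRes h) := by
  intro ι U c hc hU s hs
  have hG := hasGluing_jet (𝓛 := 𝓛)
  have hext : ∀ {V : Opens X} (_ : V ≤ U) {a b : 𝓛.JetSec V}, (∀ i W (hW : W ≤ V), W ≤ c i →
      jetRes hW a = jetRes hW b) → a = b := fun hV _ _ h ↦ hG.ext (fun _ _ _ ↦ rfl) hU hV h
  obtain ⟨M, hM, hM'⟩ := hG.glue_maps (S := 𝓛.JetSec) (resS := fun _ _ h ↦ jetRes h)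
    (fun _ _ _ ↦ rfl) (fun _ _ _ ↦ rfl) hc hU
    (fun i V hV φ ↦ (s i).on V hV φ) (fun i V W hV h D ↦ (s i).compat hV h D)
    (fun i j V hi hj D ↦ congrArg (fun φ : 𝓛.DiffSec V ↦ φ.on V le_rfl D) (hs i j V hi hj))
  have hlin : ∀ (V : Opens X) (hV : V ≤ U), ∃ f : Module.End (Fn 𝒪 V) (𝓛.JetSec V),
      ∀ φ, f φ = M V hV φ := fun V hV ↦ ⟨
    { toFun := M V hV
      map_add' := fun D E ↦ hext hV fun i W hW hi ↦ by
        simp only [map_add, hM]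
        rw [hM' i W hi, hM' i W hi, hM' i W hi, map_add]
      map_smul' := fun a D ↦ hext hV fun i W hW hi ↦ by
        simp only [RingHom.id_apply, hM, jetRes_smul]
        rw [hM' i W hi, hM' i W hi, map_smul] }, fun _ ↦ rfl⟩
  choose f hf using hlin
  have hf' : ∀ i (V : Opens X) (hV : V ≤ c i), f V (hV.trans (hc i)) = (s i).on V hV :=
    fun i V hV ↦ LinearMap.ext fun φ ↦ (hf _ _ _).trans (hM' i V hV φ)
  refine ⟨DiffSec.mk f (fun V W hV h φ ↦ by rw [hf, hf]; exact hM V W hV h φ) (fun x hx ↦ ?_),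
    ?_, ?_⟩
  -- The orders of the pieces may be unbounded over the cover; the condition only asks for a bound
  -- near `x`, and a member containing `x` supplies it.
  · obtain ⟨i, hi⟩ := Opens.mem_iSup.mp (hU hx)
    obtain ⟨V, hV, hxV, n, hn⟩ := (s i).order x hi
    refine ⟨V, hV.trans (hc i), hxV, n, fun W h ↦ ?_⟩
    rw [hf' i W (h.trans hV)]
    exact hn W h
  · exact fun i ↦ DiffSec.ext fun V hV ↦ hf' i V hV
  · intro P hP
    refine DiffSec.ext fun V hV ↦ LinearMap.ext fun φ ↦ hext hV fun i W hW hi ↦ ?_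
    rw [DiffSec.mk_on, hf]
    refine (P.compat hV hW φ).trans (Eq.trans ?_ (hM V W hV hW φ).symm)
    refine Eq.trans ?_ (hM' i W hi (jetRes hW φ)).symm
    exact congrArg (fun Q : 𝓛.DiffSec (c i) ↦ Q.on W hi (jetRes hW φ)) (hP i)

theorem diffRes_smul {U V : Opens X} (h : V ≤ U) (a : Fn 𝒪 U) (P : 𝓛.DiffSec U) :
    diffRes h (a • P) = Fn.res 𝒪 h a • diffRes h P := DiffSec.ext fun W hW ↦ by
  simp [Fn.res_trans]

theorem hasGluing_form (p : ℕ) : HasGluing (𝓛.FormSec p) (fun _ _ h ↦ formRes h) := by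
  intro ι U c hc hU s hs
  have hG := hasGluing_diff (𝓛 := 𝓛)
  have hext : ∀ {V : Opens X} (_ : V ≤ U) {a b : 𝓛.DiffSec V}, (∀ i W (hW : W ≤ V), W ≤ c i →
      diffRes hW a = diffRes hW b) → a = b := fun hV _ _ h ↦ hG.ext (fun _ _ _ ↦ rfl) hU hV h
  obtain ⟨M, hM, hM'⟩ := hG.glue_maps (S := fun V ↦ Fin p → 𝓛.sec V)
    (resS := fun _ _ h v ↦ 𝓛.res h ∘ v)
    (fun h h' v ↦ funext fun i ↦ 𝓛.res_trans h h' (v i)) (fun _ _ _ ↦ rfl) hc hU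
    (fun i V hV v ↦ (s i).on V hV v) (fun i V W hV h v ↦ (s i).compat hV h v)
    (fun i j V hi hj v ↦ congrArg (fun ω : 𝓛.FormSec p V ↦ ω.on V le_rfl v) (hs i j V hi hj))
  have hlin : ∀ (V : Opens X) (hV : V ≤ U), ∃ f : 𝓛.sec V [⋀^Fin p]→ₗ[Fn 𝒪 V] 𝓛.DiffSec V,
      ∀ v, f v = M V hV v := fun V hV ↦ ⟨
    { toFun := M V hV
      map_update_add' := fun v k x y ↦ hext hV fun i W hW hi ↦ by
        simp only [map_add, hM, Function.comp_update]
        rw [hM' i W hi, hM' i W hi, hM' i W hi,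
          AlternatingMap.map_update_add]
      map_update_smul' := fun v k a x ↦ hext hV fun i W hW hi ↦ by
        simp only [hM, Function.comp_update, diffRes_smul]
        rw [hM' i W hi, hM' i W hi, (𝓛.res hW).map_smul_apply, AlternatingMap.map_update_smul]
      map_eq_zero_of_eq' := fun v k l hkl hne ↦ hext hV fun i W hW hi ↦ by
        simp only [hM, map_zero]
        rw [hM' i W hi]
        exact AlternatingMap.map_eq_zero_of_eq _ _ (congrArg (𝓛.res hW) hkl) hne },
    fun _ ↦ rfl⟩
  choose f hf using hlin
  refine ⟨FormSec.mk f (fun V W hV h v ↦ by rw [hf, hf]; exact hM V W hV h v), ?_, ?_⟩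
  · exact fun i ↦ FormSec.ext fun V hV ↦ AlternatingMap.ext fun v ↦
      (hf _ _ _).trans (hM' i V hV v)
  · intro P hP
    refine FormSec.ext fun V hV ↦ AlternatingMap.ext fun φ ↦ hext hV fun i W hW hi ↦ ?_
    rw [FormSec.mk_on, hf]
    refine (P.compat hV hW φ).trans (Eq.trans ?_ (hM V W hV hW φ).symm)
    refine Eq.trans ?_ (hM' i W hi (𝓛.res hW ∘ φ)).symm
    exact congrArg (fun Q : 𝓛.FormSec p (c i) ↦ Q.on W hi (𝓛.res hW ∘ φ)) (hP i)

variable (𝓛) in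
theorem isSheafOfDGAlgebras [CharZero K] : 𝓛.IsSheafOfDGAlgebras where
  isSheaf p := by
    rw [TopCat.Presheaf.isSheaf_iff_isSheafUniqueGluing]
    intro ι c s hs
    refine hasGluing_form (𝓛 := 𝓛) p ι (iSup c) c (le_iSup c) le_rfl s fun i j V hi hj ↦ ?_
    have := congrArg (formRes (𝓛 := 𝓛) (le_inf hi hj)) (hs i j)
    exact this
  isDGAlgebra := isDGAlgebra_form
  res_d _ _ _ := rfl
  res_mul _ _ _ _ _ := rfl
  res_one _ := rfl

end LieAlgebroid

end LieRinehart

/-! ### The Poincaré–Birkhoff–Witt theorem for Lie–Rinehart algebras with a finite basis. -/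

namespace LieRinehart

namespace PBW

variable {K R L ι : Type*} [CommRing K] [CommRing R] [Algebra K R] [LieRing L] [LieAlgebra K L]
  [Module R L] [LieRingModule L R] [LieRinehartRing R L] [LieRinehartAlgebra K R L]

/-- The free module on the monomials in variables indexed by `ι`. -/
abbrev Mon (R ι : Type*) [CommRing R] := Multiset ι →₀ R

/-- A monomial. -/
noncomputable def mon (R : Type*) {ι : Type*} [CommRing R] (M : Multiset ι) : Mon R ι :=
  Finsupp.single M 1

/-- The submodule spanned by the monomials of degree at most `n`. -/
noncomputable def degLE (R ι : Type*) [CommRing R] (n : ℕ) : Submodule R (Mon R ι) :=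
  Submodule.span R (mon R '' {M | M.card ≤ n})

theorem mon_mem_degLE {n : ℕ} {M : Multiset ι} (h : M.card ≤ n) : mon R M ∈ degLE R ι n :=
  Submodule.subset_span ⟨M, h, rfl⟩

theorem degLE_mono {m n : ℕ} (h : m ≤ n) : degLE R ι m ≤ degLE R ι n :=
  Submodule.span_mono (Set.image_mono fun _ hM ↦ le_trans hM h)

theorem span_mon : Submodule.span R (Set.range (mon R (ι := ι))) = ⊤ := by
  have h : mon R (ι := ι) = Finsupp.basisSingleOne (R := R) (ι := Multiset ι) :=
    funext fun M ↦ by simp [mon]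
  rw [h, Module.Basis.span_eq]

variable (K) in
/-- The `x`-derivation of the free module on monomials with given values on the monomials. -/
noncomputable def tw (x : L) (t : Multiset ι → Mon R ι) : Module.End K (Mon R ι) :=
  Finsupp.lsum K fun M ↦ (LinearMap.toSpanSingleton R (Mon R ι) (t M)).restrictScalars K +
    ((Finsupp.lsingle M : R →ₗ[K] Mon R ι) ∘ₗ (LieModule.toEnd K L R x))

theorem tw_single (x : L) (t : Multiset ι → Mon R ι) (M : Multiset ι) (a : R) :
    tw K x t (Finsupp.single M a) = a • t M + ⁅x, a⁆ • mon R M := by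
  simp [tw, mon]

theorem tw_mon (x : L) (t : Multiset ι → Mon R ι) (M : Multiset ι) :
    tw K x t (mon R M) = t M := by
  rw [mon, tw_single, Env.lie_one]
  simp

theorem tw_smul (x : L) (t : Multiset ι → Mon R ι) (a : R) (s : Mon R ι) :
    tw K x t (a • s) = a • tw K x t s + ⁅x, a⁆ • s := by
  induction s using Finsupp.induction_linear with
  | zero => simp
  | add f g hf hg => simp only [smul_add, map_add, hf, hg]; abel
  | single M b =>
    have h : ∀ c : R, Finsupp.single M c = c • mon R M := fun c ↦ by simp [mon]
    simp only [Finsupp.smul_single, tw_single, smul_eq_mul, LieRinehartRing.leibniz_mul_right]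
    simp only [h]
    module

/-- On elements of degree at most `n` only the values of `t` in that range count, so an action known
in low degree may already be used there. -/
theorem tw_congr {x : L} {t t' : Multiset ι → Mon R ι} {n : ℕ}
    (h : ∀ M : Multiset ι, M.card ≤ n → t M = t' M) {s : Mon R ι} (hs : s ∈ degLE R ι n) :
    tw K x t s = tw K x t' s := by
  induction hs using Submodule.span_induction with
  | mem s hs =>
    obtain ⟨M, hM, rfl⟩ := hs
    rw [tw_mon, tw_mon, h M hM]
  | zero => simp
  | add s s' _ _ h h' => simp only [map_add, h, h']
  | smul a s _ h => simp only [tw_smul, h]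

theorem tw_mem {x : L} {t : Multiset ι → Mon R ι} {n m : ℕ} (hnm : n ≤ m)
    (h : ∀ M : Multiset ι, M.card ≤ n → t M ∈ degLE R ι m) {s : Mon R ι}
    (hs : s ∈ degLE R ι n) : tw K x t s ∈ degLE R ι m := by
  induction hs using Submodule.span_induction with
  | mem s hs =>
    obtain ⟨M, hM, rfl⟩ := hs
    rw [tw_mon]
    exact h M hM
  | zero => simp
  | add s s' _ _ h h' => rw [map_add]; exact add_mem h h'
  | smul a s hs h =>
    rw [tw_smul]
    exact add_mem (Submodule.smul_mem _ _ h) (Submodule.smul_mem _ _ (degLE_mono hnm hs))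

variable [LinearOrder ι] [Fintype ι] (b : Module.Basis ι R L)

variable (K) in
/-- Approximations to the action of the basis of `L` on monomials. -/
noncomputable def approx : ℕ → ι → Multiset ι → Mon R ι
  -- The first argument is the recursion depth. The value at depth zero is arbitrary: values on `M`
  -- are meaningful only at depth greater than `M.card`.
  | 0, _, _ => 0
  | m + 1, i, M => match M.sort (· ≤ ·) with
    | [] => mon R (i ::ₘ M)
    | j :: l => if i ≤ j then mon R (i ::ₘ M) else
        -- This is `bᵢ bⱼ l = bⱼ bᵢ l + ⁅bᵢ, bⱼ⁆ l` with `j` minimal. The leading monomial of `bᵢ l`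
        -- is treated separately, since `bⱼ` has to send it to the monomial `i ::ₘ M`; the rest has
        -- lower degree, where `bⱼ` is already available.
        mon R (i ::ₘ M) + tw K (b j) (approx m j) (approx m i l - mon R (i ::ₘ (l : Multiset ι))) +
          ∑ k, b.repr ⁅b i, b j⁆ k • approx m k l

theorem sort_cons_of_le {j : ι} {N : Multiset ι} (h : ∀ k ∈ N, j ≤ k) :
    (j ::ₘ N).sort (· ≤ ·) = j :: N.sort (· ≤ ·) := Multiset.sort_cons j N (· ≤ ·) h

theorem exists_min_cons {M : Multiset ι} (h : M ≠ 0) :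
    ∃ (j : ι) (N : Multiset ι), M = j ::ₘ N ∧ ∀ k ∈ N, j ≤ k := by
  classical
  have hM : M.sort (· ≤ ·) ≠ [] := by
    intro h'
    apply h
    rw [← Multiset.sort_eq M (· ≤ ·), h']
    rfl
  obtain ⟨j, l, hl⟩ := List.exists_cons_of_ne_nil hM
  have hs := Multiset.pairwise_sort M (· ≤ ·)
  rw [hl, List.pairwise_cons] at hs
  refine ⟨j, l, ?_, fun k hk ↦ hs.1 k hk⟩
  rw [← Multiset.sort_eq M (· ≤ ·), hl]
  rfl

theorem approx_of_le (m : ℕ) {i : ι} {M : Multiset ι} (h : ∀ k ∈ M, i ≤ k) :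
    approx K b (m + 1) i M = mon R (i ::ₘ M) := by
  rw [approx]
  split
  · rfl
  · next j l hl =>
    rw [if_pos]
    apply h
    rw [← Multiset.mem_sort (r := (· ≤ ·)), hl]
    exact List.mem_cons_self

theorem approx_of_lt (m : ℕ) {i j : ι} {N : Multiset ι} (h : ∀ k ∈ N, j ≤ k) (hij : j < i) :
    approx K b (m + 1) i (j ::ₘ N) = mon R (i ::ₘ j ::ₘ N) +
      tw K (b j) (approx K b m j) (approx K b m i N - mon R (i ::ₘ N)) +
      ∑ k, b.repr ⁅b i, b j⁆ k • approx K b m k N := by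
  rw [approx, sort_cons_of_le h]
  simp only [if_neg (not_le.mpr hij), Multiset.sort_eq]

/-- Stability in the depth and the estimate of the leading term must be proved together: `approx m
j` has stabilised on the correction `approx m i N - mon R (i ::ₘ N)` because that correction has
degree at most `N.card`. -/
theorem approx_succ (m : ℕ) : ∀ (i : ι) (M : Multiset ι), M.card < m →
    approx K b (m + 1) i M = approx K b m i M ∧
      approx K b m i M - mon R (i ::ₘ M) ∈ degLE R ι M.card := by
  induction m with
  | zero => intro i M h; omega
  | succ m ih =>
    intro i M hM
    by_cases hi : ∀ k ∈ M, i ≤ k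
    · rw [approx_of_le b _ hi, approx_of_le b _ hi, sub_self]
      exact ⟨rfl, zero_mem _⟩
    · obtain ⟨j, N, rfl, hN⟩ := exists_min_cons (M := M) (by rintro rfl; simp at hi)
      have hij : j < i := by
        by_contra hij
        refine hi fun k hk ↦ (not_lt.mp hij).trans ?_
        rcases Multiset.mem_cons.mp hk with rfl | hk
        exacts [le_rfl, hN k hk]
      rw [Multiset.card_cons] at hM ⊢
      have hN' : N.card < m := by omega
      have hmem : ∀ (k : ι) (M : Multiset ι), M.card ≤ N.card →
          approx K b m k M ∈ degLE R ι (N.card + 1) := by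
        intro k M hM
        have h1 := (ih k M (by omega)).2
        have h2 : mon R (k ::ₘ M) ∈ degLE R ι (N.card + 1) :=
          mon_mem_degLE (by rw [Multiset.card_cons]; omega)
        have h3 := add_mem (degLE_mono (hM.trans (Nat.le_succ _)) h1) h2
        rwa [sub_add_cancel] at h3
      rw [approx_of_lt b _ hN hij, approx_of_lt b _ hN hij]
      refine ⟨?_, ?_⟩
      · rw [(ih i N hN').1, tw_congr (fun M hM ↦ (ih j M (by omega)).1) (ih i N hN').2]
        simp only [(ih _ N hN').1]
      · rw [add_assoc, add_sub_cancel_left]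
        exact add_mem (tw_mem (Nat.le_succ _) (fun M hM ↦ hmem j M hM) (ih i N hN').2)
          (sum_mem fun k _ ↦ Submodule.smul_mem _ _ (hmem k N le_rfl))

variable (K) in
/-- The action of the basis of `L` on monomials. -/
noncomputable def gen (i : ι) (M : Multiset ι) : Mon R ι := approx K b (M.card + 1) i M

theorem approx_eq_gen {m : ℕ} (i : ι) {M : Multiset ι} (h : M.card < m) :
    approx K b m i M = gen K b i M := by
  induction m, h using Nat.le_induction with
  | base => rfl
  | succ m h ih => rw [(approx_succ b m i M h).1, ih]

theorem gen_of_le {i : ι} {M : Multiset ι} (h : ∀ k ∈ M, i ≤ k) :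
    gen K b i M = mon R (i ::ₘ M) := approx_of_le b _ h

theorem gen_sub_mem (i : ι) (M : Multiset ι) :
    gen K b i M - mon R (i ::ₘ M) ∈ degLE R ι M.card := (approx_succ b _ i M (Nat.lt_succ_self _)).2

theorem gen_of_lt {i j : ι} {N : Multiset ι} (h : ∀ k ∈ N, j ≤ k) (hij : j < i) :
    gen K b i (j ::ₘ N) = mon R (i ::ₘ j ::ₘ N) +
      tw K (b j) (gen K b j) (gen K b i N - mon R (i ::ₘ N)) +
      ∑ k, b.repr ⁅b i, b j⁆ k • gen K b k N := by
  have hN : N.card < (j ::ₘ N).card := by simp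
  rw [gen, approx_of_lt b _ h hij]
  simp only [approx_eq_gen b _ hN]
  rw [tw_congr (fun M hM ↦ approx_eq_gen b j (lt_of_le_of_lt hM hN)) (gen_sub_mem b i N)]

variable (K) in
/-- The action of `L` on the free module on monomials. -/
noncomputable def op (x : L) : Module.End K (Mon R ι) :=
  tw K x fun M ↦ ∑ k, b.repr x k • gen K b k M

theorem op_mon (x : L) (M : Multiset ι) : op K b x (mon R M) = ∑ k, b.repr x k • gen K b k M :=
  tw_mon _ _ _

theorem op_basis (i : ι) : op K b (b i) = tw K (b i) (gen K b i) := by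
  rw [op]
  congr 1
  funext M
  simp [Finsupp.single_apply, ite_smul]

theorem op_basis_mon (i : ι) (M : Multiset ι) : op K b (b i) (mon R M) = gen K b i M := by
  rw [op_basis, tw_mon]

theorem op_smul_right (x : L) (a : R) (s : Mon R ι) :
    op K b x (a • s) = a • op K b x s + ⁅x, a⁆ • s := tw_smul _ _ _ _

theorem mon_induction {p : Mon R ι → Prop} (mon : ∀ M, p (mon R M)) (zero : p 0)
    (add : ∀ s t, p s → p t → p (s + t)) (smul : ∀ (a : R) s, p s → p (a • s)) (s : Mon R ι) :
    p s := by
  have hs : s ∈ Submodule.span R (Set.range (PBW.mon R (ι := ι))) := by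
    rw [span_mon]; trivial
  induction hs using Submodule.span_induction with
  | mem s hs => obtain ⟨M, rfl⟩ := hs; exact mon M
  | zero => exact zero
  | add s t _ _ hs ht => exact add s t hs ht
  | smul a s _ hs => exact smul a s hs

theorem op_add (x y : L) : op K b (x + y) = op K b x + op K b y := by
  refine LinearMap.ext fun s ↦ ?_
  induction s using mon_induction with
  | mon M => simp [op_mon, add_smul, Finset.sum_add_distrib]
  | zero => simp
  | add s t hs ht => simp only [map_add, hs, ht]
  | smul a s hs =>
    simp only [op_smul_right, hs, LinearMap.add_apply, add_lie, add_smul, smul_add]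
    abel

theorem op_smul (c : R) (x : L) (s : Mon R ι) : op K b (c • x) s = c • op K b x s := by
  induction s using mon_induction with
  | mon M => simp [op_mon, Finset.smul_sum, smul_smul]
  | zero => simp
  | add s t hs ht => simp only [map_add, hs, ht, smul_add]
  | smul a s hs =>
    simp only [op_smul_right, hs, LieRinehartRing.lie_smul_eq_mul, smul_add, smul_smul]
    rw [mul_comm a c]

variable (K) in
/-- The curvature of the action of `L` on monomials. -/
noncomputable def curv (x y : L) : Mon R ι →ₗ[R] Mon R ι where
  toFun s := op K b x (op K b y s) - op K b y (op K b x s) - op K b ⁅x, y⁆ s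
  map_add' s t := by simp only [map_add]; abel
  -- The derivatives of the scalar cancel between the commutator and the bracket, which makes the
  -- curvature linear over `R`, so testing it on monomials is enough.
  map_smul' a s := by
    simp only [op_smul_right, map_add, lie_lie, sub_smul, smul_sub, RingHom.id_apply]
    abel

theorem curv_apply (x y : L) (s : Mon R ι) :
    curv K b x y s = op K b x (op K b y s) - op K b y (op K b x s) - op K b ⁅x, y⁆ s := rfl

variable (K) in
/-- The action of `L` on the free module on monomials, as an additive map. -/
noncomputable def opHom : L →+ Module.End K (Mon R ι) := AddMonoidHom.mk' (op K b) (op_add b)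

theorem opHom_apply (x : L) : opHom K b x = op K b x := rfl

theorem op_zero : op K b (0 : L) = 0 := map_zero (opHom K b)

theorem op_neg (x : L) : op K b (-x) = -op K b x := map_neg (opHom K b) x

theorem curv_swap (x y : L) : curv K b y x = -curv K b x y := by
  refine LinearMap.ext fun s ↦ ?_
  rw [LinearMap.neg_apply, curv_apply, curv_apply, ← lie_skew x y, op_neg, LinearMap.neg_apply]
  abel

theorem curv_add_left (x x' y : L) : curv K b (x + x') y = curv K b x y + curv K b x' y := by
  refine LinearMap.ext fun s ↦ ?_
  simp only [LinearMap.add_apply, curv_apply, add_lie, op_add, map_add]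
  abel

/-- The term in which `y` differentiates `a` cancels against the correction term in `⁅a • x, y⁆`. -/
theorem curv_smul_left (a : R) (x y : L) : curv K b (a • x) y = a • curv K b x y := by
  refine LinearMap.ext fun s ↦ ?_
  have h : ⁅a • x, y⁆ = a • ⁅x, y⁆ + -(⁅y, a⁆ • x) := by
    rw [← lie_skew, LieRinehartRing.leibniz_smul_right, ← lie_skew x y, smul_neg]
    abel
  simp only [LinearMap.smul_apply, curv_apply, h, op_add, op_smul, op_neg, op_smul_right,
    LinearMap.add_apply, LinearMap.neg_apply, smul_sub]
  abel

theorem curv_add_right (x y y' : L) : curv K b x (y + y') = curv K b x y + curv K b x y' := by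
  rw [curv_swap, curv_add_left, curv_swap b x y, curv_swap b x y']
  abel

/-- Together with the preceding lemmas this makes the curvature a bilinear tensor, so it may be
tested on the basis. -/
theorem curv_smul_right (a : R) (x y : L) : curv K b x (a • y) = a • curv K b x y := by
  refine LinearMap.ext fun s ↦ ?_
  rw [curv_swap, curv_smul_left, curv_swap b x y, LinearMap.neg_apply, LinearMap.smul_apply,
    LinearMap.smul_apply, LinearMap.neg_apply, smul_neg, neg_neg]

theorem curv_eq_zero_of_basis {s : Mon R ι} (h : ∀ i j, j < i → curv K b (b i) (b j) s = 0)
    (x y : L) : curv K b x y s = 0 := by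
  have h' : ∀ i j, curv K b (b i) (b j) s = 0 := by
    intro i j
    rcases lt_trichotomy i j with hij | rfl | hij
    · rw [curv_swap, LinearMap.neg_apply, h j i hij, neg_zero]
    · rw [curv_apply, lie_self, sub_self, op_zero, LinearMap.zero_apply, sub_zero]
    · exact h i j hij
  let B : L →ₗ[R] L →ₗ[R] Mon R ι := LinearMap.mk₂ R (fun x y ↦ curv K b x y s)
    (fun x x' y ↦ by rw [curv_add_left]; rfl) (fun a x y ↦ by rw [curv_smul_left]; rfl)
    (fun x y y' ↦ by rw [curv_add_right]; rfl) (fun a x y ↦ by rw [curv_smul_right]; rfl)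
  have hB : B = 0 := b.ext fun i ↦ b.ext fun j ↦ h' i j
  exact congrArg (fun B ↦ B x y) hB

/-- The recursion for `gen` on `j ::ₘ N` was chosen to make this commutation relation true. -/
theorem curv_mon_of_le {i j : ι} (hij : j < i) {N : Multiset ι} (hN : ∀ k ∈ N, j ≤ k) :
    curv K b (b i) (b j) (mon R N) = 0 := by
  have hiN : ∀ k ∈ i ::ₘ N, j ≤ k := by
    intro k hk
    rcases Multiset.mem_cons.mp hk with rfl | hk
    exacts [hij.le, hN k hk]
  rw [curv_apply, op_basis_mon, gen_of_le b hN, op_basis_mon, op_basis_mon, op_mon,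
    gen_of_lt b hN hij, map_sub, op_basis, tw_mon, gen_of_le b hiN, Multiset.cons_swap]
  abel

/-- A Bianchi identity: after expansion only the action of the Jacobi sum of the three vectors is
left over. -/
theorem bianchi (x y z : L) (s : Mon R ι) :
    curv K b x y (op K b z s) + curv K b y z (op K b x s) + curv K b z x (op K b y s) =
      op K b z (curv K b x y s) + op K b x (curv K b y z s) + op K b y (curv K b z x s) +
      (curv K b z ⁅x, y⁆ s + curv K b x ⁅y, z⁆ s + curv K b y ⁅z, x⁆ s) := by
  have h : op K b ⁅z, ⁅x, y⁆⁆ s + op K b ⁅x, ⁅y, z⁆⁆ s + op K b ⁅y, ⁅z, x⁆⁆ s = 0 := by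
    rw [← LinearMap.add_apply, ← LinearMap.add_apply, ← op_add, ← op_add]
    have : ⁅z, ⁅x, y⁆⁆ + ⁅x, ⁅y, z⁆⁆ + ⁅y, ⁅z, x⁆⁆ = 0 := by
      rw [← lie_jacobi x y z]; abel
    rw [this, op_zero]
    rfl
  have h' : op K b ⁅z, ⁅x, y⁆⁆ s = -op K b ⁅x, ⁅y, z⁆⁆ s - op K b ⁅y, ⁅z, x⁆⁆ s := by
    rw [← sub_eq_zero, ← h]; abel
  simp only [curv_apply, map_sub, h']
  abel

/-- Induction on the degree. The case left open by `curv_mon_of_le` is a monomial `k ::ₘ P` with `k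
< j < i` and `k` minimal, which is `b k` applied to `P`. The Bianchi identity on `P` expresses this
curvature through two others that have `b k` as an argument; those reduce to `curv_mon_of_le` modulo
lower degree. -/
theorem curv_eq_zero (x y : L) (s : Mon R ι) : curv K b x y s = 0 := by
  have key : ∀ (n : ℕ) (N : Multiset ι), N.card = n → ∀ x y, curv K b x y (mon R N) = 0 := by
    intro n
    induction n using Nat.strong_induction_on with
    | _ n ih =>
      intro N hn
      refine curv_eq_zero_of_basis b fun i j hij ↦ ?_
      by_cases hj : ∀ k ∈ N, j ≤ k
      · exact curv_mon_of_le b hij hj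
      · obtain ⟨k, P, rfl, hP⟩ := exists_min_cons (M := N) (by rintro rfl; simp at hj)
        have hkj : k < j := by
          by_contra hkj
          refine hj fun l hl ↦ (not_lt.mp hkj).trans ?_
          rcases Multiset.mem_cons.mp hl with rfl | hl
          exacts [le_rfl, hP l hl]
        have hcard : P.card < n := by rw [← hn]; simp
        have hlow : ∀ x y, ∀ s ∈ degLE R ι P.card, curv K b x y s = 0 := by
          intro x y s hs
          induction hs using Submodule.span_induction with
          | mem s hs =>
            obtain ⟨M, hM, rfl⟩ := hs
            exact ih _ (lt_of_le_of_lt hM hcard) M rfl x y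
          | zero => simp
          | add s t _ _ hs ht => rw [map_add, hs, ht, add_zero]
          | smul a s _ hs => rw [map_smul, hs, smul_zero]
        have hP0 : ∀ x y, curv K b x y (mon R P) = 0 :=
          fun x y ↦ hlow x y _ (mon_mem_degLE le_rfl)
        -- Up to terms of lower degree, killed by `hlow`, `b i` applied to `P` is the monomial `i
        -- ::ₘ P`, in which `k` is still a lower bound.
        have hgen : ∀ i j, k < j → k ≤ i → curv K b (b j) (b k) (op K b (b i) (mon R P)) = 0 := by
          intro i j hkj hki
          rw [op_basis_mon, ← sub_add_cancel (gen K b i P) (mon R (i ::ₘ P)), map_add,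
            hlow _ _ _ (gen_sub_mem b i P), zero_add]
          refine curv_mon_of_le b hkj fun l hl ↦ ?_
          rcases Multiset.mem_cons.mp hl with rfl | hl
          exacts [hki, hP l hl]
        have hB := bianchi (K := K) b (b i) (b j) (b k) (mon R P)
        simp only [hP0, map_zero, add_zero] at hB
        rw [hgen i j hkj (hkj.trans hij).le, curv_swap b (b i) (b k), LinearMap.neg_apply,
          hgen j i (hkj.trans hij) hkj.le, neg_zero, add_zero, add_zero, op_basis_mon,
          gen_of_le b hP] at hB
        exact hB
  induction s using mon_induction with
  | mon M => exact key _ M rfl x y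
  | zero => simp
  | add s t hs ht => rw [map_add, hs, ht, add_zero]
  | smul a s hs => rw [map_smul, hs, smul_zero]

theorem opHom_mul_lsmul (x : L) (a : R) :
    opHom K b x * Algebra.lsmul K K (Mon R ι) a =
      Algebra.lsmul K K (Mon R ι) a * opHom K b x + Algebra.lsmul K K (Mon R ι) ⁅x, a⁆ := by
  refine LinearMap.ext fun s ↦ ?_
  rw [LinearMap.add_apply, Module.End.mul_apply, Module.End.mul_apply]
  simp only [Algebra.lsmul_coe]
  exact op_smul_right b x a s

theorem opHom_smul (a : R) (x : L) :
    opHom K b (a • x) = Algebra.lsmul K K (Mon R ι) a * opHom K b x := by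
  refine LinearMap.ext fun s ↦ ?_
  rw [Module.End.mul_apply]
  simp only [Algebra.lsmul_coe]
  exact op_smul b a x s

theorem opHom_lie (x y : L) :
    opHom K b ⁅x, y⁆ = opHom K b x * opHom K b y - opHom K b y * opHom K b x := by
  refine LinearMap.ext fun s ↦ ?_
  have := curv_eq_zero (K := K) b x y s
  rw [curv_apply, sub_eq_zero] at this
  exact this.symm

variable (K) in
/-- The representation of the enveloping algebra on the free module on monomials. -/
noncomputable def rep : Env K R L →ₐ[K] Module.End K (Mon R ι) :=
  Env.lift (K := K) (R := R) (L := L) (A := Module.End K (Mon R ι))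
    (Algebra.lsmul K K (Mon R ι)) (opHom K b) (opHom_smul b) (opHom_lie b)
    (opHom_mul_lsmul b)

theorem rep_fn (a : R) (s : Mon R ι) : rep K b (Env.fn K R L a) s = a • s := by
  rw [rep, Env.lift_fn, Algebra.lsmul_coe]

theorem rep_vec (x : L) (s : Mon R ι) : rep K b (Env.vec K x) s = op K b x s := by
  rw [rep, Env.lift_vec, opHom_apply]

variable (K) in
/-- The ordered monomials in a basis of `L`, as elements of the enveloping algebra. -/
noncomputable def ordMon (M : Multiset ι) : Env K R L :=
  ((M.sort (· ≤ ·)).map fun i ↦ Env.vec K (b i)).prod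

theorem ordMon_zero : ordMon K b 0 = 1 := by simp [ordMon]

theorem ordMon_cons {j : ι} {N : Multiset ι} (h : ∀ k ∈ N, j ≤ k) :
    ordMon K b (j ::ₘ N) = Env.vec K (b j) * ordMon K b N := by
  rw [ordMon, sort_cons_of_le h, List.map_cons, List.prod_cons, ordMon]

variable (K) in
/-- The map from the free module on monomials to the enveloping algebra. -/
noncomputable def toEnv : Mon R ι →ₗ[R] Env K R L := Finsupp.linearCombination R (ordMon K b)

theorem toEnv_mon (M : Multiset ι) : toEnv K b (mon R M) = ordMon K b M := by
  simp [toEnv, mon]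

theorem vec_basis_sum (x : L) :
    Env.vec K (R := R) x = ∑ k, b.repr x k • Env.vec K (b k) := by
  let F : L →ₗ[R] Env K R L :=
    { toFun := Env.vec K
      map_add' := Env.vec_add
      map_smul' := Env.vec_smul }
  have h := congrArg F (b.sum_repr x)
  rw [map_sum] at h
  simp only [map_smul] at h
  exact h.symm

theorem vec_mul_smul (x : L) (a : R) (D : Env K R L) :
    Env.vec K x * (a • D) = a • (Env.vec K x * D) + ⁅x, a⁆ • D := by
  simp only [Env.smul_def, ← mul_assoc, Env.vec_mul_fn, add_mul]

/-- The degree bound is there for the induction in `toEnv_gen`, where compatibility is known only on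
monomials of lower degree. -/
theorem toEnv_op_of_gen {n : ℕ} {x : L}
    (h : ∀ M : Multiset ι, M.card ≤ n → toEnv K b (op K b x (mon R M)) =
      Env.vec K x * ordMon K b M) {s : Mon R ι} (hs : s ∈ degLE R ι n) :
    toEnv K b (op K b x s) = Env.vec K x * toEnv K b s := by
  induction hs using Submodule.span_induction with
  | mem s hs =>
    obtain ⟨M, hM, rfl⟩ := hs
    rw [h M hM, toEnv_mon]
  | zero => simp
  | add s t _ _ hs ht => simp only [map_add, hs, ht, mul_add]
  | smul a s _ hs => rw [op_smul_right, map_add, map_smul, map_smul, map_smul, hs, vec_mul_smul]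

/-- The recursion for `gen` is the rewriting of `bᵢ bⱼ` as `bⱼ bᵢ + ⁅bᵢ, bⱼ⁆`, which holds in the
enveloping algebra. -/
theorem toEnv_gen (n : ℕ) : ∀ (i : ι) (M : Multiset ι), M.card = n →
    toEnv K b (gen K b i M) = Env.vec K (b i) * ordMon K b M := by
  induction n using Nat.strong_induction_on with
  | _ n ih =>
    intro i M hn
    by_cases hi : ∀ k ∈ M, i ≤ k
    · rw [gen_of_le b hi, toEnv_mon, ordMon_cons b hi]
    · obtain ⟨j, N, rfl, hN⟩ := exists_min_cons (M := M) (by rintro rfl; simp at hi)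
      have hij : j < i := by
        by_contra hij
        refine hi fun k hk ↦ (not_lt.mp hij).trans ?_
        rcases Multiset.mem_cons.mp hk with rfl | hk
        exacts [le_rfl, hN k hk]
      have hcard : N.card < n := by rw [← hn]; simp
      have hiN : ∀ k ∈ i ::ₘ N, j ≤ k := by
        intro k hk
        rcases Multiset.mem_cons.mp hk with rfl | hk
        exacts [hij.le, hN k hk]
      rw [gen_of_lt b hN hij, map_add, map_add, ← op_basis,
        toEnv_op_of_gen b (n := N.card) (fun M hM ↦ by
          rw [op_basis_mon]
          exact ih _ (lt_of_le_of_lt hM hcard) j M rfl) (gen_sub_mem b i N),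
        map_sub, ih _ hcard i N rfl, toEnv_mon, toEnv_mon, Multiset.cons_swap,
        ordMon_cons b hiN, mul_sub, map_sum]
      simp only [map_smul, ih _ hcard _ N rfl]
      have h1 : ∑ k, b.repr ⁅b i, b j⁆ k • (Env.vec K (b k) * ordMon K b N) =
          Env.vec K ⁅b i, b j⁆ * ordMon K b N := by
        rw [vec_basis_sum b ⁅b i, b j⁆, Finset.sum_mul]
        simp only [smul_mul_assoc]
      rw [h1, Env.vec_lie, ordMon_cons b hN, sub_mul]
      simp only [mul_assoc]
      abel

theorem toEnv_op (x : L) (s : Mon R ι) :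
    toEnv K b (op K b x s) = Env.vec K x * toEnv K b s := by
  induction s using mon_induction with
  | mon M =>
    rw [op_mon, map_sum, toEnv_mon, vec_basis_sum b x, Finset.sum_mul]
    simp only [map_smul, toEnv_gen b _ _ M rfl, smul_mul_assoc]
  | zero => simp
  | add s t hs ht => simp only [map_add, hs, ht, mul_add]
  | smul a s hs => rw [op_smul_right, map_add, map_smul, map_smul, map_smul, hs, vec_mul_smul]

theorem toEnv_rep (D : Env K R L) (s : Mon R ι) : toEnv K b (rep K b D s) = D * toEnv K b s := by
  induction D using Env.induction_right generalizing s with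
  | one => simp
  | add D E hD hE => rw [map_add, LinearMap.add_apply, map_add, hD, hE, add_mul]
  | mul_fn D a h =>
    rw [map_mul, Module.End.mul_apply, h, rep_fn, map_smul, Env.smul_def, mul_assoc]
  | mul_vec D x h => rw [map_mul, Module.End.mul_apply, h, rep_vec, toEnv_op, mul_assoc]

/-- Each factor is at most all those that act before it, so it acts by merely adjoining its index.
-/
theorem rep_ordMon (M : Multiset ι) : rep K b (ordMon K b M) (mon R 0) = mon R M := by
  induction h : M.card generalizing M with
  | zero => rw [Multiset.card_eq_zero.mp h, ordMon_zero, map_one]; rfl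
  | succ n ih =>
    obtain ⟨j, N, rfl, hN⟩ := exists_min_cons (M := M) (by rintro rfl; simp at h)
    rw [ordMon_cons b hN, map_mul, Module.End.mul_apply, ih N (by simpa using h), rep_vec,
      op_basis_mon, gen_of_le b hN]

variable (K) in
/-- The Poincaré–Birkhoff–Witt theorem: the ordered monomials in a basis of `L` form a basis of the
enveloping algebra as a left module. -/
noncomputable def equiv : Mon R ι ≃ₗ[R] Env K R L :=
  { toEnv K b with
    -- Acting on the empty monomial recovers the coefficients: `toEnv` intertwines `rep` with left
    -- multiplication and sends the empty monomial to `1`.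
    invFun := fun D ↦ rep K b D (mon R 0)
    left_inv := fun s ↦ by
      change rep K b (toEnv K b s) (mon R 0) = s
      induction s using mon_induction with
      | mon M => rw [toEnv_mon, rep_ordMon]
      | zero => simp
      | add s t hs ht => simp only [map_add, LinearMap.add_apply, hs, ht]
      | smul a s hs =>
        rw [map_smul, Env.smul_def, map_mul, Module.End.mul_apply, hs, rep_fn]
    right_inv := fun D ↦ by
      change toEnv K b (rep K b D (mon R 0)) = D
      rw [toEnv_rep, toEnv_mon, ordMon_zero, mul_one] }

variable (K) in
/-- The basis of ordered monomials of the enveloping algebra. -/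
noncomputable def basis : Module.Basis (Multiset ι) R (Env K R L) :=
  ⟨(equiv K b).symm⟩

theorem basis_apply (M : Multiset ι) : basis K b M = ordMon K b M := toEnv_mon b M

/-- The leading term of the product of a basis vector and an ordered monomial. -/
theorem vec_mul_ordMon_sub_mem (i : ι) (M : Multiset ι) :
    Env.vec K (b i) * ordMon K b M - ordMon K b (i ::ₘ M) ∈
      Submodule.span R (ordMon K b '' {N | N.card ≤ M.card}) := by
  rw [← toEnv_gen b _ i M rfl, ← toEnv_mon, ← map_sub]
  have h := Submodule.mem_map_of_mem (f := toEnv K b) (gen_sub_mem (K := K) b i M)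
  rw [degLE, Submodule.map_span, ← Set.image_comp] at h
  have h2 : (toEnv K b) ∘ (mon R) = ordMon K b := funext (toEnv_mon b)
  rwa [h2] at h

end PBW

end LieRinehart

/-! ### Divided power series and their differential operators. -/

namespace LieRinehart

/-- Coordinates identifying a commutative `R`-algebra with the algebra of functions on the monomials
in variables indexed by `ι`, with the convolution product of divided power series. -/
structure Coord (ι R A : Type*) [CommRing R] [CommRing A] [Algebra R A] where
  /-- The coefficients. -/
  equiv : A ≃ₗ[R] (Multiset ι → R)
  one_zero : equiv 1 0 = 1
  one_ne : ∀ M, M ≠ 0 → equiv 1 M = 0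
  mul : ∀ φ ψ M, equiv (φ * ψ) M =
    ((Multiset.antidiagonal M).map fun p ↦ equiv φ p.1 * equiv ψ p.2).sum

namespace Coord

variable {ι R A : Type*} [CommRing R] [CommRing A] [Algebra R A] (c : Coord ι R A)

/-- The ideal of elements whose coefficients of degree less than `n` vanish. -/
def ideal (n : ℕ) : Submodule R A where
  carrier := {φ | ∀ M : Multiset ι, M.card < n → c.equiv φ M = 0}
  add_mem' hφ hψ M hM := by rw [map_add, Pi.add_apply, hφ M hM, hψ M hM, add_zero]
  zero_mem' M _ := by rw [map_zero, Pi.zero_apply]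
  smul_mem' a φ hφ M hM := by rw [map_smul, Pi.smul_apply, hφ M hM, smul_zero]

variable {c}

theorem ideal_mono {m n : ℕ} (h : m ≤ n) : c.ideal n ≤ c.ideal m :=
  fun _ hφ M hM ↦ hφ M (hM.trans_le h)

theorem mem_ideal_zero (φ : A) : φ ∈ c.ideal 0 := fun _ hM ↦ absurd hM (Nat.not_lt_zero _)

theorem mul_mem_ideal {m n : ℕ} {φ ψ : A} (hφ : φ ∈ c.ideal m) (hψ : ψ ∈ c.ideal n) :
    φ * ψ ∈ c.ideal (m + n) := by
  intro M hM
  rw [c.mul]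
  refine Multiset.sum_eq_zero fun x hx ↦ ?_
  obtain ⟨p, hp, rfl⟩ := Multiset.mem_map.mp hx
  rw [Multiset.mem_antidiagonal] at hp
  have hcard : p.1.card + p.2.card = M.card := by rw [← hp, Multiset.card_add]
  rcases lt_or_ge p.1.card m with h | h
  · rw [hφ _ h, zero_mul]
  · rw [hψ p.2 (by omega), mul_zero]

theorem mul_mem_ideal_right {n : ℕ} (φ : A) {ψ : A} (hψ : ψ ∈ c.ideal n) :
    φ * ψ ∈ c.ideal n := by
  simpa using mul_mem_ideal (mem_ideal_zero φ) hψ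

theorem eq_zero_of_mem_ideal {φ : A} (h : ∀ n, φ ∈ c.ideal n) : φ = 0 :=
  c.equiv.map_eq_zero_iff.mp (funext fun M ↦ h (M.card + 1) M (Nat.lt_succ_self _))

variable (c) in
/-- The value at the origin. -/
def evalZero : A →+* R where
  toFun φ := c.equiv φ 0
  map_one' := c.one_zero
  map_mul' φ ψ := by simp [c.mul]
  map_zero' := by simp
  map_add' φ ψ := by simp

theorem evalZero_apply (φ : A) : c.evalZero φ = c.equiv φ 0 := rfl

theorem mem_ideal_one {φ : A} : φ ∈ c.ideal 1 ↔ c.evalZero φ = 0 := by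
  refine ⟨fun h ↦ h 0 (by simp), fun h M hM ↦ ?_⟩
  rw [Multiset.card_eq_zero.mp (Nat.lt_one_iff.mp hM)]
  exact h

variable (c) in
/-- The sum of a sequence `φₖ ∈ c.ideal k`. -/
def tsum : (ℕ → A) →ₗ[R] A where
  -- If `a k` lies in `c.ideal k`, the terms with `k > M.card` have zero coefficient at `M`, so
  -- nothing is lost by truncating.
  toFun a := c.equiv.symm fun M ↦ ∑ k ∈ Finset.range (M.card + 1), c.equiv (a k) M
  map_add' a a' := by
    rw [← map_add]
    congr 1
    funext M
    simp [Finset.sum_add_distrib]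
  map_smul' r a := by
    rw [← map_smul]
    congr 1
    funext M
    simp [Finset.mul_sum]

theorem equiv_tsum (a : ℕ → A) (M : Multiset ι) :
    c.equiv (c.tsum a) M = ∑ k ∈ Finset.range (M.card + 1), c.equiv (a k) M := by
  simp [tsum]

theorem tsum_sub_mem {a : ℕ → A} (h : ∀ k, a k ∈ c.ideal k) (n : ℕ) :
    c.tsum a - ∑ k ∈ Finset.range n, a k ∈ c.ideal n := by
  intro M hM
  rw [map_sub, Pi.sub_apply, equiv_tsum, map_sum, Finset.sum_apply, sub_eq_zero]
  refine Finset.sum_subset (Finset.range_mono hM) fun k _ hk ↦ h k M ?_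
  rw [Finset.mem_range] at hk
  omega

/-- After scaling the value at the origin to `1`, the inverse is a geometric series, which converges
for the filtration `c.ideal`. -/
theorem isUnit_of_evalZero {φ : A} (h : IsUnit (c.evalZero φ)) : IsUnit φ := by
  have key : ∀ ψ ∈ c.ideal 1, IsUnit (1 - ψ) := by
    intro ψ hψ
    have hpow : ∀ k, ψ ^ k ∈ c.ideal k := by
      intro k
      induction k with
      | zero => exact mem_ideal_zero _
      | succ k ih => rw [pow_succ]; exact mul_mem_ideal ih hψ
    refine IsUnit.of_mul_eq_one (c.tsum fun k ↦ ψ ^ k)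
      (sub_eq_zero.mp (eq_zero_of_mem_ideal (c := c) fun n ↦ ?_))
    have h1 := mul_mem_ideal_right (1 - ψ) (tsum_sub_mem hpow n)
    have h2 : (1 - ψ) * (c.tsum fun k ↦ ψ ^ k) - 1 =
        (1 - ψ) * ((c.tsum fun k ↦ ψ ^ k) - ∑ k ∈ Finset.range n, ψ ^ k) - ψ ^ n := by
      rw [mul_sub, mul_neg_geom_sum]
      ring
    rw [h2]
    exact sub_mem h1 (hpow n)
  obtain ⟨u, hu⟩ := h
  have h1 : c.evalZero (algebraMap R A (↑u⁻¹)) = ↑u⁻¹ := by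
    rw [evalZero_apply, Algebra.algebraMap_eq_smul_one, map_smul, Pi.smul_apply, c.one_zero,
      smul_eq_mul, mul_one]
  have h2 := key (1 - algebraMap R A (↑u⁻¹) * φ) (mem_ideal_one.mpr (by
    rw [map_sub, map_mul, map_one, h1, ← hu, Units.inv_mul, sub_self]))
  rw [sub_sub_cancel] at h2
  exact isUnit_of_mul_isUnit_right h2

theorem sum_antidiagonal_zero (g : Multiset ι → R) (M : Multiset ι) :
    ((Multiset.antidiagonal M).map fun p ↦ c.equiv 1 p.1 * g p.2).sum = g M := by
  induction M using Multiset.induction_on generalizing g with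
  | empty => simp [c.one_zero]
  | cons a N ih =>
    rw [Multiset.antidiagonal_cons, Multiset.map_add, Multiset.sum_add, Multiset.map_map,
      Multiset.map_map]
    have h := ih fun M ↦ g (a ::ₘ M)
    simp only [Function.comp_def, Prod.map_fst, Prod.map_snd, id_eq,
      c.one_ne _ (Multiset.cons_ne_zero), zero_mul, Multiset.map_const', Multiset.sum_replicate,
      smul_zero, add_zero]
    exact h

variable [DecidableEq ι]

variable (c) in
/-- The coordinate functions. -/
def var (i : ι) : A := c.equiv.symm fun M ↦ if M = {i} then 1 else 0

theorem equiv_var (i : ι) (M : Multiset ι) : c.equiv (c.var i) M = if M = {i} then 1 else 0 := by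
  simp [var]

theorem var_mem (i : ι) : c.var i ∈ c.ideal 1 := mem_ideal_one.mpr (by
  rw [evalZero_apply, equiv_var, if_neg]
  exact (Multiset.singleton_ne_zero i).symm)

/-- The antidiagonal of `M` contains the splitting into `{i}` and `M.erase i` once for every
occurrence of `i`; this multiplicity is the mark of divided powers. -/
theorem equiv_var_mul (i : ι) (φ : A) (M : Multiset ι) :
    c.equiv (c.var i * φ) M = M.count i * c.equiv φ (M.erase i) := by
  rw [c.mul]
  have key : ∀ (g : Multiset ι → R) (M : Multiset ι),
      ((Multiset.antidiagonal M).map fun p ↦ c.equiv (c.var i) p.1 * g p.2).sum =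
        M.count i * g (M.erase i) := by
    intro g M
    induction M using Multiset.induction_on generalizing g with
    | empty => simp [equiv_var, (Multiset.singleton_ne_zero i).symm]
    | cons a N ih =>
      rw [Multiset.antidiagonal_cons, Multiset.map_add, Multiset.sum_add, Multiset.map_map,
        Multiset.map_map]
      have h := ih fun M ↦ g (a ::ₘ M)
      have h2 : (Multiset.map ((fun p : Multiset ι × Multiset ι ↦
          c.equiv (c.var i) p.1 * g p.2) ∘ Prod.map (Multiset.cons a) id)
            (Multiset.antidiagonal N)).sum = if a = i then g N else 0 := by
        split_ifs with hai
        · subst hai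
          rw [← sum_antidiagonal_zero (c := c) g N]
          refine congrArg Multiset.sum (Multiset.map_congr rfl fun p _ ↦ ?_)
          by_cases hp : p.1 = 0
          · simp [equiv_var, hp, c.one_zero]
          · have : a ::ₘ p.1 ≠ {a} := fun h ↦ hp (by
              rw [← Multiset.cons_zero, Multiset.cons_inj_right] at h
              exact h)
            simp [equiv_var, this, c.one_ne _ hp]
        · refine Multiset.sum_eq_zero fun x hx ↦ ?_
          obtain ⟨p, -, rfl⟩ := Multiset.mem_map.mp hx
          have : a ::ₘ p.1 ≠ {i} := fun h ↦ hai (by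
            have := Multiset.mem_cons_self a p.1
            rw [h] at this
            exact Multiset.mem_singleton.mp this)
          simp [equiv_var, this]
      rw [h2]
      refine (congrArg (· + _) h).trans ?_
      by_cases hai : a = i
      · subst hai
        by_cases haN : a ∈ N
        · simp only [if_true, Multiset.count_cons_self, Multiset.erase_cons_head,
            Multiset.cons_erase haN, Nat.cast_add, Nat.cast_one]
          ring
        · simp [Multiset.count_eq_zero_of_notMem haN]
      · rw [if_neg hai, Multiset.count_cons_of_ne (Ne.symm hai),
          Multiset.erase_cons_tail _ hai, add_zero]
  exact key (c.equiv φ) M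

variable [Fintype ι] {K : Type*} [Field K] [CharZero K] [Algebra K R]

/-- Euler's identity: the multiplicities in `M` add up to `M.card`, so dividing each coefficient by
its degree distributes `φ` over the variables. The degree of `i ::ₘ N` is `N.card + 1`, hence the
constant. -/
theorem exists_eq_sum_var (K : Type*) [Field K] [CharZero K] [Algebra K R] {φ : A}
    (h : φ ∈ c.ideal 1) : ∃ ψ : ι → A, φ = ∑ i, c.var i * ψ i := by
  refine ⟨fun i ↦ c.equiv.symm fun N ↦
    algebraMap K R ((N.card : K) + 1)⁻¹ * c.equiv φ (i ::ₘ N), ?_⟩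
  apply c.equiv.injective
  funext M
  rw [map_sum, Finset.sum_apply]
  simp only [equiv_var_mul, LinearEquiv.apply_symm_apply]
  by_cases hM : M = 0
  · subst hM
    simp [h 0 (by simp)]
  · have hM' : (M.card : K) ≠ 0 := by
      rw [Nat.cast_ne_zero]
      exact fun h ↦ hM (Multiset.card_eq_zero.mp h)
    have h1 : ∀ i, (M.count i : R) *
        (algebraMap K R (((M.erase i).card : K) + 1)⁻¹ * c.equiv φ (i ::ₘ M.erase i)) =
        (M.count i : R) * (algebraMap K R (M.card : K)⁻¹ * c.equiv φ M) := by
      intro i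
      by_cases hi : i ∈ M
      · rw [Multiset.cons_erase hi, ← Nat.cast_one, ← Nat.cast_add,
          Multiset.card_erase_add_one hi]
      · simp [Multiset.count_eq_zero_of_notMem hi]
    simp only [h1]
    rw [← Finset.sum_mul, ← Nat.cast_sum, Multiset.sum_count_eq_card (fun _ _ ↦ Finset.mem_univ _),
      ← mul_assoc, ← map_natCast (algebraMap K R), ← map_mul, mul_inv_cancel₀ hM', map_one, one_mul]

/-- No continuity of `P` is assumed. Subtracting the value at the origin and applying
`exists_eq_sum_var` gives `P φ = ∑ xᵢ P ψᵢ`, so the order of vanishing of all values of `P` rises by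
one at each round. -/
theorem eq_zero_of_commute (K : Type*) [Field K] [CharZero K] [Algebra K R] {P : Module.End R A}
    (h : ∀ i φ, P (c.var i * φ) = c.var i * P φ) (h1 : P 1 = 0) : P = 0 := by
  have key : ∀ n φ, P φ ∈ c.ideal n := by
    intro n
    induction n with
    | zero => exact fun φ ↦ mem_ideal_zero _
    | succ n ih =>
      intro φ
      obtain ⟨ψ, hψ⟩ := exists_eq_sum_var (c := c) K (φ := φ - c.evalZero φ • 1)
        (mem_ideal_one.mpr (by
          rw [evalZero_apply, map_sub, map_smul, Pi.sub_apply, Pi.smul_apply, c.one_zero,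
            smul_eq_mul, mul_one, evalZero_apply, sub_self]))
      have h2 : P φ = ∑ i, c.var i * P (ψ i) := by
        rw [← sub_add_cancel φ (c.evalZero φ • 1), hψ, map_add, map_smul, h1, smul_zero, add_zero,
          map_sum]
        simp only [h]
      rw [h2]
      refine sum_mem fun i _ ↦ ?_
      rw [add_comm]
      exact mul_mem_ideal (var_mem i) (ih (ψ i))
  exact LinearMap.ext fun φ ↦ eq_zero_of_mem_ideal fun n ↦ key n φ

variable (c) in
/-- The monomials in the coordinate functions. -/
def varProd (B : Multiset ι) : A := (B.map c.var).prod

theorem varProd_zero : c.varProd 0 = 1 := by simp [varProd]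

theorem varProd_cons (i : ι) (B : Multiset ι) :
    c.varProd (i ::ₘ B) = c.var i * c.varProd B := by simp [varProd]

/-- The commutators with the coordinates have order one less and kill the monomials of degree one
less, so they vanish by induction, and `eq_zero_of_commute` applies. -/
theorem isDiffOp_eq_zero (K : Type*) [Field K] [CharZero K] [Algebra K R] {n : ℕ}
    {P : Module.End R A} (hP : IsDiffOp R n P)
    (h : ∀ B : Multiset ι, B.card ≤ n → P (c.varProd B) = 0) : P = 0 := by
  have hcomm : ∀ {P : Module.End R A} {i : ι},
      P * LinearMap.mulLeft R (c.var i) - LinearMap.mulLeft R (c.var i) * P = 0 →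
        ∀ φ, P (c.var i * φ) = c.var i * P φ :=
    fun h φ ↦ sub_eq_zero.mp (LinearMap.congr_fun h φ)
  induction n generalizing P with
  | zero =>
    refine eq_zero_of_commute (c := c) K (fun i ↦ hcomm (hP _)) ?_
    rw [← c.varProd_zero]
    exact h 0 (by simp)
  | succ n ih =>
    refine eq_zero_of_commute (c := c) K (fun i ↦ hcomm (ih (hP _) fun B hB ↦ ?_)) ?_
    · rw [LinearMap.sub_apply, Module.End.mul_apply, Module.End.mul_apply, LinearMap.mulLeft_apply,
        LinearMap.mulLeft_apply, ← varProd_cons, h B (by omega),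
        h _ (by rw [Multiset.card_cons]; omega), mul_zero, sub_zero]
    · rw [← c.varProd_zero]
      exact h 0 (by simp)

theorem equiv_varProd_ne {B M : Multiset ι} (h : M ≠ B) : c.equiv (c.varProd B) M = 0 := by
  induction B using Multiset.induction_on generalizing M with
  | empty => rw [varProd_zero, c.one_ne _ h]
  | cons i B ih =>
    rw [varProd_cons, equiv_var_mul]
    by_cases hi : i ∈ M
    · rw [ih (M := M.erase i), mul_zero]
      rintro rfl
      exact h (Multiset.cons_erase hi).symm
    · rw [Multiset.count_eq_zero_of_notMem hi, Nat.cast_zero, zero_mul]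

/-- The constant is the product of the factorials of the multiplicities; only that it is nonzero
matters. -/
theorem equiv_varProd_self (B : Multiset ι) :
    ∃ k : ℕ, k ≠ 0 ∧ c.equiv (c.varProd B) B = k := by
  induction B using Multiset.induction_on with
  | empty => exact ⟨1, one_ne_zero, by rw [varProd_zero, c.one_zero, Nat.cast_one]⟩
  | cons i B ih =>
    obtain ⟨k, hk, h⟩ := ih
    refine ⟨(i ::ₘ B).count i * k, mul_ne_zero (by simp) hk, ?_⟩
    rw [varProd_cons, equiv_var_mul, Multiset.erase_cons_head, h, Nat.cast_mul]

end Coord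

/-- The monomials of degree at most `n`. -/
abbrev BddMon (ι : Type*) (n : ℕ) := {M : Multiset ι // M.card ≤ n}

instance (ι : Type*) [Finite ι] (n : ℕ) : Finite (BddMon ι n) := by
  classical
  have := Fintype.ofFinite ι
  let f : BddMon ι n → Σ k : Fin (n + 1), Sym ι k :=
    fun M ↦ ⟨⟨M.1.card, Nat.lt_succ_of_le M.2⟩, ⟨M.1, rfl⟩⟩
  refine Finite.of_injective f fun M N h ↦ Subtype.ext ?_
  exact congrArg (fun s : Σ k : Fin (n + 1), Sym ι k ↦ s.2.1) h

noncomputable instance (ι : Type*) [Finite ι] (n : ℕ) : Fintype (BddMon ι n) := Fintype.ofFinite _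

namespace Coord

variable {ι R A : Type*} [CommRing R] [CommRing A] [Algebra R A] (c : Coord ι R A)
  [DecidableEq ι] [Fintype ι] {n : ℕ} (E : BddMon ι n → Module.End R A)

/-- The matrix of values of differential operators on the monomials in the coordinates. -/
def valueMatrix : Matrix (BddMon ι n) (BddMon ι n) A := fun B M ↦ E M (c.varProd B.1)

/-- At the origin the matrix is diagonal with nonzero integers on the diagonal, and a series with
invertible value at the origin is invertible. -/
theorem isUnit_det_valueMatrix (K : Type*) [Field K] [CharZero K] [Algebra K R]
    (hE : ∀ M φ, c.equiv (E M φ) 0 = c.equiv φ M.1) :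
    IsUnit (c.valueMatrix E).det := by
  apply isUnit_of_evalZero (c := c)
  choose k hk hk' using equiv_varProd_self (c := c)
  have h : c.evalZero.mapMatrix (c.valueMatrix E) =
      Matrix.diagonal fun B : BddMon ι n ↦ (k B.1 : R) := by
    ext B M
    rw [RingHom.mapMatrix_apply, Matrix.map_apply, evalZero_apply, valueMatrix, hE]
    by_cases hBM : B = M
    · subst hBM
      rw [Matrix.diagonal_apply_eq, hk']
    · rw [Matrix.diagonal_apply_ne _ hBM, equiv_varProd_ne]
      exact fun h ↦ hBM (Subtype.ext h.symm)
  rw [RingHom.map_det, h, Matrix.det_diagonal, IsUnit.prod_univ_iff]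
  intro B
  rw [← map_natCast (algebraMap K R)]
  exact (IsUnit.mk0 _ (Nat.cast_ne_zero.mpr (hk _))).map _

/-- The coefficients of an operator as a linear combination of given differential operators. -/
noncomputable def coeffs (M : BddMon ι n) : Module.End R A →ₗ[R] A where
  toFun P := ∑ B, (c.valueMatrix E)⁻¹ M B * P (c.varProd B.1)
  map_add' P Q := by simp [mul_add, Finset.sum_add_distrib]
  map_smul' a P := by simp [Finset.smul_sum]

variable {c E}

/-- The coefficients solve the linear system that prescribes the values on monomials of degree at
most `n` in the coordinates, and these values determine an operator of order at most `n`. -/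
theorem sum_coeffs (K : Type*) [Field K] [CharZero K] [Algebra K R]
    (hE : ∀ M φ, c.equiv (E M φ) 0 = c.equiv φ M.1) (hE' : ∀ M, IsDiffOp R n (E M))
    {P : Module.End R A} (hP : IsDiffOp R n P) :
    ∑ M, LinearMap.mulLeft R (c.coeffs E M P) * E M = P := by
  have hsum : ∀ (s : Finset (BddMon ι n)), IsDiffOp R n
      (∑ M ∈ s, LinearMap.mulLeft R (c.coeffs E M P) * E M) := by
    classical
    intro s
    induction s using Finset.induction_on with
    | empty => rw [Finset.sum_empty]; exact IsDiffOp.zero n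
    | insert M s hM ih =>
      rw [Finset.sum_insert hM]
      refine IsDiffOp.add ?_ ih
      have := (IsDiffOp.mulLeft (R := R) (c.coeffs E M P)).mul (hE' M)
      rwa [zero_add] at this
  have hneg : IsDiffOp R n ((-1 : ℤ) • P) := hP.smul _
  have h := isDiffOp_eq_zero (c := c) K ((hsum Finset.univ).add hneg) fun B hB ↦ ?_
  · rw [neg_one_smul, ← sub_eq_add_neg, sub_eq_zero] at h
    exact h
  · rw [neg_one_smul, ← sub_eq_add_neg, LinearMap.sub_apply, sub_eq_zero]
    have h1 := congrArg (fun G : Matrix _ _ A ↦ G.mulVec (fun B ↦ P (c.varProd B.1)) ⟨B, hB⟩)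
      (Matrix.mul_nonsing_inv _ (c.isUnit_det_valueMatrix E K hE))
    simp only [← Matrix.mulVec_mulVec, Matrix.one_mulVec] at h1
    rw [← h1, LinearMap.sum_apply]
    simp only [Matrix.mulVec, dotProduct]
    refine Finset.sum_congr rfl fun M _ ↦ ?_
    rw [Module.End.mul_apply, LinearMap.mulLeft_apply, mul_comm]
    rfl

theorem eq_zero_of_sum_eq_zero (K : Type*) [Field K] [CharZero K] [Algebra K R]
    (hE : ∀ M φ, c.equiv (E M φ) 0 = c.equiv φ M.1) {f : BddMon ι n → A}
    (h : ∑ M, LinearMap.mulLeft R (f M) * E M = 0) : f = 0 := by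
  have h1 : (c.valueMatrix E).mulVec f = 0 := by
    funext B
    have := LinearMap.congr_fun h (c.varProd B.1)
    rw [LinearMap.sum_apply] at this
    simp only [Matrix.mulVec, dotProduct]
    rw [Pi.zero_apply, ← LinearMap.zero_apply (σ₁₂ := RingHom.id R) (M₂ := A) (c.varProd B.1), ← this]
    refine Finset.sum_congr rfl fun M _ ↦ ?_
    rw [Module.End.mul_apply, LinearMap.mulLeft_apply, mul_comm]
    rfl
  have h2 := congrArg (fun v ↦ (c.valueMatrix E)⁻¹.mulVec v) h1
  simpa [Matrix.mulVec_mulVec, Matrix.nonsing_inv_mul _ (c.isUnit_det_valueMatrix E K hE)] using h2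

end Coord

end LieRinehart

/-! ### Coordinates on jets along a frame. -/

namespace LieRinehart

namespace Coord

/-- Transport of coordinates along an isomorphism of algebras. -/
def congr {ι R A B : Type*} [CommRing R] [CommRing A] [Algebra R A] [CommRing B] [Algebra R B]
    (c : Coord ι R A) (g : B ≃ₐ[R] A) : Coord ι R B where
  equiv := g.toLinearEquiv.trans c.equiv
  one_zero := by simp [c.one_zero]
  one_ne M hM := by simp [c.one_ne M hM]
  mul φ ψ M := by simp [c.mul]

end Coord

section

variable {K R L ι : Type*} [CommRing K] [CommRing R] [Algebra K R] [LieRing L] [LieAlgebra K L]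
  [Module R L] [LieRingModule L R] [LieRinehartRing R L] [LieRinehartAlgebra K R L]
  [LinearOrder ι] [Fintype ι] (b : Module.Basis ι R L)

namespace PBW

theorem monomial_induction {p : Multiset ι → Prop} (zero : p 0)
    (cons : ∀ (j : ι) (N : Multiset ι), (∀ k ∈ N, j ≤ k) → p N → p (j ::ₘ N)) (M : Multiset ι) :
    p M := by
  induction h : M.card generalizing M with
  | zero => rwa [Multiset.card_eq_zero.mp h]
  | succ n ih =>
    obtain ⟨j, N, rfl, hN⟩ := exists_min_cons (M := M) (by rintro rfl; simp at h)
    exact cons j N hN (ih N (by simpa using h))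

theorem counit_ordMon {M : Multiset ι} (h : M ≠ 0) : Env.counit K R L (ordMon K b M) = 0 := by
  induction M using monomial_induction with
  | zero => exact absurd rfl h
  | cons j N hN ih =>
    rw [ordMon_cons b hN, Env.counit_vec_mul]
    by_cases h0 : N = 0
    · rw [h0, ordMon_zero, Env.counit_one, Env.lie_one]
    · rw [ih h0, lie_zero]

/-- The Leibniz rule for the connection along `b j` computes the value at `b j` times a monomial
from values at that monomial. As `j` is a lower bound of `N`, it is one of both parts of every
splitting of `N`, so adjoining `b j` to either part gives an ordered monomial again. -/
theorem mul_ordMon (φ ψ : Jet K R L) (M : Multiset ι) : (φ * ψ) (ordMon K b M) =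
    ((Multiset.antidiagonal M).map fun p ↦ φ (ordMon K b p.1) * ψ (ordMon K b p.2)).sum := by
  induction M using monomial_induction generalizing φ ψ with
  | zero => simp [ordMon_zero, Jet.mul_apply_one]
  | cons j N hN ih =>
    have h1 := Jet.conn_apply (b j) (φ * ψ) (ordMon K b N)
    rw [Jet.conn_mul, Jet.add_apply, ih, ih, ih, ← LieModule.toEnd_apply_apply K L R,
      map_multiset_sum, Multiset.map_map] at h1
    have h2 : (φ * ψ) (ordMon K b (j ::ₘ N)) =
        ((Multiset.antidiagonal N).map ((LieModule.toEnd K L R (b j)) ∘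
          fun p ↦ φ (ordMon K b p.1) * ψ (ordMon K b p.2))).sum -
        (((Multiset.antidiagonal N).map fun p ↦
            Jet.conn (b j) φ (ordMon K b p.1) * ψ (ordMon K b p.2)).sum +
          ((Multiset.antidiagonal N).map fun p ↦
            φ (ordMon K b p.1) * Jet.conn (b j) ψ (ordMon K b p.2)).sum) := by
      rw [h1, ordMon_cons b hN]
      abel
    rw [h2, ← Multiset.sum_map_add, ← Multiset.sum_map_sub, Multiset.antidiagonal_cons,
      Multiset.map_add, Multiset.sum_add, Multiset.map_map, Multiset.map_map,
      ← Multiset.sum_map_add]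
    refine congrArg Multiset.sum (Multiset.map_congr rfl fun p hp ↦ ?_)
    rw [Multiset.mem_antidiagonal] at hp
    have hp1 : ∀ k ∈ p.1, j ≤ k := fun k hk ↦ hN k (by rw [← hp]; exact Multiset.mem_add.mpr (.inl hk))
    have hp2 : ∀ k ∈ p.2, j ≤ k := fun k hk ↦ hN k (by rw [← hp]; exact Multiset.mem_add.mpr (.inr hk))
    simp only [Function.comp_apply, LieModule.toEnd_apply_apply,
      LieRinehartRing.leibniz_mul_right, Jet.conn_apply, Prod.map_fst, Prod.map_snd, id_eq,
      ordMon_cons b hp1, ordMon_cons b hp2, smul_eq_mul]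
    ring

variable (K) in
/-- The coefficients of a jet with respect to the ordered monomials in a basis of `L`. -/
noncomputable def coord : Coord ι R (Jet K R L) where
  equiv :=
    { toFun := fun φ M ↦ φ (ordMon K b M)
      map_add' := fun _ _ ↦ rfl
      map_smul' := fun _ _ ↦ rfl
      invFun := fun f ↦ show Env K R L →ₗ[R] R from (basis K b).constr R f
      left_inv := fun φ ↦ by
        refine (basis K b).ext fun M ↦ ?_
        rw [Module.Basis.constr_basis, basis_apply]
        rfl
      right_inv := fun f ↦ funext fun M ↦ by
        have h := (basis K b).constr_basis R f M
        rwa [basis_apply] at h }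
  one_zero := by
    change Env.counit K R L (ordMon K b 0) = 1
    rw [ordMon_zero, Env.counit_one]
  one_ne M hM := counit_ordMon b hM
  mul φ ψ M := mul_ordMon b φ ψ M

theorem coord_apply (φ : Jet K R L) (M : Multiset ι) :
    (coord K b).equiv φ M = φ (ordMon K b M) := rfl

/-- Reordering `b i` times an ordered monomial changes it only by monomials of degree at most
`M.card`, on which `φ` vanishes; so does the term in which `b i` differentiates a coefficient. Thus
`b i` acts as the negative of a partial derivative to leading order. -/
theorem coord_conn {φ : Jet K R L} {i : ι} {M : Multiset ι} {k : ℕ}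
    (hφ : φ ∈ (coord K b).ideal k) (hM : M.card < k) :
    (coord K b).equiv (Jet.conn (b i) φ) M = -(coord K b).equiv φ (i ::ₘ M) := by
  have hφ' : ∀ N : Multiset ι, N.card < k → φ (ordMon K b N) = 0 := fun N hN ↦ by
    rw [← coord_apply]
    exact hφ N hN
  have h : φ (Env.vec K (b i) * ordMon K b M - ordMon K b (i ::ₘ M)) = 0 := by
    have h := vec_mul_ordMon_sub_mem (K := K) b i M
    generalize Env.vec K (b i) * ordMon K b M - ordMon K b (i ::ₘ M) = D at h
    induction h using Submodule.span_induction with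
    | mem s hs =>
      obtain ⟨N, hN, rfl⟩ := hs
      exact hφ' N (lt_of_le_of_lt hN hM)
    | zero => exact map_zero φ
    | add s t _ _ hs ht => rw [map_add, hs, ht, add_zero]
    | smul a s _ hs => rw [map_smul, hs, smul_zero]
  rw [map_sub, sub_eq_zero] at h
  rw [coord_apply, coord_apply, Jet.conn_apply, hφ' M hM, lie_zero, zero_sub, h]

end PBW

section

variable {R' L' : Type*} [CommRing R'] [Algebra K R'] {σ : R →ₐ[K] R'} [LieRing L']
  [LieAlgebra K L'] [Module R' L'] [LieRingModule L' R'] [LieRinehartRing R' L']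
  [LieRinehartAlgebra K R' L'] {b} {b' : Module.Basis ι R' L'}

theorem PBW.map_ordMon {f : LieRinehartAlgebra.Hom σ L L'} (hb : ∀ i, b' i = f (b i))
    (M : Multiset ι) : Env.map f (ordMon K b M) = ordMon K b' M := by
  rw [ordMon, ordMon, map_list_prod, List.map_map]
  congr 2
  funext i
  rw [Function.comp_apply, Env.map_vec, hb]

theorem Env.map_smul (f : LieRinehartAlgebra.Hom σ L L') (a : R) (D : Env K R L) :
    Env.map f (a • D) = σ a • Env.map f D := by
  rw [Env.smul_def, map_mul, Env.map_fn, Env.smul_def]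

theorem Jet.Compat.of_ordMon {f : LieRinehartAlgebra.Hom σ L L'} {φ : Jet K R L}
    {φ' : Jet K R' L'} (h : ∀ M, σ (φ (PBW.ordMon K b M)) = φ' (Env.map f (PBW.ordMon K b M))) :
    Jet.Compat f φ φ' := by
  intro D
  have hD := (PBW.basis K b).mem_span D
  induction hD using Submodule.span_induction with
  | mem s hs =>
    obtain ⟨M, rfl⟩ := hs
    rw [PBW.basis_apply]
    exact h M
  | zero => simp
  | add s t _ _ hs ht => simp only [map_add, hs, ht]
  | smul a s _ hs =>
    rw [map_smul, smul_eq_mul, map_mul, hs, Env.map_smul, map_smul, smul_eq_mul]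

end

end

namespace LieAlgebroid

variable {K : Type u} [Field K] {X : TopCat.{u}} {𝒪 : TopCat.Sheaf (CommAlgCat.{u} K) X}
  (𝓛 : LieAlgebroid 𝒪)

/-- A frame of a Lie algebroid over an open subset: sections whose restrictions to smaller open
subsets form bases. -/
structure Frame (ι : Type*) (U : Opens X) where
  /-- The basis over a smaller open subset. -/
  basis : ∀ V : Opens X, V ≤ U → Module.Basis ι (Fn 𝒪 V) (𝓛.sec V)
  res_basis : ∀ (V W : Opens X) (hV : V ≤ U) (h : W ≤ V) (i : ι),
    basis W (h.trans hV) i = 𝓛.res h (basis V hV i)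

variable {𝓛}

theorem IsLocallyFreeOfRank.exists_frame {r : ℕ} (h : 𝓛.IsLocallyFreeOfRank r) (x : X) :
    ∃ U : Opens X, x ∈ U ∧ Nonempty (Frame 𝓛 (Fin r) U) := by
  obtain ⟨U, hx, e, he⟩ := h x
  choose b hb using he
  refine ⟨U, hx, ⟨⟨b, fun V W hV h i ↦ ?_⟩⟩⟩
  rw [hb, hb, 𝓛.res_trans]

namespace Frame

variable {ι : Type*} {U : Opens X} (F : Frame 𝓛 ι U)

/-- The restriction of a frame. -/
def restrict {V : Opens X} (h : V ≤ U) : Frame 𝓛 ι V where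
  basis W hW := F.basis W (hW.trans h)
  res_basis _ _ hW h' i := F.res_basis _ _ (hW.trans h) h' i

/-- The basis over the whole open subset. -/
def top : Module.Basis ι (Fn 𝒪 U) (𝓛.sec U) := F.basis U le_rfl

variable [LinearOrder ι] [Fintype ι]

theorem envRes_ordMon {V W : Opens X} (hV : V ≤ U) (h : W ≤ V) (M : Multiset ι) :
    𝓛.envRes h (PBW.ordMon K (F.basis V hV) M) = PBW.ordMon K (F.basis W (h.trans hV)) M :=
  PBW.map_ordMon (F.res_basis V W hV h) M

end Frame

/-- The component of a jet on the whole open subset. -/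
def JetSec.onTop (U : Opens X) : 𝓛.JetSec U →ₐ[Fn 𝒪 U] Jet K (Fn 𝒪 U) (𝓛.sec U) where
  toFun φ := φ.on U le_rfl
  map_one' := rfl
  map_mul' _ _ := rfl
  map_zero' := rfl
  map_add' _ _ := rfl
  commutes' a := by
    change algebraMap _ _ (Fn.res 𝒪 le_rfl a) = _
    rw [Fn.res_refl]

namespace Frame

variable {ι : Type*} {U : Opens X} [LinearOrder ι] [Fintype ι]

/-- Ordered monomials in a frame restrict to ordered monomials, so the coefficients over a smaller
open subset are the restrictions of those over `U`, which are arbitrary. -/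
theorem onTop_bijective (F : Frame 𝓛 ι U) : Function.Bijective (JetSec.onTop (𝓛 := 𝓛) U) := by
  constructor
  · intro φ ψ h
    refine JetSec.ext fun V hV ↦ ?_
    apply (PBW.coord K (F.basis V hV)).equiv.injective
    funext M
    rw [PBW.coord_apply, PBW.coord_apply, ← F.envRes_ordMon le_rfl hV]
    refine ((φ.compat le_rfl hV _).symm.trans ?_).trans (ψ.compat le_rfl hV _)
    exact congrArg (fun χ : Jet K (Fn 𝒪 U) (𝓛.sec U) ↦ Fn.res 𝒪 hV (χ _)) h
  · intro φ
    refine ⟨JetSec.mk (fun V hV ↦ (PBW.coord K (F.basis V hV)).equiv.symm fun M ↦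
      Fn.res 𝒪 hV (φ (PBW.ordMon K (F.basis U le_rfl) M))) fun V W hV h ↦ ?_, ?_⟩
    · refine Jet.Compat.of_ordMon (b := F.basis V hV) fun M ↦ ?_
      have := F.envRes_ordMon hV h M
      rw [envRes] at this
      rw [this, ← PBW.coord_apply, ← PBW.coord_apply, LinearEquiv.apply_symm_apply,
        LinearEquiv.apply_symm_apply, Fn.res_trans]
    · apply (PBW.coord K (F.basis U le_rfl)).equiv.injective
      funext M
      change (PBW.coord K (F.basis U le_rfl)).equiv ((PBW.coord K (F.basis U le_rfl)).equiv.symm _) M = _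
      rw [LinearEquiv.apply_symm_apply, PBW.coord_apply, Fn.res_refl]

variable (F : Frame 𝓛 ι U)

/-- Jets over an open subset with a frame are the jets of the Lie–Rinehart algebra of sections. -/
noncomputable def jetEquiv : 𝓛.JetSec U ≃ₐ[Fn 𝒪 U] Jet K (Fn 𝒪 U) (𝓛.sec U) :=
  AlgEquiv.ofBijective (JetSec.onTop U) F.onTop_bijective

/-- The coefficients of jets with respect to a frame. -/
noncomputable def coord : Coord ι (Fn 𝒪 U) (𝓛.JetSec U) := (PBW.coord K F.top).congr F.jetEquiv

theorem coord_apply (φ : 𝓛.JetSec U) (M : Multiset ι) :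
    F.coord.equiv φ M = φ.on U le_rfl (PBW.ordMon K F.top M) := PBW.coord_apply _ _ _

theorem coord_conn {φ : 𝓛.JetSec U} {i : ι} {M : Multiset ι} {k : ℕ}
    (hφ : φ ∈ F.coord.ideal k) (hM : M.card < k) :
    F.coord.equiv (jetConn U (F.top i) φ) M = -F.coord.equiv φ (i ::ₘ M) := by
  rw [coord_apply, jetConn_on, 𝓛.res_refl, ← PBW.coord_apply]
  exact PBW.coord_conn F.top hφ hM

/-- This is the hypothesis `hE` of `Coord.sum_coeffs` for the second action: evaluation at the
origin is evaluation at `1`. -/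
theorem coord_actTwo (φ : 𝓛.JetSec U) (M : Multiset ι) :
    F.coord.equiv (jetActTwo U (PBW.ordMon K F.top M) φ) 0 = F.coord.equiv φ M := by
  rw [coord_apply, coord_apply, jetActTwo_on, Jet.actTwo_apply, PBW.ordMon_zero, one_mul,
    envRes_refl]

theorem coord_res {V : Opens X} (h : V ≤ U) (φ : 𝓛.JetSec U) (M : Multiset ι) :
    (F.restrict h).coord.equiv (jetRes h φ) M = Fn.res 𝒪 h (F.coord.equiv φ M) := by
  rw [coord_apply, coord_apply, jetRes_on, φ.compat le_rfl h]
  exact congrArg (φ.on V _) (F.envRes_ordMon le_rfl h M).symm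

theorem jetRes_var {V : Opens X} (h : V ≤ U) (i : ι) :
    jetRes h (F.coord.var i) = (F.restrict h).coord.var i := by
  apply (F.restrict h).coord.equiv.injective
  funext M
  rw [coord_res, Coord.equiv_var, Coord.equiv_var]
  split_ifs <;> simp

theorem jetRes_varProd {V : Opens X} (h : V ≤ U) (B : Multiset ι) :
    jetRes h (F.coord.varProd B) = (F.restrict h).coord.varProd B := by
  induction B using Multiset.induction_on with
  | empty => simp [Coord.varProd_zero]
  | cons i B ih => rw [Coord.varProd_cons, Coord.varProd_cons, map_mul, ih, jetRes_var]

end Frame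

theorem isDiffOp_actTwo_ordMon {ι : Type*} [LinearOrder ι] [Fintype ι] {U : Opens X}
    (b : Module.Basis ι (Fn 𝒪 U) (𝓛.sec U)) (M : Multiset ι) :
    IsDiffOp (Fn 𝒪 U) M.card (jetActTwo U (PBW.ordMon K b M)) := by
  induction M using PBW.monomial_induction with
  | zero =>
    rw [PBW.ordMon_zero, map_one]
    have h := IsDiffOp.mulLeft (R := Fn 𝒪 U) (1 : 𝓛.JetSec U)
    rwa [LinearMap.mulLeft_one] at h
  | cons j N hN ih =>
    rw [PBW.ordMon_cons b hN, map_mul, Multiset.card_cons, add_comm]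
    exact (isDiffOp_vec (b j)).mul ih

end LieAlgebroid

end LieRinehart

/-! ### The formal Poincaré lemma. -/

namespace LieRinehart

theorem alternatingMap_sum_apply {R M N ι κ : Type*} [CommRing R] [AddCommGroup M] [Module R M]
    [AddCommGroup N] [Module R N] (s : Finset κ) (f : κ → M [⋀^ι]→ₗ[R] N) (v : ι → M) :
    (∑ k ∈ s, f k) v = ∑ k ∈ s, f k v :=
  map_sum (AddMonoidHom.mk' (fun f : M [⋀^ι]→ₗ[R] N ↦ f v) fun _ _ ↦ rfl) f s

section Koszul

variable {K R L M N : Type*} [Field K] [CharZero K] [CommRing R] [Algebra K R]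
  [LieRing L] [LieAlgebra K L] [Module R L] [LieRingModule L R] [LieRinehartRing R L]
  [LieRinehartAlgebra K R L] [AddCommGroup M] [Module K M] [Module R M] [IsScalarTower K R M]
  [AddCommGroup N] [Module K N] [Module R N] [IsScalarTower K R N]

theorem koszulFun_add (D : L →ₗ[R] Module.End K M) {p : ℕ} (ω η : L [⋀^Fin p]→ₗ[R] M)
    (v : Fin (p + 1) → L) : koszulFun D (ω + η) v = koszulFun D ω v + koszulFun D η v := by
  cases p <;>
  simp only [AlternatingMap.add_apply, koszulFun, bracketSum, map_add, smul_add,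
    Finset.sum_add_distrib, add_zero]
  abel

theorem koszulFun_smul (D : L →ₗ[R] Module.End K M) {p : ℕ} (a : K) (ω : L [⋀^Fin p]→ₗ[R] M)
    (v : Fin (p + 1) → L) : koszulFun D (a • ω) v = a • koszulFun D ω v := by
  cases p <;>
  simp only [AlternatingMap.smul_apply, koszulFun, bracketSum, map_smul, smul_add,
    Finset.smul_sum, smul_zero, smul_comm _ a]

/-- The Chevalley–Eilenberg differential as a linear map. -/
def koszulHom (D : L →ₗ[R] Module.End K M)
    (hD : ∀ (x : L) (a : R) (m : M), D x (a • m) = a • D x m + ⁅x, a⁆ • m) (p : ℕ) :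
    L [⋀^Fin p]→ₗ[R] M →ₗ[K] L [⋀^Fin (p + 1)]→ₗ[R] M where
  toFun := koszul D hD
  map_add' ω η := AlternatingMap.ext fun v ↦ koszulFun_add D ω η v
  map_smul' a ω := AlternatingMap.ext fun v ↦ koszulFun_smul D a ω v

theorem koszulHom_apply (D : L →ₗ[R] Module.End K M)
    (hD : ∀ (x : L) (a : R) (m : M), D x (a • m) = a • D x m + ⁅x, a⁆ • m) {p : ℕ}
    (ω : L [⋀^Fin p]→ₗ[R] M) (v : Fin (p + 1) → L) : koszulHom D hD p ω v = koszulFun D ω v := rfl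

theorem bracketSum_comp (g : M →ₗ[R] N) {p : ℕ} (ω : L [⋀^Fin p]→ₗ[R] M) (v : Fin (p + 1) → L) :
    bracketSum (g.compAlternatingMap ω) v = g (bracketSum ω v) := by
  cases p with
  | zero => exact (map_zero g).symm
  | succ p => simp only [bracketSum, LinearMap.compAlternatingMap_apply, map_sum, map_zsmul]

theorem koszulFun_comp (D : L →ₗ[R] Module.End K M) (D' : L →ₗ[R] Module.End K N) (g : M →ₗ[R] N)
    (hg : ∀ x m, D' x (g m) = g (D x m)) {p : ℕ} (ω : L [⋀^Fin p]→ₗ[R] M) (v : Fin (p + 1) → L) :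
    koszulFun D' (g.compAlternatingMap ω) v = g (koszulFun D ω v) := by
  rw [koszulFun, koszulFun, bracketSum_comp, map_add, map_sum]
  simp only [LinearMap.compAlternatingMap_apply, map_zsmul, hg]

theorem koszulFun_mem (D : L →ₗ[R] Module.End K M) {I J : Submodule R M} (hIJ : I ≤ J)
    (hD : ∀ x, ∀ m ∈ I, D x m ∈ J) {p : ℕ} {ω : L [⋀^Fin p]→ₗ[R] M} (hω : ∀ v, ω v ∈ I)
    (v : Fin (p + 1) → L) : koszulFun D ω v ∈ J := by
  refine add_mem (sum_mem fun i _ ↦ zsmul_mem (hD _ _ (hω _)) _) ?_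
  cases p with
  | zero => exact zero_mem _
  | succ p => exact sum_mem fun i _ ↦ sum_mem fun j _ ↦ zsmul_mem (hIJ (hω _)) _

end Koszul

namespace Coord

variable {K R L ι A : Type*} [Field K] [CharZero K] [CommRing R] [Algebra K R]
  [LieRing L] [LieAlgebra K L] [Module R L] [LieRingModule L R] [LieRinehartRing R L]
  [LieRinehartAlgebra K R L] [CommRing A] [Algebra R A] [Algebra K A] [IsScalarTower K R A]
  [DecidableEq ι] [Fintype ι] (c : Coord ι R A) (b : Module.Basis ι R L)
  (D : L →ₗ[R] Module.End K A)

/-- A connection on an algebra with coordinates is a coordinate connection if, to leading order, the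
elements of the basis of `L` act as the negatives of the partial derivatives. -/
def IsCoordConn : Prop := ∀ (k : ℕ), ∀ φ ∈ c.ideal k, ∀ (i : ι) (M : Multiset ι), M.card < k →
  c.equiv (D (b i) φ) M = -c.equiv φ (i ::ₘ M)

/-- The contraction of a form with the radial vector field. -/
noncomputable def radial {p : ℕ} (ω : L [⋀^Fin (p + 1)]→ₗ[R] A) : L [⋀^Fin p]→ₗ[R] A :=
  ∑ i, (LinearMap.mulLeft R (c.var i)).compAlternatingMap (ω.curryLeft (b i))

theorem radial_apply {p : ℕ} (ω : L [⋀^Fin (p + 1)]→ₗ[R] A) (v : Fin p → L) :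
    c.radial b ω v = ∑ i, c.var i * ω (Matrix.vecCons (b i) v) := by
  simp [radial, alternatingMap_sum_apply]

variable {c b D}

theorem radial_mem {p k : ℕ} {ω : L [⋀^Fin (p + 1)]→ₗ[R] A} (hω : ∀ v, ω v ∈ c.ideal k)
    (v : Fin p → L) : c.radial b ω v ∈ c.ideal (k + 1) := by
  rw [radial_apply, add_comm]
  exact sum_mem fun i _ ↦ mul_mem_ideal (var_mem i) (hω _)

theorem conn_eq_sum (D : L →ₗ[R] Module.End K A) (x : L) (φ : A) :
    D x φ = ∑ i, b.repr x i • D (b i) φ := by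
  have h := congrArg (fun x ↦ D x φ) (b.sum_repr x)
  simp only [map_sum, map_smul] at h
  rw [← h, LinearMap.sum_apply]
  rfl

theorem IsCoordConn.conn_mem (hlead : c.IsCoordConn b D) {k : ℕ} (x : L) {φ : A}
    (hφ : φ ∈ c.ideal (k + 1)) : D x φ ∈ c.ideal k := by
  rw [conn_eq_sum (b := b)]
  refine sum_mem fun i _ ↦ Submodule.smul_mem _ _ fun M hM ↦ ?_
  rw [hlead (k + 1) φ hφ i M (by omega), hφ _ (by rw [Multiset.card_cons]; omega), neg_zero]

/-- At the origin the derivative of the `i`-th coordinate along `b j` is `-1` for `i = j` and `0`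
otherwise. -/
theorem IsCoordConn.conn_var (hlead : c.IsCoordConn b D) (x : L) (i : ι) :
    D x (c.var i) + algebraMap R A (b.repr x i) ∈ c.ideal 1 := by
  rw [mem_ideal_one, map_add, evalZero_apply, evalZero_apply, conn_eq_sum (b := b), map_sum,
    Finset.sum_apply, Algebra.algebraMap_eq_smul_one, map_smul, Pi.smul_apply, c.one_zero]
  have h : ∀ j, c.equiv (b.repr x j • D (b j) (c.var i)) 0 =
      if i = j then -b.repr x i else 0 := by
    intro j
    rw [map_smul, Pi.smul_apply, hlead 1 _ (var_mem i) j 0 (by simp), equiv_var,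
      Multiset.cons_zero]
    by_cases hij : i = j
    · simp [hij]
    · have : ({j} : Multiset ι) ≠ {i} := fun h ↦ hij (Multiset.singleton_inj.mp h).symm
      simp [hij, this]
  simp only [h, Finset.sum_ite_eq, Finset.mem_univ, if_true, smul_eq_mul, mul_one, neg_add_cancel]

/-- Euler's identity: `-∑ xᵢ ∂ᵢ` acts as `-k` on the leading part, of degree `k`. -/
theorem IsCoordConn.radial_conn (hlead : c.IsCoordConn b D) {k : ℕ} {φ : A}
    (hφ : φ ∈ c.ideal k) : ∑ i, c.var i * D (b i) φ + (k : K) • φ ∈ c.ideal (k + 1) := by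
  intro M hM
  have h : ∀ i, c.equiv (c.var i * D (b i) φ) M = (M.count i : R) * -c.equiv φ M := by
    intro i
    rw [equiv_var_mul]
    by_cases hi : i ∈ M
    · have := Multiset.card_erase_add_one hi
      rw [hlead k φ hφ i _ (by omega), Multiset.cons_erase hi]
    · simp [Multiset.count_eq_zero_of_notMem hi]
  rw [map_add, map_sum, Pi.add_apply, Finset.sum_apply, ← algebraMap_smul R (k : K) φ, map_smul,
    Pi.smul_apply, Finset.sum_congr rfl fun i _ ↦ h i, ← Finset.sum_mul, ← Nat.cast_sum,
    Multiset.sum_count_eq_card (fun _ _ ↦ Finset.mem_univ _), map_natCast, smul_eq_mul]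
  rcases Nat.lt_succ_iff_lt_or_eq.mp hM with h | h
  · rw [hφ M h]; simp
  · rw [h]; ring

theorem koszulFun_mul (hmul : ∀ x φ ψ, D x (φ * ψ) = D x φ * ψ + φ * D x ψ) (a : A) {p : ℕ}
    (θ : L [⋀^Fin p]→ₗ[R] A) (w : Fin (p + 1) → L) :
    koszulFun D ((LinearMap.mulLeft R a).compAlternatingMap θ) w =
      ∑ j : Fin (p + 1), (-1 : ℤ) ^ (j : ℕ) • (D (w j) a * θ (j.removeNth w)) +
        a * koszulFun D θ w := by
  rw [koszulFun, koszulFun, bracketSum_comp, mul_add, Finset.mul_sum, ← add_assoc,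
    ← Finset.sum_add_distrib]
  simp only [LinearMap.compAlternatingMap_apply, LinearMap.mulLeft_apply, hmul, smul_add,
    mul_smul_comm]

theorem koszulFun_sum {p : ℕ} (s : Finset ι) (θ : ι → L [⋀^Fin p]→ₗ[R] A)
    (hD : ∀ (x : L) (a : R) (m : A), D x (a • m) = a • D x m + ⁅x, a⁆ • m) (w : Fin (p + 1) → L) :
    koszulFun D (∑ i ∈ s, θ i) w = ∑ i ∈ s, koszulFun D (θ i) w := by
  have := congrArg (fun f ↦ f w) (map_sum (koszulHom D hD p) θ s)
  simpa only [alternatingMap_sum_apply, koszulHom_apply] using this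

/-- For closed `ω` the differential of the radial contraction is the Lie derivative along the Euler
field. With the sign convention of a coordinate connection its leading part is `-(p + 1 + k) ω`: the
form degree is `p + 1` and the coefficients vanish to order `k`. -/
theorem IsCoordConn.koszul_radial (hlead : c.IsCoordConn b D)
    (hD : ∀ (x : L) (a : R) (m : A), D x (a • m) = a • D x m + ⁅x, a⁆ • m)
    (hmul : ∀ x φ ψ, D x (φ * ψ) = D x φ * ψ + φ * D x ψ) {p k : ℕ}
    {ω : L [⋀^Fin (p + 1)]→ₗ[R] A} (hω : koszul D hD ω = 0) (hk : ∀ v, ω v ∈ c.ideal k)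
    (w : Fin (p + 1) → L) :
    koszulFun D (c.radial b ω) w + ((p + 1 + k : ℕ) : K) • ω w ∈ c.ideal (k + 1) := by
  have hcl : ∀ x, koszulFun D (ω.curryLeft x) w =
      D x (ω w) - ∑ l, ω (Function.update w l ⁅x, w l⁆) := by
    intro x
    have h1 : koszulFun D ω (Fin.cons x w : Fin (p + 2) → L) = 0 :=
      congrArg (fun f ↦ f (Fin.cons x w : Fin (p + 2) → L)) hω
    rw [koszulFun_cons, sub_eq_zero] at h1
    exact h1.symm
  -- Each of the three groups on the right vanishes to order `k + 1`: by `conn_var`, by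
  -- `radial_conn`, and because the bracket terms carry a factor `xᵢ`.
  have hdec : koszulFun D (c.radial b ω) w + ((p + 1 + k : ℕ) : K) • ω w =
      ∑ i, ∑ j : Fin (p + 1), (-1 : ℤ) ^ (j : ℕ) •
        ((D (w j) (c.var i) + algebraMap R A (b.repr (w j) i)) *
          ω (Matrix.vecCons (b i) (j.removeNth w))) +
      (∑ i, c.var i * D (b i) (ω w) + (k : K) • ω w) -
      ∑ i, c.var i * ∑ l, ω (Function.update w l ⁅b i, w l⁆) := by
    -- Summing over `i` reassembles `w j` in front; moving it back to place `j` absorbs the sign, so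
    -- each of the `p + 1` places contributes `ω w`.
    have hsum : ∑ i, ∑ j : Fin (p + 1), (-1 : ℤ) ^ (j : ℕ) •
        (algebraMap R A (b.repr (w j) i) * ω (Matrix.vecCons (b i) (j.removeNth w))) =
        ((p + 1 : ℕ) : K) • ω w := by
      rw [Finset.sum_comm]
      have h2 : ∀ j : Fin (p + 1), ∑ i, (-1 : ℤ) ^ (j : ℕ) •
          (algebraMap R A (b.repr (w j) i) * ω (Matrix.vecCons (b i) (j.removeNth w))) = ω w := by
        intro j
        have h3 : ω (Matrix.vecCons (w j) (j.removeNth w)) =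
            ∑ i, algebraMap R A (b.repr (w j) i) * ω (Matrix.vecCons (b i) (j.removeNth w)) := by
          have h4 := congrArg (fun x ↦ ω.curryLeft x (j.removeNth w)) (b.sum_repr (w j))
          simp only [map_sum, map_smul, alternatingMap_sum_apply, AlternatingMap.smul_apply,
            AlternatingMap.curryLeft_apply_apply] at h4
          rw [← h4]
          simp only [Algebra.smul_def]
        rw [← Finset.smul_sum, ← h3, ← AlternatingMap.map_insertNth, Fin.insertNth_self_removeNth]
      simp only [h2, Finset.sum_const, Finset.card_univ, Fintype.card_fin, Nat.cast_smul_eq_nsmul]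
    rw [radial, koszulFun_sum _ _ hD]
    simp only [koszulFun_mul hmul, hcl, add_mul, smul_add, Finset.sum_add_distrib, hsum, mul_sub,
      Finset.sum_sub_distrib, AlternatingMap.curryLeft_apply_apply, Nat.cast_add (p + 1) k,
      add_smul]
    abel
  rw [hdec]
  refine sub_mem (add_mem (sum_mem fun i _ ↦ sum_mem fun j _ ↦ zsmul_mem ?_ _)
    (hlead.radial_conn (hk w))) (sum_mem fun i _ ↦ ?_)
  · rw [add_comm k]
    exact mul_mem_ideal (hlead.conn_var _ i) (hk _)
  · rw [add_comm k]
    exact mul_mem_ideal (var_mem i) (sum_mem fun l _ ↦ hk _)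

variable (c b D) in
/-- The successive remainders in the construction of a primitive of a closed form. -/
noncomputable def remainder
    (hD : ∀ (x : L) (a : R) (m : A), D x (a • m) = a • D x m + ⁅x, a⁆ • m) {p : ℕ}
    (ω : L [⋀^Fin (p + 1)]→ₗ[R] A) : ℕ → L [⋀^Fin (p + 1)]→ₗ[R] A
  | 0 => ω
  | k + 1 => remainder hD ω k +
      ((p + 1 + k : ℕ) : K)⁻¹ • koszulHom D hD p (c.radial b (remainder hD ω k))

/-- The Poincaré lemma: closed forms of positive degree with values in an algebra with coordinates
are exact. -/
theorem IsCoordConn.exists_primitive (hlead : c.IsCoordConn b D)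
    (hD : ∀ (x : L) (a : R) (m : A), D x (a • m) = a • D x m + ⁅x, a⁆ • m)
    (hmul : ∀ x φ ψ, D x (φ * ψ) = D x φ * ψ + φ * D x ψ)
    (hflat : ∀ x y m, D ⁅x, y⁆ m = D x (D y m) - D y (D x m)) {p : ℕ}
    {ω : L [⋀^Fin (p + 1)]→ₗ[R] A} (hω : koszul D hD ω = 0) :
    ∃ η : L [⋀^Fin p]→ₗ[R] A, koszul D hD η = ω := by
  -- The remainder `ρ k` stays closed, differs from `ω` by an exact form, and vanishes to order `k`.
  let ρ := c.remainder b D hD ω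
  have hρ : ∀ k, ρ (k + 1) = ρ k + ((p + 1 + k : ℕ) : K)⁻¹ • koszulHom D hD p (c.radial b (ρ k)) :=
    fun _ ↦ rfl
  have hcl : ∀ k, koszulHom D hD (p + 1) (ρ k) = 0 := by
    intro k
    induction k with
    | zero => exact hω
    | succ k ih =>
      have h := koszul_koszul D hD hflat (c.radial b (ρ k))
      rw [hρ, map_add, ih, map_smul, zero_add]
      exact (congrArg _ h).trans (smul_zero _)
  have hmem : ∀ k v, ρ k v ∈ c.ideal k := by
    intro k
    induction k with
    | zero => exact fun v ↦ mem_ideal_zero _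
    | succ k ih =>
      intro v
      have h := hlead.koszul_radial hD hmul (hcl k) ih v
      have hne : ((p + 1 + k : ℕ) : K) ≠ 0 := Nat.cast_ne_zero.mpr (by omega)
      have h2 := Submodule.smul_mem _ (algebraMap K R ((p + 1 + k : ℕ) : K)⁻¹) h
      rw [algebraMap_smul, smul_add, smul_smul, inv_mul_cancel₀ hne, one_smul] at h2
      rw [hρ, AlternatingMap.add_apply, add_comm (ρ k v)]
      exact h2
  -- The `k`-th correction to the primitive, so that `d (θ k) = ρ k - ρ (k + 1)`.
  let θ : ℕ → L [⋀^Fin p]→ₗ[R] A := fun k ↦ -(((p + 1 + k : ℕ) : K)⁻¹ • c.radial b (ρ k))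
  have hθ : ∀ k v, θ k v ∈ c.ideal (k + 1) := fun k v ↦ by
    have h2 := Submodule.smul_mem _ (algebraMap K R ((p + 1 + k : ℕ) : K)⁻¹)
      (radial_mem (b := b) (hmem k) v)
    rw [algebraMap_smul] at h2
    exact neg_mem h2
  have hstep : ∀ n, ∑ k ∈ Finset.range n, koszulHom D hD p (θ k) = ω - ρ n := by
    intro n
    induction n with
    | zero => exact (sub_self ω).symm
    | succ n ih =>
      rw [Finset.sum_range_succ, ih, hρ, map_neg, map_smul]
      abel
  let η : L [⋀^Fin p]→ₗ[R] A := c.tsum.compAlternatingMap (AlternatingMap.pi θ)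
  have hη : ∀ n v, (η - ∑ k ∈ Finset.range n, θ k) v ∈ c.ideal n := by
    intro n v
    rw [AlternatingMap.sub_apply, alternatingMap_sum_apply]
    exact tsum_sub_mem (a := fun k ↦ θ k v) (fun k ↦ ideal_mono (Nat.le_succ k) (hθ k v)) n
  refine ⟨η, AlternatingMap.ext fun v ↦ sub_eq_zero.mp (eq_zero_of_mem_ideal (c := c) fun n ↦ ?_)⟩
  -- The differential may lower the order of vanishing by one, so the partial sum is taken one step
  -- further than the order wanted.
  have h1 : koszulHom D hD p η - ω =
      koszulHom D hD p (η - ∑ k ∈ Finset.range (n + 1), θ k) - ρ (n + 1) := by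
    rw [map_sub, map_sum, hstep]
    abel
  have h2 := congrArg (fun f ↦ f v) h1
  refine (congrArg (· ∈ c.ideal n) h2).mpr (sub_mem ?_ (ideal_mono (Nat.le_succ n) (hmem _ v)))
  exact koszulFun_mem D (ideal_mono (Nat.le_succ n)) (fun x m hm ↦ hlead.conn_mem x hm)
    (hη (n + 1)) v

end Coord

end LieRinehart

/-! ### Operators of bounded order along a frame; flat operators. -/

namespace LieRinehart

section OfValues

variable {K R L M ι : Type*} [Field K] [CharZero K] [CommRing R] [Algebra K R] [AddCommGroup L]
  [Module R L] [AddCommGroup M] [Module K M] [Module R M] [IsScalarTower K R M] [Fintype ι]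

/-- The multilinear map with given values on a basis. -/
noncomputable def multilinearOfValues (b : Module.Basis ι R L) {p : ℕ} (y : (Fin p → ι) → M) :
    MultilinearMap R (fun _ : Fin p ↦ L) M :=
  ∑ J : Fin p → ι, (MultilinearMap.mkPiRing R (Fin p) (y J)).compLinearMap fun i ↦ b.coord (J i)

theorem multilinearOfValues_apply (b : Module.Basis ι R L) {p : ℕ} (y : (Fin p → ι) → M)
    (v : Fin p → L) :
    multilinearOfValues b y v = ∑ J : Fin p → ι, (∏ i, b.repr (v i) (J i)) • y J := by
  simp [multilinearOfValues]

variable (K) in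
/-- The alternating map with given (alternating) values on a basis. -/
noncomputable def alternatingOfValues (b : Module.Basis ι R L) {p : ℕ} (y : (Fin p → ι) → M) :
    L [⋀^Fin p]→ₗ[R] M :=
  (p.factorial : K)⁻¹ • MultilinearMap.alternatization (multilinearOfValues b y)

theorem alternatingOfValues_apply (b : Module.Basis ι R L) {p : ℕ} (y : (Fin p → ι) → M)
    (v : Fin p → L) : alternatingOfValues K b y v = (p.factorial : K)⁻¹ •
      ∑ σ : Equiv.Perm (Fin p), Equiv.Perm.sign σ •
        ∑ J : Fin p → ι, (∏ i, b.repr (v (σ i)) (J i)) • y J := by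
  simp [alternatingOfValues, MultilinearMap.alternatization_apply, multilinearOfValues_apply]

theorem alternatingOfValues_self (b : Module.Basis ι R L) {p : ℕ} (η : L [⋀^Fin p]→ₗ[R] M) :
    alternatingOfValues K b (fun J ↦ η (b ∘ J)) = η := by
  classical
  have h : multilinearOfValues b (fun J ↦ η (b ∘ J)) = η.toMultilinearMap := by
    refine Module.Basis.ext_multilinear (fun _ ↦ b) fun J ↦ ?_
    rw [multilinearOfValues_apply, Finset.sum_eq_single J]
    · simp [Function.comp_def]
    · intro J' _ hJ'
      obtain ⟨i, hi⟩ := Function.ne_iff.mp hJ'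
      rw [Finset.prod_eq_zero (Finset.mem_univ i), zero_smul]
      simp [Ne.symm hi]
    · simp
  have hp : (p.factorial : K) ≠ 0 := Nat.cast_ne_zero.mpr p.factorial_ne_zero
  rw [alternatingOfValues, h, AlternatingMap.coe_alternatization, Fintype.card_fin,
    ← Nat.cast_smul_eq_nsmul K, smul_smul, inv_mul_cancel₀ hp, one_smul]

/-- Naturality of the extension from basis values; with restriction maps for `f` and `g` it makes
the extensions in `Frame.exists_form` compatible. -/
theorem alternatingOfValues_map {R' L' M' : Type*} [CommRing R'] [Algebra K R'] [AddCommGroup L']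
    [Module R' L'] [AddCommGroup M'] [Module K M'] [Module R' M'] [IsScalarTower K R' M']
    (b : Module.Basis ι R L) (b' : Module.Basis ι R' L') (σ : R →+* R') (f : L → L')
    (hf : ∀ x i, b'.repr (f x) i = σ (b.repr x i)) (g : M →ₗ[K] M')
    (hg : ∀ a m, g (a • m) = σ a • g m) {p : ℕ} (y : (Fin p → ι) → M) (v : Fin p → L) :
    g (alternatingOfValues K b y v) = alternatingOfValues K b' (g ∘ y) (f ∘ v) := by
  rw [alternatingOfValues_apply, alternatingOfValues_apply, map_smul, map_sum]
  simp only [Units.smul_def, map_zsmul, map_sum, hg, Function.comp_apply, hf, map_prod]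

theorem alternatingMap_mem (b : Module.Basis ι R L) (S : Submodule R M) {p : ℕ}
    (ω : L [⋀^Fin p]→ₗ[R] M) (h : ∀ J : Fin p → ι, ω (b ∘ J) ∈ S) (v : Fin p → L) : ω v ∈ S := by
  have h0 : S.mkQ.compAlternatingMap ω = 0 := by
    refine Module.Basis.ext_alternating b fun J _ ↦ ?_
    exact (Submodule.Quotient.mk_eq_zero S).mpr (h J)
  exact (Submodule.Quotient.mk_eq_zero S).mp (congrArg (fun f ↦ f v) h0)

end OfValues

section Decomposition

variable {K R L M N κ : Type*} [Field K] [CharZero K] [CommRing R] [Algebra K R]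
  [LieRing L] [LieAlgebra K L] [Module R L] [LieRingModule L R] [LieRinehartRing R L]
  [LieRinehartAlgebra K R L] [AddCommGroup M] [Module K M] [Module R M] [IsScalarTower K R M]
  [AddCommGroup N] [Module K N] [Module R N] [IsScalarTower K R N] [Fintype κ]

/-- The closed forms with values in a sum of copies of a module are exact if those with values in
the module are. -/
theorem exists_primitive_of_decomposition (D : L →ₗ[R] Module.End K M)
    (hD : ∀ (x : L) (a : R) (m : M), D x (a • m) = a • D x m + ⁅x, a⁆ • m)
    (D' : L →ₗ[R] Module.End K N)
    (hD' : ∀ (x : L) (a : R) (m : N), D' x (a • m) = a • D' x m + ⁅x, a⁆ • m)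
    (g : κ → M →ₗ[R] N) (f : κ → N →ₗ[R] M) (hg : ∀ k x m, D' x (g k m) = g k (D x m))
    (hinj : ∀ m : κ → M, ∑ k, g k (m k) = 0 → m = 0) {p : ℕ}
    (hM : ∀ θ : L [⋀^Fin (p + 1)]→ₗ[R] M, koszul D hD θ = 0 → ∃ η, koszul D hD η = θ)
    {ω : L [⋀^Fin (p + 1)]→ₗ[R] N} (hω : koszul D' hD' ω = 0)
    (hsum : ∀ v, ∑ k, g k (f k (ω v)) = ω v) : ∃ η, koszul D' hD' η = ω := by
  have hkos : ∀ {q : ℕ} (ξ : κ → L [⋀^Fin q]→ₗ[R] M) (v : Fin (q + 1) → L),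
      koszulFun D' (∑ k, (g k).compAlternatingMap (ξ k)) v =
        ∑ k, g k (koszulFun D (ξ k) v) := by
    intro q ξ v
    have h := congrArg (fun f ↦ f v) (map_sum (koszulHom D' hD' q)
      (fun k ↦ (g k).compAlternatingMap (ξ k)) Finset.univ)
    rw [alternatingMap_sum_apply] at h
    exact h.trans (Finset.sum_congr rfl fun k _ ↦ koszulFun_comp D D' (g k) (hg k) (ξ k) v)
  have hdec : ∑ k, (g k).compAlternatingMap ((f k).compAlternatingMap ω) = ω :=
    AlternatingMap.ext fun v ↦ by
      rw [alternatingMap_sum_apply]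
      exact hsum v
  -- The maps `g k` commute with the connections and are jointly independent, so closedness of the
  -- sum passes to each component.
  have hcl : ∀ k, koszul D hD ((f k).compAlternatingMap ω) = 0 := by
    have h : ∀ v, (fun k ↦ koszulFun D ((f k).compAlternatingMap ω) v) = 0 := fun v ↦
      hinj _ (by
        rw [← hkos (fun k ↦ (f k).compAlternatingMap ω) v, hdec]
        exact congrArg (fun f ↦ f v) hω)
    exact fun k ↦ AlternatingMap.ext fun v ↦ congrFun (h v) k
  choose η hη using fun k ↦ hM _ (hcl k)
  refine ⟨∑ k, (g k).compAlternatingMap (η k), AlternatingMap.ext fun v ↦ ?_⟩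
  rw [koszul_apply, hkos, ← hsum v]
  exact Finset.sum_congr rfl fun k _ ↦ congrArg (g k) (congrArg (fun f ↦ f v) (hη k))

end Decomposition

namespace LieAlgebroid

variable {K : Type u} [Field K] {X : TopCat.{u}} {𝒪 : TopCat.Sheaf (CommAlgCat.{u} K) X}
  {𝓛 : LieAlgebroid 𝒪}

namespace Frame

variable {ι : Type*} {U : Opens X} (F : Frame 𝓛 ι U)

theorem repr_res [Fintype ι] {V W : Opens X} (hV : V ≤ U) (h : W ≤ V) (x : 𝓛.sec V) (i : ι) :
    (F.basis W (h.trans hV)).repr (𝓛.res h x) i = Fn.res 𝒪 h ((F.basis V hV).repr x i) := by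
  have h1 : 𝓛.res h x = ∑ j, Fn.res 𝒪 h ((F.basis V hV).repr x j) • F.basis W (h.trans hV) j := by
    have h2 := congrArg (𝓛.res h).toLieHom.toLinearMap ((F.basis V hV).sum_repr x)
    rw [map_sum] at h2
    refine h2.symm.trans (Finset.sum_congr rfl fun j _ ↦ ?_)
    rw [F.res_basis V W hV h]
    exact (𝓛.res h).map_smul_apply _ _
  classical
  rw [h1, map_sum]
  simp [Finsupp.single_apply, Finsupp.finsetSum_apply]

/-- Forms on an open subset with a frame are determined by their component on that subset. -/
theorem form_ext (F : Frame 𝓛 ι U) {p : ℕ} {ω η : 𝓛.FormSec p U}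
    (h : ω.on U le_rfl = η.on U le_rfl) : ω = η := by
  refine FormSec.ext fun V hV ↦ Module.Basis.ext_alternating (F.basis V hV) fun J _ ↦ ?_
  have hJ : F.basis V hV ∘ J = 𝓛.res hV ∘ (F.basis U le_rfl ∘ J) :=
    funext fun i ↦ F.res_basis U V le_rfl hV (J i)
  change ω.on V hV (F.basis V hV ∘ J) = η.on V hV (F.basis V hV ∘ J)
  rw [hJ, ← ω.compat le_rfl hV, ← η.compat le_rfl hV, h]

/-- Over each smaller open subset the restricted values on the frame are extended by
`alternatingOfValues`, which over `U` gives back `η`. -/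
theorem exists_form [Fintype ι] [CharZero K] (F : Frame 𝓛 ι U) {p : ℕ}
    (η : 𝓛.sec U [⋀^Fin p]→ₗ[Fn 𝒪 U] 𝓛.DiffSec U) :
    ∃ θ : 𝓛.FormSec p U, θ.on U le_rfl = η := by
  have hres : ∀ (V W : Opens X) (hV : V ≤ U) (h : W ≤ V) (v : Fin p → 𝓛.sec V),
      diffRes h (alternatingOfValues K (F.basis V hV)
          (fun J ↦ diffRes hV (η (F.basis U le_rfl ∘ J))) v) =
        alternatingOfValues K (F.basis W (h.trans hV))
          (fun J ↦ diffRes (h.trans hV) (η (F.basis U le_rfl ∘ J))) (𝓛.res h ∘ v) := by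
    intro V W hV h v
    exact alternatingOfValues_map (F.basis V hV) (F.basis W (h.trans hV))
      (Fn.res 𝒪 h : Fn 𝒪 V →+* Fn 𝒪 W) (𝓛.res h) (fun x i ↦ F.repr_res hV h x i)
      (diffRes h : 𝓛.DiffSec V →ₐ[K] 𝓛.DiffSec W).toLinearMap (fun a m ↦ diffRes_smul h a m)
      (fun J ↦ diffRes hV (η (F.basis U le_rfl ∘ J))) v
  refine ⟨FormSec.mk (fun V hV ↦ alternatingOfValues K (F.basis V hV) fun J ↦
    diffRes hV (η (F.basis U le_rfl ∘ J))) hres, ?_⟩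
  rw [FormSec.mk_on]
  exact alternatingOfValues_self (F.basis U le_rfl) η

end Frame

/-- The operator of multiplication by a jet. -/
def jetMul (U : Opens X) : 𝓛.JetSec U →ₗ[Fn 𝒪 U] 𝓛.DiffSec U where
  toFun f := DiffSec.mk (fun V h ↦ LinearMap.mulLeft (Fn 𝒪 V) (jetRes h f))
    (fun V W hV h φ ↦ by
      rw [LinearMap.mulLeft_apply, LinearMap.mulLeft_apply, map_mul]
      rfl)
    (fun x hx ↦ ⟨U, le_rfl, hx, 0, fun W h ↦ IsDiffOp.mulLeft _⟩)
  map_add' f g := DiffSec.ext fun V h ↦ LinearMap.ext fun φ ↦ by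
    simp [add_mul]
  map_smul' a f := DiffSec.ext fun V h ↦ LinearMap.ext fun φ ↦ by
    simp [jetRes_smul]

theorem jetMul_on {U : Opens X} (f : 𝓛.JetSec U) (V : Opens X) (h : V ≤ U) :
    (jetMul U f).on V h = LinearMap.mulLeft (Fn 𝒪 V) (jetRes h f) := rfl

/-- The operator `φ ↦ f (D ·₂ φ)`, as a function of the jet `f`. -/
def jetMulEnv {U : Opens X} (D : 𝓛.EnvSec U) : 𝓛.JetSec U →ₗ[Fn 𝒪 U] 𝓛.DiffSec U :=
  LinearMap.mulRight (Fn 𝒪 U) (envToDiff U D) ∘ₗ jetMul U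

theorem jetMulEnv_apply {U : Opens X} (D : 𝓛.EnvSec U) (f : 𝓛.JetSec U) :
    jetMulEnv D f = jetMul U f * envToDiff U D := rfl

theorem diffConn_jetMul {U : Opens X} (x : 𝓛.sec U) (f : 𝓛.JetSec U) :
    diffConn U x (jetMul U f) = jetMul U (jetConn U x f) :=
  DiffSec.ext fun V h ↦ LinearMap.ext fun φ ↦ by
    rw [diffConn_on, connCommutator_apply, jetMul_on, jetMul_on, LinearMap.mulLeft_apply,
      LinearMap.mulLeft_apply, LinearMap.mulLeft_apply, jetConn_mul, jetRes_conn]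
    abel

/-- The second action commutes with `∇⁽¹⁾`, so only the coefficient is differentiated; this makes
the decomposition of operators one of modules with connection. -/
theorem diffConn_jetMulEnv {U : Opens X} (x : 𝓛.sec U) (D : 𝓛.EnvSec U) (f : 𝓛.JetSec U) :
    diffConn U x (jetMulEnv D f) = jetMulEnv D (jetConn U x f) := by
  rw [jetMulEnv_apply, jetMulEnv_apply, diffConn_mul, diffConn_envToDiff, mul_zero, add_zero,
    diffConn_jetMul]

variable (𝓛) in
/-- The differential operators of order at most `n` on every open subset. -/
def diffLE (n : ℕ) (U : Opens X) : Submodule (Fn 𝒪 U) (𝓛.DiffSec U) where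
  carrier := {P | ∀ (V : Opens X) (h : V ≤ U), IsDiffOp (Fn 𝒪 V) n (P.on V h)}
  add_mem' hP hQ V h := (hP V h).add (hQ V h)
  zero_mem' V h := IsDiffOp.zero n
  smul_mem' a P hP V h := by
    rw [DiffSec.smul_on]
    exact (hP V h).smul _

theorem exists_diffRes_mem_diffLE {κ : Type*} [Finite κ] {U : Opens X} (P : κ → 𝓛.DiffSec U)
    {x : X} (hx : x ∈ U) : ∃ (V : Opens X) (h : V ≤ U), x ∈ V ∧
      ∃ n, ∀ k, diffRes h (P k) ∈ 𝓛.diffLE n V := by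
  have := Fintype.ofFinite κ
  choose V hV hxV n hn using fun k ↦ (P k).order x hx
  let V' : Opens X := ⟨⋂ k, (V k : Set X), isOpen_iInter_of_finite fun k ↦ (V k).2⟩
  have hV' : ∀ k, V' ≤ V k := fun k ↦ Set.iInter_subset (fun k ↦ (V k : Set X)) k
  refine ⟨V' ⊓ U, inf_le_right, ⟨Set.mem_iInter.mpr hxV, hx⟩, Finset.univ.sup n, fun k W hW ↦ ?_⟩
  exact (hn k W ((hW.trans inf_le_left).trans (hV' k))).mono (Finset.le_sup (Finset.mem_univ k))

/-- The component of a differential operator on the whole open subset. -/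
def DiffSec.onTop (U : Opens X) : 𝓛.DiffSec U →ₗ[Fn 𝒪 U] Module.End (Fn 𝒪 U) (𝓛.JetSec U) where
  toFun P := P.on U le_rfl
  map_add' _ _ := rfl
  map_smul' a P := by
    rw [DiffSec.smul_on, Fn.res_refl]
    rfl

theorem DiffSec.onTop_apply {U : Opens X} (P : 𝓛.DiffSec U) :
    DiffSec.onTop U P = P.on U le_rfl := rfl

/-- A form is determined by its finitely many values on a frame. Each has finite order near `x`, so
a finite intersection of neighbourhoods carries a uniform bound. -/
theorem exists_formRes_mem_diffLE {r p : ℕ} (hr : 𝓛.IsLocallyFreeOfRank r) {U : Opens X}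
    (ω : 𝓛.FormSec p U) {x : X} (hx : x ∈ U) :
    ∃ (V : Opens X) (h : V ≤ U), x ∈ V ∧ Nonempty (Frame 𝓛 (Fin r) V) ∧
      ∃ n, ∀ v, ω.on V h v ∈ 𝓛.diffLE n V := by
  obtain ⟨U₀, hx₀, ⟨F⟩⟩ := hr.exists_frame x
  let W := U ⊓ U₀
  have hW : W ≤ U := inf_le_left
  let G : Frame 𝓛 (Fin r) W := F.restrict inf_le_right
  obtain ⟨V, h, hxV, n, hn⟩ := exists_diffRes_mem_diffLE
    (fun J : Fin p → Fin r ↦ ω.on W hW (G.basis W le_rfl ∘ J)) (x := x) ⟨hx, hx₀⟩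
  refine ⟨V, h.trans hW, hxV, ⟨G.restrict h⟩, n, fun v ↦ ?_⟩
  refine alternatingMap_mem (G.basis V h) _ _ (fun J ↦ ?_) v
  have hJ : G.basis V h ∘ J = 𝓛.res h ∘ (G.basis W le_rfl ∘ J) :=
    funext fun i ↦ G.res_basis W V le_rfl h (J i)
  rw [hJ, ← ω.compat hW h]
  exact hn J

namespace Frame

variable {ι : Type*} {U : Opens X} (F : Frame 𝓛 ι U) [LinearOrder ι] [Fintype ι] [CharZero K]

/-- An operator of order at most `n` over `V` is determined by its values on monomials in the
coordinates, and these monomials are restrictions from `U`. -/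
theorem diff_ext {n : ℕ} {P Q : 𝓛.DiffSec U} (hP : P ∈ 𝓛.diffLE n U) (hQ : Q ∈ 𝓛.diffLE n U)
    (h : P.on U le_rfl = Q.on U le_rfl) (F : Frame 𝓛 ι U) : P = Q := by
  refine DiffSec.ext fun V hV ↦ ?_
  have h1 : IsDiffOp (Fn 𝒪 V) n (P.on V hV + (-1 : ℤ) • Q.on V hV) := (hP V hV).add ((hQ V hV).smul _)
  have h2 := Coord.isDiffOp_eq_zero (c := (F.restrict hV).coord) K h1 fun B _ ↦ ?_
  · rwa [neg_one_smul, ← sub_eq_add_neg, sub_eq_zero] at h2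
  · rw [neg_one_smul, ← sub_eq_add_neg, LinearMap.sub_apply, ← F.jetRes_varProd hV,
      ← P.compat le_rfl hV, ← Q.compat le_rfl hV, h, sub_self]

/-- The second action of the monomials of degree at most `n` on jets. -/
noncomputable def monOp (n : ℕ) (M : BddMon ι n) : Module.End (Fn 𝒪 U) (𝓛.JetSec U) :=
  jetActTwo U (PBW.ordMon K F.top M.1)

theorem isDiffOp_monOp (n : ℕ) (M : BddMon ι n) : IsDiffOp (Fn 𝒪 U) n (F.monOp n M) :=
  (isDiffOp_actTwo_ordMon F.top M.1).mono M.2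

theorem jetMulEnv_mem_diffLE (n : ℕ) (M : BddMon ι n) (f : 𝓛.JetSec U) :
    jetMulEnv (PBW.ordMon K F.top M.1) f ∈ 𝓛.diffLE n U := fun V hV ↦ by
  have h := F.envRes_ordMon le_rfl hV M.1
  rw [jetMulEnv_apply, DiffSec.mul_on, jetMul_on, envToDiff_on, top, h]
  have := (IsDiffOp.mulLeft (R := Fn 𝒪 V) (jetRes hV f)).mul
    ((isDiffOp_actTwo_ordMon (F.basis V hV) M.1).mono M.2)
  rwa [zero_add] at this

theorem jetMulEnv_on_top (D : 𝓛.EnvSec U) (f : 𝓛.JetSec U) :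
    (jetMulEnv D f).on U le_rfl = LinearMap.mulLeft (Fn 𝒪 U) f * jetActTwo U D := by
  rw [jetMulEnv_apply, DiffSec.mul_on, jetMul_on, envToDiff_on, envRes_refl]
  rfl

/-- The coefficients of a differential operator of order at most `n`. -/
noncomputable def diffCoeff (n : ℕ) (M : BddMon ι n) : 𝓛.DiffSec U →ₗ[Fn 𝒪 U] 𝓛.JetSec U :=
  F.coord.coeffs (F.monOp n) M ∘ₗ DiffSec.onTop U

theorem onTop_sum (n : ℕ) (f : BddMon ι n → 𝓛.JetSec U) :
    DiffSec.onTop U (∑ M, jetMulEnv (PBW.ordMon K F.top M.1) (f M)) =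
      ∑ M, LinearMap.mulLeft (Fn 𝒪 U) (f M) * F.monOp n M := by
  rw [map_sum]
  exact Finset.sum_congr rfl fun M _ ↦ jetMulEnv_on_top _ _

theorem sum_diffCoeff {n : ℕ} {P : 𝓛.DiffSec U} (hP : P ∈ 𝓛.diffLE n U) :
    ∑ M, jetMulEnv (PBW.ordMon K F.top M.1) (F.diffCoeff n M P) = P := by
  refine diff_ext (n := n) (sum_mem fun M _ ↦ F.jetMulEnv_mem_diffLE n M _) hP ?_ F
  rw [← DiffSec.onTop_apply, onTop_sum]
  exact Coord.sum_coeffs K (fun M φ ↦ F.coord_actTwo φ M.1) (F.isDiffOp_monOp n) (hP U le_rfl)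

theorem eq_zero_of_sum_jetMulEnv {n : ℕ} {f : BddMon ι n → 𝓛.JetSec U}
    (h : ∑ M, jetMulEnv (PBW.ordMon K F.top M.1) (f M) = 0) : f = 0 := by
  refine Coord.eq_zero_of_sum_eq_zero (c := F.coord) (E := F.monOp n) K
    (fun M φ ↦ F.coord_actTwo φ M.1) ?_
  rw [← onTop_sum, h, map_zero]

theorem isCoordConn : F.coord.IsCoordConn F.top (jetConn U) := fun _ _ hφ _ _ hM ↦ F.coord_conn hφ hM

/-- The order bound makes the decomposition into jet coefficients finite, and the Poincaré lemma for
jets applies to each coefficient. -/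
theorem exists_primitive (F : Frame 𝓛 ι U) {n p : ℕ} {ω : 𝓛.sec U [⋀^Fin (p + 1)]→ₗ[Fn 𝒪 U] 𝓛.DiffSec U}
    (hω : koszul (diffConn U) diffConn_smul ω = 0) (hn : ∀ v, ω v ∈ 𝓛.diffLE n U) :
    ∃ η : 𝓛.sec U [⋀^Fin p]→ₗ[Fn 𝒪 U] 𝓛.DiffSec U, koszul (diffConn U) diffConn_smul η = ω := by
  exact exists_primitive_of_decomposition (jetConn U) jetConn_smul (diffConn U) diffConn_smul
    (fun M : BddMon ι n ↦ jetMulEnv (PBW.ordMon K F.top M.1)) (fun M ↦ F.diffCoeff n M)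
    (fun M x f ↦ diffConn_jetMulEnv x _ f) (fun f hf ↦ F.eq_zero_of_sum_jetMulEnv hf)
    (fun θ hθ ↦ F.isCoordConn.exists_primitive (K := K) jetConn_smul jetConn_mul jetConn_lie hθ)
    hω (fun v ↦ F.sum_diffCoeff (hn v))

end Frame

/-- For a vector `D` this is flatness and for a function it is linearity; these generate the
enveloping algebra. -/
theorem Jet.apply_mul_of_conn_eq_zero {R L : Type*} [CommRing R] [Algebra K R] [LieRing L]
    [LieAlgebra K L] [Module R L] [LieRingModule L R] [LieRinehartRing R L]
    [LieRinehartAlgebra K R L] {φ : Jet K R L} (h : ∀ x, Jet.conn x φ = 0) (D E : Env K R L) :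
    φ (D * E) = Env.act K R L D (φ E) := by
  let S : Subalgebra K (Env K R L) :=
    { carrier := {D | ∀ E, φ (D * E) = Env.act K R L D (φ E)}
      mul_mem' := fun {D D'} hD hD' E ↦ by
        rw [mul_assoc, hD, hD', map_mul, Module.End.mul_apply]
      add_mem' := fun {D D'} hD hD' E ↦ by
        rw [add_mul, map_add, hD, hD', map_add, LinearMap.add_apply]
      algebraMap_mem' := fun c E ↦ by
        rw [← AlgHom.commutes (Env.fn K R L), Jet.map_fn_mul, Env.act_fn] }
  refine Env.mem_of_generators S (fun a E ↦ ?_) (fun x E ↦ ?_) D E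
  · rw [Jet.map_fn_mul, Env.act_fn]
  · have := congrArg (fun ψ : Jet K R L ↦ ψ E) (h x)
    simp only [Jet.conn_apply, Jet.zero_apply, sub_eq_zero] at this
    rw [← this, Env.act_vec]

/-- A flat jet is determined by its value `a` at `1`: it is `D ↦ D(a)`, which is `D ↦ ε(D a)`. -/
theorem Jet.eq_actTwo_of_conn_eq_zero {R L : Type*} [CommRing R] [Algebra K R] [LieRing L]
    [LieAlgebra K L] [Module R L] [LieRingModule L R] [LieRinehartRing R L]
    [LieRinehartAlgebra K R L] {φ : Jet K R L} (h : ∀ x, Jet.conn x φ = 0) :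
    φ = Jet.actTwo (Env.fn K R L (φ 1)) 1 := by
  ext D
  rw [Jet.actTwo_apply, Jet.one_apply, Env.counit_mul_fn, ← apply_mul_of_conn_eq_zero h, mul_one]

namespace Frame

variable {ι : Type*} {U : Opens X} [LinearOrder ι] [Fintype ι]

theorem eq_actTwo_of_conn_eq_zero (F : Frame 𝓛 ι U) {f : 𝓛.JetSec U}
    (h : ∀ x, jetConn U x f = 0) :
    ∃ a, f = jetActTwo U (Env.fn K (Fn 𝒪 U) (𝓛.sec U) a) 1 := by
  have h1 : ∀ x, Jet.conn x (f.on U le_rfl) = 0 := fun x ↦ by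
    have := congrArg (fun g : 𝓛.JetSec U ↦ g.on U le_rfl) (h x)
    simp only [jetConn_on, 𝓛.res_refl] at this
    exact this
  refine ⟨f.on U le_rfl 1, F.onTop_bijective.1 ?_⟩
  refine (Jet.eq_actTwo_of_conn_eq_zero h1).trans ?_
  change _ = Jet.actTwo (𝓛.envRes le_rfl _) _
  rw [envRes_refl]
  rfl

theorem jetMul_actTwo_fn (a : Fn 𝒪 U) :
    jetMul U (jetActTwo U (Env.fn K (Fn 𝒪 U) (𝓛.sec U) a) 1) =
      envToDiff U (Env.fn K (Fn 𝒪 U) (𝓛.sec U) a) :=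
  DiffSec.ext fun V hV ↦ LinearMap.ext fun φ ↦ by
    rw [jetMul_on, envToDiff_on, LinearMap.mulLeft_apply, jetRes_actTwo, envRes, Env.map_fn]
    refine JetSec.ext fun W hW ↦ ?_
    rw [JetSec.mul_on, jetActTwo_on, jetActTwo_on, envRes, Env.map_fn, ← Jet.actTwo_fn_mul]
    congr 1
    exact one_mul _

/-- By uniqueness of the coefficients a flat operator has flat ones. Multiplication by a flat jet is
the second action of a function, so the whole expansion is the second action of one element. -/
theorem exists_eq_envToDiff [CharZero K] (F : Frame 𝓛 ι U) {n : ℕ} {P : 𝓛.DiffSec U}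
    (hP : P ∈ 𝓛.diffLE n U) (h : ∀ x, diffConn U x P = 0) : ∃ D, envToDiff U D = P := by
  have h1 : ∀ (M : BddMon ι n) (x : 𝓛.sec U), jetConn U x (F.diffCoeff n M P) = 0 := by
    intro M x
    have h2 : (fun M ↦ jetConn U x (F.diffCoeff n M P)) = 0 := F.eq_zero_of_sum_jetMulEnv (by
      rw [← h x]
      conv_rhs => rw [← F.sum_diffCoeff hP, map_sum]
      simp only [diffConn_jetMulEnv])
    exact congrFun h2 M
  choose a ha using fun M ↦ F.eq_actTwo_of_conn_eq_zero (h1 M)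
  refine ⟨∑ M, Env.fn K (Fn 𝒪 U) (𝓛.sec U) (a M) * PBW.ordMon K F.top M.1, ?_⟩
  rw [map_sum]
  refine (Finset.sum_congr rfl fun M _ ↦ ?_).trans (F.sum_diffCoeff hP)
  rw [map_mul, jetMulEnv_apply, ← jetMul_actTwo_fn, ← ha]

/-- Evaluating `D ·₂ φ` at `1` gives `φ D`, and among the jets are the coordinate functionals of the
monomial basis. -/
theorem envToDiff_injective (F : Frame 𝓛 ι U) : Function.Injective (envToDiff (𝓛 := 𝓛) U) := by
  refine (injective_iff_map_eq_zero _).mpr fun D hD ↦ ?_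
  have h : ∀ φ : Jet K (Fn 𝒪 U) (𝓛.sec U), φ D = 0 := by
    intro φ
    obtain ⟨f, rfl⟩ := F.onTop_bijective.2 φ
    have h1 := congrArg (fun P : 𝓛.DiffSec U ↦ (P.on U le_rfl f).on U le_rfl 1) hD
    simp only [envToDiff_on, jetActTwo_on, envRes_refl, Jet.actTwo_apply, one_mul] at h1
    exact h1
  refine (PBW.basis K F.top).ext_elem fun M ↦ ?_
  rw [map_zero]
  exact h ((PBW.basis K F.top).coord M)

end Frame

end LieAlgebroid

end LieRinehart

/-! ### Local exactness and the quasi-isomorphism of complexes of sheaves. -/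

namespace LieRinehart

/-- A short complex of sheaves is exact if the cocycles are locally coboundaries. -/
theorem sheaf_exact_of_locally {K : Type u} [Field K] {X : TopCat.{u}}
    (S : ShortComplex (TopCat.Sheaf (ModuleCat.{u} K) X))
    (h : ∀ (U : Opens X) (t : S.X₂.obj.obj (op U)), S.g.hom.app (op U) t = 0 → ∀ x ∈ U,
      ∃ (V : Opens X) (hV : V ≤ U), x ∈ V ∧
        ∃ s : S.X₁.obj.obj (op V), S.f.hom.app (op V) s = S.X₂.obj.map (homOfLE hV).op t) :
    S.Exact := by
  -- Exactness becomes local surjectivity onto the kernel sheaf. Sections of the kernel are compared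
  -- inside `S.X₂`, the inclusion being injective on sections.
  rw [S.exact_iff_epi_kernel_lift, ← TopCat.Sheaf.isLocallySurjective_iff_epi,
    TopCat.Presheaf.isLocallySurjective_iff]
  intro U s x hx
  have h0 : Mono (Limits.kernel.ι S.g) := inferInstance
  have hmono : Mono ((Limits.kernel.ι S.g).hom) :=
    (Sheaf.Hom.mono_iff_presheaf_mono _ _ _).mp h0
  have hg : ∀ V, (Limits.kernel.ι S.g).hom.app V ≫ S.g.hom.app V = 0 := fun V ↦
    congrArg (fun f : Limits.kernel S.g ⟶ S.X₃ ↦ f.hom.app V) (Limits.kernel.condition S.g)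
  have hf : ∀ V, (Limits.kernel.lift S.g S.f S.zero).hom.app V ≫
      (Limits.kernel.ι S.g).hom.app V = S.f.hom.app V := fun V ↦
    congrArg (fun f : S.X₁ ⟶ S.X₂ ↦ f.hom.app V) (Limits.kernel.lift_ι S.g S.f S.zero)
  obtain ⟨V, hV, hxV, y, hy⟩ := h U ((Limits.kernel.ι S.g).hom.app (op U) s)
    (ConcreteCategory.congr_hom (hg (op U)) s) x hx
  refine ⟨V, hV, ⟨y, ?_⟩, hxV⟩
  apply (ModuleCat.mono_iff_injective _).mp ((NatTrans.mono_iff_mono_app _).mp hmono (op V))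
  exact ((ConcreteCategory.congr_hom (hf (op V)) y).trans hy).trans
    (ConcreteCategory.congr_hom ((Limits.kernel.ι S.g).hom.naturality (homOfLE hV).op) s).symm

namespace LieAlgebroid

variable {K : Type u} [Field K] [CharZero K] {X : TopCat.{u}}
  {𝒪 : TopCat.Sheaf (CommAlgCat.{u} K) X} {𝓛 : LieAlgebroid 𝒪}

/-- After shrinking to a frame with bounded order, the equation is solved over `V` alone;
`exists_form` spreads the solution to smaller opens and `form_ext` reduces the check to `V`. -/
theorem IsLocallyFreeOfRank.exists_formD_eq {r p : ℕ} (hr : 𝓛.IsLocallyFreeOfRank r)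
    {U : Opens X} {ω : 𝓛.FormSec (p + 1) U} (hω : formD (p + 1) U ω = 0) {x : X} (hx : x ∈ U) :
    ∃ (V : Opens X) (h : V ≤ U), x ∈ V ∧ ∃ η : 𝓛.FormSec p V, formD p V η = formRes h ω := by
  obtain ⟨V, h, hxV, ⟨F⟩, n, hn⟩ := exists_formRes_mem_diffLE hr ω hx
  obtain ⟨η, hη⟩ := F.exists_primitive (ω := ω.on V h)
    (congrArg (fun θ : 𝓛.FormSec (p + 2) U ↦ θ.on V h) hω) hn
  obtain ⟨θ, hθ⟩ := F.exists_form η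
  refine ⟨V, h, hxV, θ, F.form_ext ?_⟩
  change koszul (diffConn V) diffConn_smul (θ.on V le_rfl) = ω.on V h
  rw [hθ, hη]

/-- The differential of a `0`-form evaluated on one vector is the connection, so a closed `0`-form
is a flat operator. -/
theorem IsLocallyFreeOfRank.exists_envToForm_eq {r : ℕ} (hr : 𝓛.IsLocallyFreeOfRank r)
    {U : Opens X} {ω : 𝓛.FormSec 0 U} (hω : formD 0 U ω = 0) {x : X} (hx : x ∈ U) :
    ∃ (V : Opens X) (h : V ≤ U), x ∈ V ∧ ∃ D : 𝓛.EnvSec V, envToForm V D = formRes h ω := by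
  obtain ⟨V, h, hxV, ⟨F⟩, n, hn⟩ := exists_formRes_mem_diffLE hr ω hx
  obtain ⟨D, hD⟩ := F.exists_eq_envToDiff (hn ![]) fun y ↦ by
    rw [← koszulFun_cons_zero]
    exact congrArg (fun θ : 𝓛.FormSec 1 U ↦ θ.on V h (Fin.cons y ![])) hω
  refine ⟨V, h, hxV, D, F.form_ext (AlternatingMap.ext fun v ↦ ?_)⟩
  rw [Subsingleton.elim v ![], formRes_on, ← hD]
  exact congrArg (envToDiff V) (𝓛.envRes_refl D)

theorem IsLocallyFreeOfRank.exists_envRes_eq {r : ℕ} (hr : 𝓛.IsLocallyFreeOfRank r)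
    {U : Opens X} {D E : 𝓛.EnvSec U} (hDE : envToForm U D = envToForm U E) {x : X} (hx : x ∈ U) :
    ∃ (V : Opens X) (h : V ≤ U), x ∈ V ∧ 𝓛.envRes h D = 𝓛.envRes h E := by
  obtain ⟨W, hxW, ⟨F⟩⟩ := hr.exists_frame x
  exact ⟨U ⊓ W, inf_le_left, ⟨hx, hxW⟩, (F.restrict inf_le_right).envToDiff_injective
    (congrArg (fun θ : 𝓛.FormSec 0 U ↦ θ.on (U ⊓ W) inf_le_left ![]) hDE)⟩

theorem toSheafify_envToFormSheaf (h : 𝓛.IsSheafOfDGAlgebras) :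
    toSheafify (Opens.grothendieckTopology X) 𝓛.envPresheaf ≫ (envToFormSheaf h).hom =
      𝓛.envToFormHom := toSheafify_sheafifyLift _ _ _

/-- Local injectivity on the presheaf passes to the sheafification, because every section of the
latter comes locally from the presheaf. -/
theorem mono_envToFormSheaf {r : ℕ} (hr : 𝓛.IsLocallyFreeOfRank r) (h : 𝓛.IsSheafOfDGAlgebras) :
    Mono (envToFormSheaf h) := by
  have h1 : Presheaf.IsLocallyInjective (Opens.grothendieckTopology X) 𝓛.envToFormHom :=
    ⟨fun {U} D E hDE x hx ↦ by
      obtain ⟨V, hV, hxV, hVDE⟩ := hr.exists_envRes_eq (U := U.unop) hDE hx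
      exact ⟨V, homOfLE hV, hVDE, hxV⟩⟩
  have h2 : Presheaf.IsLocallyInjective (Opens.grothendieckTopology X)
      (toSheafify (Opens.grothendieckTopology X) 𝓛.envPresheaf ≫ (envToFormSheaf h).hom) := by
    rw [toSheafify_envToFormSheaf]
    exact h1
  have h3 : Sheaf.IsLocallyInjective (envToFormSheaf h) :=
    Presheaf.isLocallyInjective_of_isLocallyInjective_of_isLocallySurjective _
      (toSheafify (Opens.grothendieckTopology X) 𝓛.envPresheaf) _
  exact Sheaf.mono_of_isLocallyInjective _

theorem formComplex_d (h : 𝓛.IsSheafOfDGAlgebras) (p : ℕ) :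
    (formComplex h).d p (p + 1) = formSheafD h p :=
  CochainComplex.of_d (formSheaf h) (formSheafD h) p

theorem exact_envToFormSheaf {r : ℕ} (hr : 𝓛.IsLocallyFreeOfRank r)
    (h : 𝓛.IsSheafOfDGAlgebras) :
    (ShortComplex.mk _ _ (envToFormSheaf_comp_d h)).Exact := by
  refine sheaf_exact_of_locally _ fun U t ht x hx ↦ ?_
  have ht' : formD 0 U t = 0 := by
    have h1 := congrArg (fun f : formSheaf h 0 ⟶ formSheaf h 1 ↦ f.hom.app (op U) t)
      (formComplex_d h 0)
    exact h1.symm.trans ht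
  obtain ⟨V, hV, hxV, D, hD⟩ := hr.exists_envToForm_eq ht' hx
  refine ⟨V, hV, hxV, (toSheafify (Opens.grothendieckTopology X) 𝓛.envPresheaf).app (op V) D, ?_⟩
  have h1 := congrArg (fun f : 𝓛.envPresheaf ⟶ 𝓛.formPresheaf 0 ↦ f.app (op V) D)
    (toSheafify_envToFormSheaf h)
  exact h1.trans hD

theorem exactAt_formComplex {r : ℕ} (hr : 𝓛.IsLocallyFreeOfRank r)
    (h : 𝓛.IsSheafOfDGAlgebras) (p : ℕ) : (formComplex h).ExactAt (p + 1) := by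
  rw [HomologicalComplex.exactAt_iff' _ p (p + 1) (p + 2) (by simp) (by simp)]
  refine sheaf_exact_of_locally _ fun U t ht x hx ↦ ?_
  have ht' : formD (p + 1) U t = 0 := by
    have h1 := congrArg (fun f : formSheaf h (p + 1) ⟶ formSheaf h (p + 2) ↦ f.hom.app (op U) t)
      (formComplex_d h (p + 1))
    exact h1.symm.trans ht
  obtain ⟨V, hV, hxV, η, hη⟩ := hr.exists_formD_eq ht' hx
  refine ⟨V, hV, hxV, η, ?_⟩
  have h1 := congrArg (fun f : formSheaf h p ⟶ formSheaf h (p + 1) ↦ f.hom.app (op V) η)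
    (formComplex_d h p)
  exact h1.trans hη

theorem envInclusion_f_zero (h : 𝓛.IsSheafOfDGAlgebras) :
    (envInclusion h).f 0 = envToFormSheaf h :=
  CochainComplex.fromSingle₀Equiv_symm_apply_f_zero _ _

theorem quasiIso_envInclusion {r : ℕ} (hr : 𝓛.IsLocallyFreeOfRank r)
    (h : 𝓛.IsSheafOfDGAlgebras) : QuasiIso (envInclusion h) := by
  refine ⟨fun i ↦ ?_⟩
  cases i with
  | zero =>
    -- In degree zero the differentials around the source and the one entering the target vanish, so
    -- the claim is that the inclusion is a kernel of the first differential: mono and exact.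
    rw [CochainComplex.quasiIsoAt₀_iff, ShortComplex.quasiIso_iff_of_zeros _ (by simp; rfl)
      (by simp; rfl) (by simp; rfl)]
    have h1 := exact_envToFormSheaf hr h
    have h2 := mono_envToFormSheaf hr h
    rw [← envInclusion_f_zero h] at h2
    simp only [← envInclusion_f_zero h] at h1
    exact ⟨h1, h2⟩
  | succ p =>
    rw [quasiIsoAt_iff_exactAt]
    · exact exactAt_formComplex hr h p
    · exact HomologicalComplex.exactAt_single_obj _ _ _ _ (by simp)

end LieAlgebroid

end LieRinehart

theorem mainTheorem11 {K : Type u} [Field K] [CharZero K] {X : TopCat.{u}}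
    (𝒪 : TopCat.Sheaf (CommAlgCat.{u} K) X) (𝓛 : LieRinehart.LieAlgebroid 𝒪) (r : ℕ)
    (hr : 𝓛.IsLocallyFreeOfRank r) :
    ∃ h : 𝓛.IsSheafOfDGAlgebras, QuasiIso (LieRinehart.LieAlgebroid.envInclusion h) :=
  ⟨𝓛.isSheafOfDGAlgebras, LieRinehart.LieAlgebroid.quasiIso_envInclusion hr _⟩
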